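/- **Setting.** For $A\in\mathbb C^{n\times n}$ with eigenvalues $\lambda_1,\dots,\lambda_n$ (with multiplicity) let $\mu_A=\frac1n\sum_{j}\delta_{\lambda_j}$ be its spectral density, $\|A\|$ its spectral norm, and for compactly supported probability measures on $\mathbb C$ let $\mathcal W_1(\mu,\nu)=\sup_f\left(\int f\,d\mu-\int f\,d\nu\right)$ over all $f:\mathbb C\to\mathbb R$ with Lipschitz constant at most $1$. Let $T_j$ be the Chebyshev polynomials of the first kind, $\widetilde T_0=1/\sqrt\pi$, $\widetilde T_j=\sqrt{2/\pi}\,T_j$ for $j\ge1$, and $$\rho_j=\frac{(m+2-j)\cos\frac{j\pi}{m+2}+\sin\frac{j\pi}{m+2}\cot\frac{\pi}{m+2}}{m+2},\qquad 0\le j\le m.$$ **Algorithm SpecDens$(A,m)$, with scale $s>0$, $s\ge\|A\|$.** Put $\widetilde A=A/s$, $H=(\widetilde A+\widetilde A^*)/2$, $K=(\widetilde A-\widetilde A^*)/(2i)$. Draw $b$ uniformly from the unit sphere of $\mathbb C^n$. By the three-term recurrence compute $x_j=\widetilde T_j(H)b$ and $y_j=\widetilde T_j(K)b$ for $0\le j\le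 m$ (including $x_2,y_2$ even if $m=1$), using $\widetilde A$ and $\widetilde A^*$ only through matrix-vector products. Compute $\Gamma_{jk}=x_j^*y_k$ and output the coefficients $\rho_j\rho_k\Gamma_{jk}$ of $p(x,y)=\sum_{j,k=0}^m\rho_j\rho_k\Gamma_{jk}\widetilde T_j(x)\widetilde T_k(y)$. They represent the measure $\widehat\mu_A$, the image under $(x,y)\mapsto s(x+iy)$ of $$\frac{p(x,y)}{\sqrt{1-x^2}\sqrt{1-y^2}}\,dx\,dy\quad\text{on }[-1,1]^2.$$ The *atomic variant* outputs instead the measure with mass $\left(\frac{\pi}{m+1}\right)^2p(\xi_j,\xi_k)$ at $s(\xi_j+i\xi_k)$, $0\le j,k\le m$, where $\xi_j=\cos\frac{(2j+1)\pi}{2(m+1)}$ (Gauss–Chebyshev discretization); the values $p(\xi_j,\xi_k)$ are computed as inner products $u_j^*v_k$ with $u_j=\sum_a\rho_a\widetilde T_a(\xi_j)x_a$, $v_k=\sum_a\rho_a\widetilde T_a(\xi_k)y_a$. **Theorem 1.** There is an absolute constant $C>0$ such that for all $n,m\ge1$, every normal $A\in\mathbb C^{n\times n}$ and every $s>0$ with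 $\|A\|\le s$ the following holds, both for SpecDens and for its atomic variant. 1. For every unit vector $b$ the output $\widehat\mu_A$ is a probability measure supported on $[-s,s]+i[-s,s]$. In the model of exact complex arithmetic with unit cost per operation (including square roots, sines and cosines), the algorithm uses at most $Cm$ matrix-vector products with $A$ and at most $Cm$ with $A^*$, at most $Cmn$ cells of working storage (the write-only output is not counted), and at most $Cm^2n$ further steps. The output of the atomic variant is supported on at most $Cm^2$ points. 2. For every $0<\delta<1$, with probability at least $1-\delta$ over $b$, $$\frac1s\,\mathcal W_1(\mu_A,\widehat\mu_A)\le C\left(\frac1m+\sqrt{\frac{\log(m/\delta)\,\log m}{n}}\right).$$ In particular, for $A\ne0$ and $s=\|A\|$, the left-hand side is $\mathcal W_1(\mu_A,\widehat\mu_A)/\|A\|$. -/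

import Mathlib

open MeasureTheory
open scoped ENNReal

namespace SpecDens

/-! ## Measures, norms and the earth mover's distance -/

/-- The spectral (operator `ℓ² → ℓ²`) norm of a complex matrix. -/
noncomputable def specNorm {n : ℕ} (A : Matrix (Fin n) (Fin n) ℂ) : ℝ :=
  ‖Matrix.toEuclideanCLM (𝕜 := ℂ) A‖

/-- The spectral density: the uniform distribution on the `n` eigenvalues of `A`, counted with
multiplicity. -/
noncomputable def spectralDensity {n : ℕ} (A : Matrix (Fin n) (Fin n) ℂ) : Measure ℂ :=
  (n : ℝ≥0∞)⁻¹ • (A.charpoly.roots.map (fun z : ℂ => Measure.dirac z)).sum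

/-- The earth mover's distance: supremum of `∫ f dμ - ∫ f dν` over the real-valued functions `f`
with Lipschitz constant at most `1` for the Euclidean metric of `ℂ`. -/
noncomputable def earthMover (μ ν : Measure ℂ) : ℝ≥0∞ :=
  ⨆ f : {f : ℂ → ℝ // LipschitzWith 1 f},
    ENNReal.ofReal ((∫ z, f.1 z ∂μ) - ∫ z, f.1 z ∂ν)

/-- The uniform distribution on the unit sphere of `ℂⁿ = ℝ²ⁿ` (normalized surface measure). -/
noncomputable def unifSphere (n : ℕ) :
    Measure (Metric.sphere (0 : EuclideanSpace ℂ (Fin n)) 1) :=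
  ((volume : Measure (EuclideanSpace ℂ (Fin n))).toSphere Set.univ)⁻¹ •
    (volume : Measure (EuclideanSpace ℂ (Fin n))).toSphere

/-- `unifSphere n` is a probability measure as soon as the sphere is nonempty. -/
theorem isProbabilityMeasure_unifSphere {n : ℕ} (hn : 1 ≤ n) :
    IsProbabilityMeasure (unifSphere n) := by
  have : Nonempty (Fin n) := ⟨⟨0, hn⟩⟩
  refine ⟨?_⟩
  rw [unifSphere, Measure.smul_apply, smul_eq_mul]
  refine ENNReal.inv_mul_cancel ?_ (measure_ne_top _ _)
  rw [Measure.toSphere_apply_univ]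
  refine mul_ne_zero ?_ (Metric.measure_ball_pos _ _ one_pos).ne'
  exact_mod_cast (Module.finrank_pos (R := ℝ) (M := EuclideanSpace ℂ (Fin n))).ne'

/-- The closed square `[-s, s] + i [-s, s]`. -/
def square (s : ℝ) : Set ℂ := {z | |z.re| ≤ s ∧ |z.im| ≤ s}

/-! ## The machine model

Programs for a random access machine with exact complex arithmetic, whose only access to the
matrix `A` is through the products `v ↦ A v` and `v ↦ A* v`.  A program is a fixed finite syntax
tree; in particular it does not depend on the dimension `n`, on the degree `m` or on `A`. -/

/-- Names of the arrays of the machine; each is a two-dimensional array of complex numbers. -/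
inductive Arr
  | b | X | Y | P | Q | rho | nrm | U | V | t | acc
  deriving DecidableEq

/-- Names of the loop counters. -/
inductive Idx
  | i | j | k
  deriving DecidableEq

/-- A memory cell: array name, row, column. -/
abbrev Cell := Arr × ℕ × ℕ

/-- Integer expressions, used as array subscripts and loop bounds. -/
inductive IExp
  | lit (k : ℕ)
  | dimN
  | degM
  | var (x : Idx)
  | add (e f : IExp)
  | mul (e f : IExp)
  /-- truncated subtraction -/
  | sub (e f : IExp)

/-- Scalar expressions. `scale` is the scaling parameter handed to the program. -/
inductive SExp
  | ofInt (e : IExp)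
  | imagUnit
  | pi
  | scale
  | cell (a : Arr) (r c : IExp)
  | add (e f : SExp)
  | sub (e f : SExp)
  | mul (e f : SExp)
  | div (e f : SExp)
  | conj (e : SExp)
  /-- square root of a nonnegative real number -/
  | sqrt (e : SExp)
  | cos (e : SExp)
  | sin (e : SExp)

inductive Prog
  | skip
  | seq (p q : Prog)
  /-- `a[r, c] := e` -/
  | assign (a : Arr) (r c : IExp) (e : SExp)
  /-- append the value of `e` to the write-only output stream -/
  | output (e : SExp)
  /-- `a[r, ·] :=` the random unit vector -/
  | sample (a : Arr) (r : IExp)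
  /-- `a[r, ·] := A a'[r', ·]` -/
  | mulA (a : Arr) (r : IExp) (a' : Arr) (r' : IExp)
  /-- `a[r, ·] := A* a'[r', ·]` -/
  | mulAStar (a : Arr) (r : IExp) (a' : Arr) (r' : IExp)
  /-- execute the body for `x = 0, 1, …, e - 1` -/
  | loop (x : Idx) (e : IExp) (body : Prog)

/-- What a program is run on: dimension, degree, scale, matrix, and the random unit vector. -/
structure Input where
  n : ℕ
  m : ℕ
  s : ℝ
  A : Matrix (Fin n) (Fin n) ℂ
  b : Fin n → ℂ

/-- A machine configuration, with the resources consumed so far. -/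
structure State where
  mem : Cell → ℂ
  /-- cells written so far -/
  used : Finset Cell
  out : List ℂ
  /-- number of products with `A` -/
  queries : ℕ
  /-- number of products with `A*` -/
  queriesStar : ℕ
  /-- number of elementary steps other than those inside the matrix-vector products -/
  time : ℕ

/-- Storage: the number of distinct memory cells written. The write-only output stream is not
counted, nor are the three loop counters. -/
def State.storage (σ : State) : ℕ := σ.used.card

def IExp.eval (inp : Input) (env : Idx → ℕ) : IExp → ℕ
  | .lit k => k
  | .dimN => inp.n
  | .degM => inp.m
  | .var x => env x
  | .add e f => e.eval inp env + f.eval inp env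
  | .mul e f => e.eval inp env * f.eval inp env
  | .sub e f => e.eval inp env - f.eval inp env

/-- Evaluating an integer expression costs one step per node. -/
def IExp.cost : IExp → ℕ
  | .lit _ | .dimN | .degM | .var _ => 1
  | .add e f | .mul e f | .sub e f => e.cost + f.cost + 1

noncomputable def SExp.eval (inp : Input) (env : Idx → ℕ) (mem : Cell → ℂ) : SExp → ℂ
  | .ofInt e => (e.eval inp env : ℂ)
  | .imagUnit => Complex.I
  | .pi => (Real.pi : ℂ)
  | .scale => (inp.s : ℂ)
  | .cell a r c => mem (a, r.eval inp env, c.eval inp env)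
  | .add e f => e.eval inp env mem + f.eval inp env mem
  | .sub e f => e.eval inp env mem - f.eval inp env mem
  | .mul e f => e.eval inp env mem * f.eval inp env mem
  | .div e f => e.eval inp env mem / f.eval inp env mem
  | .conj e => star (e.eval inp env mem)
  | .sqrt e => (Real.sqrt (e.eval inp env mem).re : ℂ)
  | .cos e => Complex.cos (e.eval inp env mem)
  | .sin e => Complex.sin (e.eval inp env mem)

/-- Evaluating a scalar expression costs one step per node, subscripts included. -/
def SExp.cost : SExp → ℕ
  | .ofInt e => e.cost + 1
  | .imagUnit | .pi | .scale => 1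
  | .cell _ r c => r.cost + c.cost + 1
  | .add e f | .sub e f | .mul e f | .div e f => e.cost + f.cost + 1
  | .conj e | .sqrt e | .cos e | .sin e => e.cost + 1

/-- Memory after the vector `v` has been written to row `r` of array `a`. -/
def writeRow {n : ℕ} (mem : Cell → ℂ) (a : Arr) (r : ℕ) (v : Fin n → ℂ) : Cell → ℂ :=
  fun c => if h : c.1 = a ∧ c.2.1 = r ∧ c.2.2 < n then v ⟨c.2.2, h.2.2⟩ else mem c

/-- The cells of the first `n` entries of row `r` of array `a`. -/
def rowCells (a : Arr) (r n : ℕ) : Finset Cell :=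
  (Finset.range n).image fun c => (a, r, c)

/-- Execution of a program. Reading or writing a whole vector of length `n`
costs `n` steps. -/
noncomputable def Prog.exec (inp : Input) : Prog → (Idx → ℕ) → State → State
  | .skip, _, σ => σ
  | .seq p q, env, σ => q.exec inp env (p.exec inp env σ)
  | .assign a r c e, env, σ =>
      let cl : Cell := (a, r.eval inp env, c.eval inp env)
      { σ with
        mem := Function.update σ.mem cl (e.eval inp env σ.mem)
        used := insert cl σ.used
        time := σ.time + (r.cost + c.cost + e.cost + 1) }
  | .output e, env, σ =>
      { σ with
        out := σ.out ++ [e.eval inp env σ.mem]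
        time := σ.time + (e.cost + 1) }
  | .sample a r, env, σ =>
      { σ with
        mem := writeRow σ.mem a (r.eval inp env) inp.b
        used := σ.used ∪ rowCells a (r.eval inp env) inp.n
        time := σ.time + (r.cost + inp.n + 1) }
  | .mulA a r a' r', env, σ =>
      { σ with
        mem := writeRow σ.mem a (r.eval inp env)
          (inp.A.mulVec fun l => σ.mem (a', r'.eval inp env, l))
        used := σ.used ∪ rowCells a (r.eval inp env) inp.n
        queries := σ.queries + 1
        time := σ.time + (r.cost + r'.cost + 2 * inp.n + 1) }
  | .mulAStar a r a' r', env, σ =>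
      { σ with
        mem := writeRow σ.mem a (r.eval inp env)
          (inp.A.conjTranspose.mulVec fun l => σ.mem (a', r'.eval inp env, l))
        used := σ.used ∪ rowCells a (r.eval inp env) inp.n
        queriesStar := σ.queriesStar + 1
        time := σ.time + (r.cost + r'.cost + 2 * inp.n + 1) }
  | .loop x e body, env, σ =>
      (List.range (e.eval inp env)).foldl
        (fun τ v =>
          let τ' := body.exec inp (Function.update env x v) τ
          { τ' with time := τ'.time + 1 })
        { σ with time := σ.time + (e.cost + 1) }

/-- The initial configuration: empty memory, nothing consumed. -/
def State.init : State where
  mem := fun _ => 0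
  used := ∅
  out := []
  queries := 0
  queriesStar := 0
  time := 0

/-- The final configuration of a program. -/
noncomputable def Prog.run (p : Prog) (inp : Input) : State :=
  p.exec inp (fun _ => 0) State.init

/-! ## The algorithm -/

/-- Sequential composition of a list of commands. -/
def block : List Prog → Prog
  | [] => .skip
  | p :: l => .seq p (block l)

/-- The numeral `k` as a scalar. -/
def num (k : ℕ) : SExp := .ofInt (.lit k)

/-- The loop counters. -/
def iv : IExp := .var .i
def jv : IExp := .var .j
def kv : IExp := .var .k

/-- The bound `m + 1` of the loops over `0, …, m`. -/
def degs : IExp := .add .degM (.lit 1)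

/-- `P ← A z`, `Q ← A* z` for the vector `z = a[r, ·]`. -/
def query (a : Arr) (r : IExp) : Prog :=
  block [.mulA .P (.lit 0) a r, .mulAStar .Q (.lit 0) a r]

/-- After `query a r`: the `i`-th entry of `H z`, where `H = (Ã + Ã*) / 2` and `Ã = A / s`. -/
def entryH : SExp :=
  .div (.add (.cell .P (.lit 0) iv) (.cell .Q (.lit 0) iv)) (.mul (num 2) .scale)

/-- After `query a r`: the `i`-th entry of `K z`, where `K = (Ã - Ã*) / (2i)` and `Ã = A / s`. -/
def entryK : SExp :=
  .div (.sub (.cell .P (.lit 0) iv) (.cell .Q (.lit 0) iv))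
    (.mul (.mul (num 2) .imagUnit) .scale)

/-- The three-term recurrence for one of the two families of vectors: row `j` of `a` becomes
`T̃_j(H) b` (or `T̃_j(K) b`), where `entry` is `entryH` (or `entryK`). -/
def recurrenceStart (a : Arr) (entry : SExp) : Prog :=
  block [
    .loop .i .dimN (.assign a (.lit 0) iv (.div (.cell .b (.lit 0) iv) (.sqrt .pi))),
    query a (.lit 0),
    .loop .i .dimN (.assign a (.lit 1) iv (.mul (.sqrt (num 2)) entry)),
    query a (.lit 1),
    .loop .i .dimN (.assign a (.lit 2) iv
      (.sub (.mul (num 2) entry) (.mul (.sqrt (num 2)) (.cell a (.lit 0) iv))))]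

/-- One step `z_{j+3} ← 2 H z_{j+2} - z_{j+1}` of the recurrence. -/
def recurrenceStep (a : Arr) (entry : SExp) : Prog :=
  block [
    query a (.add jv (.lit 2)),
    .loop .i .dimN (.assign a (.add jv (.lit 3)) iv
      (.sub (.mul (num 2) entry) (.cell a (.add jv (.lit 1)) iv)))]

/-- The vectors `x_0, …, x_m` (rows of `X`) and `y_0, …, y_m` (rows of `Y`). -/
def chebVectors : Prog :=
  block [
    recurrenceStart .X entryH,
    recurrenceStart .Y entryK,
    .loop .j (.sub .degM (.lit 2))
      (block [recurrenceStep .X entryH, recurrenceStep .Y entryK])]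

/-- The angle `e π / f`. -/
def angle (e f : IExp) : SExp := .div (.mul (.ofInt e) .pi) (.ofInt f)

/-- The damping coefficients
`ρ_j = ((m+2-j) cos(jπ/(m+2)) + sin(jπ/(m+2)) cot(π/(m+2))) / (m+2)`, for `j = 0, …, m`. -/
def damping : Prog :=
  let N : IExp := .add .degM (.lit 2)
  .loop .j degs (.assign .rho (.lit 0) jv
    (.div
      (.add
        (.mul (.ofInt (.sub N jv)) (.cos (angle jv N)))
        (.mul (.sin (angle jv N)) (.div (.cos (angle (.lit 1) N)) (.sin (angle (.lit 1) N)))))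
      (.ofInt N)))

/-- `acc ← ∑_i conj (a[j, i]) a'[k, i]`. -/
def innerProd (a a' : Arr) : Prog :=
  block [
    .assign .acc (.lit 0) (.lit 0) (num 0),
    .loop .i .dimN (.assign .acc (.lit 0) (.lit 0)
      (.add (.cell .acc (.lit 0) (.lit 0))
        (.mul (.conj (.cell a jv iv)) (.cell a' kv iv))))]

/-- The algorithm: draw `b`, compute the mixed Chebyshev moments `Γ = X* Y`, and output the
coefficients `ρ_j ρ_k Γ_{jk}`, `0 ≤ j, k ≤ m`, of the kernel polynomial, row by row. -/
def specDens : Prog :=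
  block [
    .sample .b (.lit 0),
    chebVectors,
    damping,
    .loop .j degs (.loop .k degs (block [
      innerProd .X .Y,
      .output (.mul (.mul (.cell .rho (.lit 0) jv) (.cell .rho (.lit 0) kv))
        (.cell .acc (.lit 0) (.lit 0)))]))]

/-- The angle `(2e + 1) π / (2 (m + 1))` of the `e`-th Gauss-Chebyshev node. -/
def nodeAngle (e : IExp) : SExp :=
  .div (.mul (.ofInt (.add (.mul (.lit 2) e) (.lit 1))) .pi) (.ofInt (.mul (.lit 2) degs))

/-- `nrm[0, j]` becomes the factor with which `T_j` is normalized: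
`√(1/π)` for `j = 0` and `√(2/π)` otherwise. -/
def normalizers : Prog :=
  block [
    .loop .j degs (.assign .nrm (.lit 0) jv (.sqrt (.div (num 2) .pi))),
    .assign .nrm (.lit 0) (.lit 0) (.sqrt (.div (num 1) .pi))]

/-- With `x_k` the `k`-th node:
`U[k, i] ← ∑_j ρ_j T̃_j(x_k) X[j, i]` and `V[k, i] ← ∑_j ρ_j T̃_j(x_k) Y[j, i]`. -/
def nodeVectors : Prog :=
  .loop .k degs (block [
    .loop .i .dimN (block [.assign .U kv iv (num 0), .assign .V kv iv (num 0)]),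
    .loop .j degs (block [
      .assign .t (.lit 0) (.lit 0)
        (.mul (.mul (.cell .rho (.lit 0) jv) (.cell .nrm (.lit 0) jv))
          (.cos (.mul (.ofInt jv) (nodeAngle kv)))),
      .loop .i .dimN (block [
        .assign .U kv iv
          (.add (.cell .U kv iv) (.mul (.cell .t (.lit 0) (.lit 0)) (.cell .X jv iv))),
        .assign .V kv iv
          (.add (.cell .V kv iv) (.mul (.cell .t (.lit 0) (.lit 0)) (.cell .Y jv iv)))])])])

/-- The variant with atomic output: Gauss-Chebyshev discretization of the output of `specDens`.
For each pair of nodes `x_j, x_k` it outputs the location `s (x_j + i x_k)` followed by the mass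
`w_j w_k p(x_j, x_k)`, where `w_j = π / (m + 1)` and `p` is the kernel polynomial; the value
`p(x_j, x_k) = ∑_{a, c} ρ_a ρ_c Γ_{ac} T̃_a(x_j) T̃_c(x_k)` is obtained as the inner product of row
`j` of `U` and row `k` of `V`. -/
def specDensAtomic : Prog :=
  block [
    .sample .b (.lit 0),
    chebVectors,
    damping,
    normalizers,
    nodeVectors,
    .loop .j degs (.loop .k degs (block [
      innerProd .U .V,
      .output (.mul .scale (.add (.cos (nodeAngle jv)) (.mul .imagUnit (.cos (nodeAngle kv))))),
      .output (.mul
        (.mul (.div .pi (.ofInt degs)) (.div .pi (.ofInt degs)))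
        (.cell .acc (.lit 0) (.lit 0)))]))]

/-! ## The measures that the outputs stand for -/

/-- The normalized Chebyshev polynomials, orthonormal for `dx / √(1 - x²)` on `[-1, 1]`. -/
noncomputable def chebT (j : ℕ) (x : ℝ) : ℝ :=
  (if j = 0 then √(1 / Real.pi) else √(2 / Real.pi)) *
    (Polynomial.Chebyshev.T ℝ (j : ℤ)).eval x

/-- The bivariate polynomial whose `(j, k)` coefficient in the basis `T̃_j(x) T̃_k(y)` is entry
`j (m + 1) + k` of the list. -/
noncomputable def kpmPoly (m : ℕ) (l : List ℂ) (x y : ℝ) : ℝ :=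
  ∑ j ∈ Finset.range (m + 1), ∑ k ∈ Finset.range (m + 1),
    (l.getD (j * (m + 1) + k) 0).re * chebT j x * chebT k y

/-- The measure with density `p(x, y) / (√(1 - x²) √(1 - y²))` on `[-1, 1]²`, moved to `ℂ` by
`(x, y) ↦ s (x + i y)`. -/
noncomputable def densityMeasure (m : ℕ) (s : ℝ) (l : List ℂ) : Measure ℂ :=
  Measure.map (fun q : ℝ × ℝ => (s : ℂ) * (q.1 + Complex.I * q.2))
    ((volume.restrict (Set.Icc (-1 : ℝ) 1 ×ˢ Set.Icc (-1 : ℝ) 1)).withDensity fun q =>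
      ENNReal.ofReal (kpmPoly m l q.1 q.2 / (√(1 - q.1 ^ 2) * √(1 - q.2 ^ 2))))

/-- The atomic measure described by a list of alternating locations and masses. -/
noncomputable def atomicMeasure : List ℂ → Measure ℂ
  | z :: w :: l => ENNReal.ofReal w.re • Measure.dirac z + atomicMeasure l
  | _ => 0

/-- The output of the algorithm for the random vector `b`. -/
noncomputable def estimate (inp : Input) : Measure ℂ :=
  densityMeasure inp.m inp.s (specDens.run inp).out

/-- The output of the variant with atomic output for the random vector `b`. -/
noncomputable def estimateAtomic (inp : Input) : Measure ℂ :=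
  atomicMeasure (specDensAtomic.run inp).out

/-- `O(m)` products with `A` and with `A*`, `O(mn)` storage and `O(m²n)` additional time, with
constant `C`. -/
def WithinBudget (C : ℝ) (n m : ℕ) (σ : State) : Prop :=
  (σ.queries : ℝ) ≤ C * m ∧ (σ.queriesStar : ℝ) ≤ C * m ∧
    (σ.storage : ℝ) ≤ C * (m * n) ∧ (σ.time : ℝ) ≤ C * (m ^ 2 * n)

/-- The error bound `C (1/m + √(log(m/δ) log(m) / n))`. -/
noncomputable def errorBound (C : ℝ) (n m : ℕ) (δ : ℝ) : ℝ :=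
  C * (1 / m + √(Real.log (m / δ) * Real.log m / n))

end SpecDens

/-! Write the eigenvalues as s(x_l + i y_l). Normality makes A + A* and i(A* - A) commuting
Hermitian matrices, so there is an orthonormal basis u_l of common eigenvectors
(`exists_isEigenbasis`). In this basis the matrix recurrence is the scalar Chebyshev recurrence,
hence T̃_j(H)b = Σ_l T̃_j(x_l)⟨u_l,b⟩u_l (`isChebSeq_spectralVec`), and Γ_jk is the mixed Chebyshev
moment of the random measure with weights w_l = |⟨u_l,b⟩|² at (x_l,y_l). Consequently p = Σ_l w_l
J(x_l,·)J(y_l,·), where J is the Jackson kernel (`jacksonMixture_eq`): the output is the spectral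
measure of b, smoothed.

The smoothing. The ρ_j are autocorrelations of a sine sequence, so J is, up to the product formula
for cosines, the squared modulus of a trigonometric polynomial and therefore nonnegative. From ρ_0 =
1 it has mass one, and ρ_1, ρ_2 give a second moment O(1/m²) about its center. These integrals only
involve polynomials of degree at most 2m+1, so they are the same for the Chebyshev weight and for
the Gauss-Chebyshev rule. The notion `IsChebQuad` treats both variants of the algorithm at once: p
is a probability density relative to either, and smoothing costs O(s/m) in earth mover's distance
(`abs_sum_sub_integral_kernelMeasure_le`).

The randomness. It remains to compare the weights w_l with 1/n. A linear statistic Σ_l (w_l -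
1/n)a_l is compared with a threshold by asking for the sign of a quadratic form, which is constant
on rays, so b may be replaced by a Gaussian vector and the exponential Markov inequality applies
(`unifSphere_tail`). A union bound makes all (m+1)² moments accurate to τ of order √(log(m/δ)/n)
(`unifSphere_exists_moment_le`).

From moments to distance. Summing τ over all moments would lose a power of m. Instead both weighted
configurations are smoothed with the Gauss rule, whichever variant is being analyzed; the difference
of the integrals of a Lipschitz f is then a pairing of the moment errors with the discrete Chebyshev
coefficients ĝ_jk of f on the grid. Summation by parts and Bessel's inequality give Σ (j²+k²)ĝ_jk² =
O(s²), a Sobolev bound that needs no derivative of f. Since Σ 1/(j²+k²) = O(log m) in two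
dimensions, Cauchy-Schwarz gives O(sτ√log m) (`abs_sum_mul_gridCoeff_le`). The moment of index (0,0)
is exact and drops out.

The resources of a run do not depend on the memory contents, so they are computed by recursion on
the syntax (`withinBudget_of_costs`); correctness of the programs is a chain of loop invariants
ending in `specDens_out` and `specDensAtomic_out`. -/

namespace SpecDens

/-! ## The Jackson coefficients -/

/-- The Jackson damping coefficients. -/
noncomputable def jacksonCoeff (m j : ℕ) : ℝ :=
  (((m : ℝ) + 2 - j) * Real.cos (j * Real.pi / (m + 2)) +
    Real.sin (j * Real.pi / (m + 2)) *
      (Real.cos (Real.pi / (m + 2)) / Real.sin (Real.pi / (m + 2)))) / (m + 2)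

/-- The sum telescopes because 2 sin φ cos x = sin(x+φ) - sin(x-φ) and consecutive angles differ by
2φ. -/
theorem two_mul_sin_mul_sum_cos (φ : ℝ) (j K : ℕ) :
    2 * Real.sin φ * ∑ k ∈ Finset.range K, Real.cos ((2 * k + 2 + j) * φ) =
      Real.sin ((2 * K + j + 1) * φ) - Real.sin ((j + 1) * φ) := by
  induction K with
  | zero => simp
  | succ K ih =>
    rw [Finset.sum_range_succ, mul_add, ih]
    have h1 : (2 * ((K + 1 : ℕ) : ℝ) + j + 1) * φ = (2 * K + 2 + j) * φ + φ := by push_cast; ring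
    have h2 : (2 * (K : ℝ) + j + 1) * φ = (2 * K + 2 + j) * φ - φ := by ring
    rw [h1, h2, Real.sin_add, Real.sin_sub]
    ring

theorem sin_pi_div_pos (m : ℕ) : 0 < Real.sin (Real.pi / (m + 2)) := by
  have hm : (0 : ℝ) < (m : ℝ) + 2 := by positivity
  refine Real.sin_pos_of_pos_of_lt_pi (by positivity) ?_
  rw [div_lt_iff₀ hm]
  nlinarith [Real.pi_pos, (Nat.cast_nonneg m : (0 : ℝ) ≤ m)]

/-- The amplitudes whose autocorrelations are the Jackson coefficients. -/
noncomputable def jacksonAmp (m k : ℕ) : ℝ :=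
  √(2 / (m + 2)) * Real.sin ((k + 1) * (Real.pi / (m + 2)))

theorem sum_jacksonAmp_mul {m j : ℕ} (hj : j ≤ m) :
    ∑ k ∈ Finset.range (m + 1 - j), jacksonAmp m k * jacksonAmp m (k + j) =
      jacksonCoeff m j := by
  obtain ⟨K, hK⟩ : ∃ K, m + 1 - j = K := ⟨_, rfl⟩
  have hm : (m : ℝ) = K + j - 1 := by
    have : m + 1 = K + j := by omega
    have : (m : ℝ) + 1 = K + j := by exact_mod_cast this
    linarith
  have hN : (0 : ℝ) < (m : ℝ) + 2 := by positivity
  have hs := sin_pi_div_pos m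
  set φ := Real.pi / ((m : ℝ) + 2) with hφ
  have hterm : ∀ k : ℕ, jacksonAmp m k * jacksonAmp m (k + j) =
      (Real.cos (j * φ) - Real.cos ((2 * k + 2 + j) * φ)) / (m + 2) := by
    intro k
    have hsq : √(2 / ((m : ℝ) + 2)) * √(2 / ((m : ℝ) + 2)) = 2 / (m + 2) :=
      Real.mul_self_sqrt (by positivity)
    have h1 : (j : ℝ) * φ = ((k + j : ℕ) + 1) * φ - (k + 1) * φ := by push_cast; ring
    have h2 : (2 * (k : ℝ) + 2 + j) * φ = ((k + j : ℕ) + 1) * φ + (k + 1) * φ := by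
      push_cast; ring
    rw [h1, h2, Real.cos_add, Real.cos_sub, jacksonAmp, jacksonAmp, ← hφ]
    calc _ = (√(2 / ((m : ℝ) + 2)) * √(2 / ((m : ℝ) + 2))) *
        (Real.sin ((k + 1) * φ) * Real.sin (((k + j : ℕ) + 1) * φ)) := by ring
      _ = _ := by rw [hsq]; ring
  have hsum := two_mul_sin_mul_sum_cos φ j K
  -- Since K + j + 1 = m + 2 and (m+2)φ = π, the upper end of the telescoping sum mirrors the lower
  -- end, and the two boundary terms add up.
  have hang : (2 * (K : ℝ) + j + 1) * φ = 2 * Real.pi - (j + 1) * φ := by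
    have : ((m : ℝ) + 2) * φ = Real.pi := by rw [hφ]; field_simp
    rw [hm] at this
    linarith
  rw [hang, Real.sin_two_pi_sub] at hsum
  have hS : ∑ k ∈ Finset.range K, Real.cos ((2 * k + 2 + j) * φ) =
      -(Real.sin ((j + 1) * φ) / Real.sin φ) := by
    rw [← neg_div, eq_div_iff hs.ne']
    linarith
  rw [hK, Finset.sum_congr rfl fun k _ => hterm k, ← Finset.sum_div, Finset.sum_sub_distrib, hS,
    Finset.sum_const, Finset.card_range, nsmul_eq_mul, jacksonCoeff, ← hφ]
  have h3 : ((j : ℝ) + 1) * φ = j * φ + φ := by ring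
  have h4 : (j : ℝ) * Real.pi / (m + 2) = j * φ := by rw [hφ]; ring
  have h5 : (K : ℝ) = m + 1 - j := by linarith
  rw [h3, h4, Real.sin_add, h5]
  congr 1
  field_simp
  ring

theorem jacksonCoeff_zero (m : ℕ) : jacksonCoeff m 0 = 1 := by
  have hN : ((m : ℝ) + 2) ≠ 0 := by positivity
  simp [jacksonCoeff, hN]

theorem jacksonCoeff_one (m : ℕ) : jacksonCoeff m 1 = Real.cos (Real.pi / (m + 2)) := by
  have hN : ((m : ℝ) + 2) ≠ 0 := by positivity
  have hs := (sin_pi_div_pos m).ne'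
  simp only [jacksonCoeff, Nat.cast_one, one_mul]
  field_simp
  ring

theorem jacksonCoeff_two (m : ℕ) :
    jacksonCoeff m 2 = ((m + 1) * Real.cos (2 * (Real.pi / (m + 2))) + 1) / (m + 2) := by
  have hN : ((m : ℝ) + 2) ≠ 0 := by positivity
  have hs := (sin_pi_div_pos m).ne'
  simp only [jacksonCoeff, Nat.cast_ofNat]
  rw [mul_div_assoc, Real.sin_two_mul, Real.cos_two_mul]
  field_simp
  ring

theorem abs_sin_nat_mul_le (j : ℕ) (φ : ℝ) : |Real.sin (j * φ)| ≤ j * |Real.sin φ| := by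
  induction j with
  | zero => simp
  | succ j ih =>
    have h : ((j + 1 : ℕ) : ℝ) * φ = j * φ + φ := by push_cast; ring
    rw [h, Real.sin_add]
    calc _ ≤ |Real.sin (j * φ) * Real.cos φ| + |Real.cos (j * φ) * Real.sin φ| := abs_add_le _ _
      _ = |Real.sin (j * φ)| * |Real.cos φ| + |Real.cos (j * φ)| * |Real.sin φ| := by
        rw [abs_mul, abs_mul]
      _ ≤ j * |Real.sin φ| * 1 + 1 * |Real.sin φ| := by
        gcongr
        · exact Real.abs_cos_le_one _
        · exact Real.abs_cos_le_one _
      _ = _ := by push_cast; ring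

/-- From |sin jφ| ≤ j sin φ the cotangent term is at most j, and the other term at most m + 2 - j;
the sum is the denominator. -/
theorem abs_jacksonCoeff_le_one {m j : ℕ} (hj : j ≤ m) : |jacksonCoeff m j| ≤ 1 := by
  have hN : (0 : ℝ) < (m : ℝ) + 2 := by positivity
  have hs := sin_pi_div_pos m
  have hj' : (j : ℝ) ≤ m := by exact_mod_cast hj
  have h := abs_sin_nat_mul_le j (Real.pi / (m + 2))
  rw [abs_of_pos hs] at h
  rw [jacksonCoeff, abs_div, abs_of_pos hN, div_le_one hN, mul_div_assoc]
  calc _ ≤ |((m : ℝ) + 2 - j) * Real.cos (j * (Real.pi / (m + 2)))| +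
        |Real.sin (j * (Real.pi / (m + 2))) *
          (Real.cos (Real.pi / (m + 2)) / Real.sin (Real.pi / (m + 2)))| := abs_add_le _ _
    _ ≤ ((m : ℝ) + 2 - j) * 1 + j := by
        gcongr ?_ + ?_
        · rw [abs_mul, abs_of_pos (by linarith : (0 : ℝ) < (m : ℝ) + 2 - j)]
          exact mul_le_mul_of_nonneg_left (Real.abs_cos_le_one _) (by linarith)
        · rw [abs_mul, abs_div, abs_of_pos hs]
          calc _ ≤ (j * Real.sin (Real.pi / (m + 2))) * (1 / Real.sin (Real.pi / (m + 2))) := by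
                gcongr
                exact Real.abs_cos_le_one _
            _ = j := by field_simp
    _ = _ := by ring

/-! ## Positivity of the Jackson kernel -/

/-- The double sum is grouped along its diagonals; the difference j and its negative contribute
equally, which explains the factor 2 off the main diagonal. -/
theorem sum_sum_mul_cos_sub (a : ℕ → ℝ) (θ : ℝ) (M : ℕ) :
    ∑ k ∈ Finset.range M, ∑ l ∈ Finset.range M, a k * a l * Real.cos (k * θ - l * θ) =
      ∑ j ∈ Finset.range M, (if j = 0 then 1 else 2) *
        (∑ k ∈ Finset.range (M - j), a k * a (k + j)) * Real.cos (j * θ) := by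
  induction M with
  | zero => simp
  | succ M ih =>
    have hL : ∑ k ∈ Finset.range (M + 1), ∑ l ∈ Finset.range (M + 1),
          a k * a l * Real.cos (k * θ - l * θ) =
        (∑ k ∈ Finset.range M, ∑ l ∈ Finset.range M, a k * a l * Real.cos (k * θ - l * θ)) +
          (2 * (∑ k ∈ Finset.range M, a k * a M * Real.cos (k * θ - M * θ)) + a M * a M) := by
      -- In the induction both sides gain the border, that is, the last row and the last column of
      -- the square array.
      rw [Finset.sum_range_succ]
      simp_rw [Finset.sum_range_succ (fun l => _ * a l * _)]
      rw [Finset.sum_add_distrib]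
      have : ∑ l ∈ Finset.range M, a M * a l * Real.cos (M * θ - l * θ) =
          ∑ k ∈ Finset.range M, a k * a M * Real.cos (k * θ - M * θ) := by
        refine Finset.sum_congr rfl fun l _ => ?_
        rw [← Real.cos_neg, neg_sub]
        ring
      rw [this]
      simp only [sub_self, Real.cos_zero]
      ring
    have hR : ∑ j ∈ Finset.range (M + 1), (if j = 0 then 1 else 2) *
          (∑ k ∈ Finset.range (M + 1 - j), a k * a (k + j)) * Real.cos (j * θ) =
        (∑ j ∈ Finset.range (M + 1), (if j = 0 then 1 else 2) *
          (∑ k ∈ Finset.range (M - j), a k * a (k + j)) * Real.cos (j * θ)) +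
        ∑ j ∈ Finset.range (M + 1), (if j = 0 then 1 else 2) *
          (a (M - j) * a M) * Real.cos (j * θ) := by
      rw [← Finset.sum_add_distrib]
      refine Finset.sum_congr rfl fun j hj => ?_
      have hj' : j ≤ M := Nat.lt_succ_iff.mp (Finset.mem_range.mp hj)
      rw [Nat.sub_add_comm hj', Finset.sum_range_succ, Nat.sub_add_cancel hj']
      ring
    have hrefl : ∑ j ∈ Finset.range (M + 1), (if j = 0 then 1 else 2) *
          (a (M - j) * a M) * Real.cos (j * θ) =
        2 * (∑ k ∈ Finset.range M, a k * a M * Real.cos (k * θ - M * θ)) + a M * a M := by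
      rw [← Finset.sum_range_reflect, Finset.sum_range_succ, Finset.mul_sum]
      congr 1
      · refine Finset.sum_congr rfl fun k hk => ?_
        have hk' : k < M := Finset.mem_range.mp hk
        have h1 : M + 1 - 1 - k = M - k := by omega
        have h2 : M - (M - k) = k := by omega
        rw [h1, h2, if_neg (by omega), Nat.cast_sub hk'.le, ← Real.cos_neg]
        rw [show -(((M : ℝ) - k) * θ) = k * θ - M * θ by ring]
        ring
      · simp
    rw [hL, hR, hrefl, Finset.sum_range_succ (fun j => (if j = 0 then (1 : ℝ) else 2) * _ * _), ih]
    simp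

/-- Since the coefficients are autocorrelations, the sum is |Σ_k a_k e^{ikθ}|² with a_k =
`jacksonAmp m k`. -/
theorem jackson_trig_nonneg (m : ℕ) (θ : ℝ) :
    0 ≤ ∑ j ∈ Finset.range (m + 1), (if j = 0 then 1 else 2) * jacksonCoeff m j *
      Real.cos (j * θ) := by
  have h := sum_sum_mul_cos_sub (jacksonAmp m) θ (m + 1)
  rw [Finset.sum_congr rfl fun j hj => by
    rw [← sum_jacksonAmp_mul (Nat.lt_succ_iff.mp (Finset.mem_range.mp hj))], ← h]
  have : ∑ k ∈ Finset.range (m + 1), ∑ l ∈ Finset.range (m + 1),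
      jacksonAmp m k * jacksonAmp m l * Real.cos (k * θ - l * θ) =
      (∑ k ∈ Finset.range (m + 1), jacksonAmp m k * Real.cos (k * θ)) ^ 2 +
      (∑ k ∈ Finset.range (m + 1), jacksonAmp m k * Real.sin (k * θ)) ^ 2 := by
    rw [sq, sq, Finset.sum_mul_sum, Finset.sum_mul_sum, ← Finset.sum_add_distrib]
    refine Finset.sum_congr rfl fun k _ => ?_
    rw [← Finset.sum_add_distrib]
    refine Finset.sum_congr rfl fun l _ => ?_
    rw [Real.cos_sub]
    ring
  rw [this]
  positivity

/-- The Jackson kernel on `[-1, 1]²`. -/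
noncomputable def jackson (m : ℕ) (u v : ℝ) : ℝ :=
  ∑ j ∈ Finset.range (m + 1), jacksonCoeff m j * chebT j u * chebT j v

theorem chebT_cos (j : ℕ) (α : ℝ) :
    chebT j (Real.cos α) = (if j = 0 then √(1 / Real.pi) else √(2 / Real.pi)) *
      Real.cos (j * α) := by
  rw [chebT, Polynomial.Chebyshev.T_real_cos]
  norm_cast

theorem chebT_cos_mul (j : ℕ) (α β : ℝ) :
    chebT j (Real.cos α) * chebT j (Real.cos β) =
      (if j = 0 then 1 else 2) / Real.pi * (Real.cos (j * α) * Real.cos (j * β)) := by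
  have hπ := Real.pi_pos
  rw [chebT_cos, chebT_cos]
  split_ifs
  · linear_combination (Real.cos (j * α) * Real.cos (j * β)) *
      Real.mul_self_sqrt (by positivity : 0 ≤ 1 / Real.pi)
  · linear_combination (Real.cos (j * α) * Real.cos (j * β)) *
      Real.mul_self_sqrt (by positivity : 0 ≤ 2 / Real.pi)

theorem jackson_nonneg (m : ℕ) {u v : ℝ} (hu : u ∈ Set.Icc (-1 : ℝ) 1)
    (hv : v ∈ Set.Icc (-1 : ℝ) 1) : 0 ≤ jackson m u v := by
  obtain ⟨α, rfl⟩ : ∃ α, u = Real.cos α := ⟨_, (Real.cos_arccos hu.1 hu.2).symm⟩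
  obtain ⟨β, rfl⟩ : ∃ β, v = Real.cos β := ⟨_, (Real.cos_arccos hv.1 hv.2).symm⟩
  -- In angles, cos jα cos jβ averages the cosines of j(α+β) and j(α-β), so the kernel is an average
  -- of two values of the nonnegative trigonometric sum.
  have h : jackson m (Real.cos α) (Real.cos β) = 1 / (2 * Real.pi) *
      ((∑ j ∈ Finset.range (m + 1), (if j = 0 then 1 else 2) * jacksonCoeff m j *
        Real.cos (j * (α + β))) +
      ∑ j ∈ Finset.range (m + 1), (if j = 0 then 1 else 2) * jacksonCoeff m j *
        Real.cos (j * (α - β))) := by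
    rw [← Finset.sum_add_distrib, jackson, Finset.mul_sum]
    refine Finset.sum_congr rfl fun j _ => ?_
    rw [mul_assoc, chebT_cos_mul, mul_add (j : ℝ), mul_sub, Real.cos_add, Real.cos_sub]
    ring
  rw [h]
  have hπ := Real.pi_pos
  have h1 := jackson_trig_nonneg m (α + β)
  have h2 := jackson_trig_nonneg m (α - β)
  positivity

theorem chebT_continuous (j : ℕ) : Continuous (chebT j) := by
  unfold chebT
  fun_prop

theorem jackson_continuous (m : ℕ) (u : ℝ) : Continuous (jackson m u) := by
  unfold jackson
  have := chebT_continuous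
  fun_prop

end SpecDens

namespace SpecDens

/-! ## Quadrature measures on `[-1, 1]` -/

/-- A finite measure on `[-1, 1]` that integrates the polynomials of degree at most `2m + 1` like
the Chebyshev weight `dx / √(1 - x²)`. -/
structure IsChebQuad (m : ℕ) (ω : Measure ℝ) : Prop where
  finite : IsFiniteMeasure ω
  supp : ω (Set.Icc (-1 : ℝ) 1)ᶜ = 0
  total : ∫ _, (1 : ℝ) ∂ω = Real.pi
  integral_T : ∀ k : ℤ, k ≠ 0 → |k| ≤ 2 * m + 1 →
    ∫ x, (Polynomial.Chebyshev.T ℝ k).eval x ∂ω = 0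

theorem integrable_of_continuousOn_compact {X : Type*} [TopologicalSpace X] [T2Space X]
    [MeasurableSpace X] [OpensMeasurableSpace X] {μ : Measure X} [IsFiniteMeasure μ] {K : Set X}
    (hK : IsCompact K) (hμ : μ Kᶜ = 0) {g : X → ℝ} (hg : ContinuousOn g K) :
    Integrable g μ := by
  have : μ.restrict K = μ := Measure.restrict_eq_self_of_ae_mem (by
    rw [ae_iff]; exact hμ)
  rw [← this]
  exact hg.integrableOn_compact hK

namespace IsChebQuad

variable {m : ℕ} {ω : Measure ℝ}

theorem integrable (h : IsChebQuad m ω) {g : ℝ → ℝ} (hg : Continuous g) : Integrable g ω :=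
  have := h.finite
  integrable_of_continuousOn_compact isCompact_Icc h.supp hg.continuousOn

theorem ae_mem (h : IsChebQuad m ω) : ∀ᵐ x ∂ω, x ∈ Set.Icc (-1 : ℝ) 1 := by
  rw [ae_iff]
  exact h.supp

theorem integral_T_eq (h : IsChebQuad m ω) {k : ℤ} (hk : |k| ≤ 2 * m + 1) :
    ∫ x, (Polynomial.Chebyshev.T ℝ k).eval x ∂ω = if k = 0 then Real.pi else 0 := by
  split_ifs with h0
  · subst h0
    simpa using h.total
  · exact h.integral_T k h0 hk

/-- By 2 T_j T_k = T_{j+k} + T_{j-k}, exactness up to degree j + k is all that orthogonality uses.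
Integer indices make the case j < k harmless. -/
theorem integral_chebT_mul_chebT (h : IsChebQuad m ω) {j k : ℕ} (hjk : j + k ≤ 2 * m + 1) :
    ∫ x, chebT j x * chebT k x ∂ω = if j = k then 1 else 0 := by
  have hT : ∀ x : ℝ, (Polynomial.Chebyshev.T ℝ j).eval x * (Polynomial.Chebyshev.T ℝ k).eval x =
      ((Polynomial.Chebyshev.T ℝ (j + k)).eval x + (Polynomial.Chebyshev.T ℝ (j - k)).eval x) / 2 := by
    intro x
    have := congrArg (Polynomial.eval x) (Polynomial.Chebyshev.T_mul_T ℝ j k)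
    simp only [Polynomial.eval_mul, Polynomial.eval_ofNat, Polynomial.eval_add] at this
    linarith
  have hπ := Real.pi_pos
  have hsplit : ∀ x, chebT j x * chebT k x =
      ((if j = 0 then √(1 / Real.pi) else √(2 / Real.pi)) *
        (if k = 0 then √(1 / Real.pi) else √(2 / Real.pi)) / 2) *
      ((Polynomial.Chebyshev.T ℝ (j + k)).eval x + (Polynomial.Chebyshev.T ℝ (j - k)).eval x) := by
    intro x
    rw [chebT, chebT]
    linear_combination ((if j = 0 then √(1 / Real.pi) else √(2 / Real.pi)) *
        (if k = 0 then √(1 / Real.pi) else √(2 / Real.pi))) * hT x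
  simp_rw [hsplit]
  rw [integral_const_mul, integral_add (h.integrable (by fun_prop)) (h.integrable (by fun_prop)),
    h.integral_T_eq (by rw [abs_of_nonneg (by positivity)]; omega),
    h.integral_T_eq (by rw [abs_le]; omega)]
  by_cases hj : j = 0
  · by_cases hk : k = 0
    · simp only [hj, hk, if_true, Nat.cast_zero, add_zero, sub_self]
      rw [Real.mul_self_sqrt (by positivity)]
      field_simp
      ring
    · have h1 : ((j : ℤ) + k) ≠ 0 := by omega
      have h2 : ((j : ℤ) - k) ≠ 0 := by omega
      have h3 : j ≠ k := by omega
      simp [h1, h2, h3]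
  · have h1 : ((j : ℤ) + k) ≠ 0 := by omega
    by_cases hjk' : j = k
    · subst hjk'
      simp only [hj, if_false, sub_self, if_true, h1]
      rw [Real.mul_self_sqrt (by positivity)]
      field_simp
      ring
    · have h2 : ((j : ℤ) - k) ≠ 0 := by omega
      simp [h1, h2, hjk']

theorem integral_jackson_mul_chebT (h : IsChebQuad m ω) (u : ℝ) {k : ℕ} (hk : k ≤ m + 1) :
    ∫ v, jackson m u v * chebT k v ∂ω =
      if k ≤ m then jacksonCoeff m k * chebT k u else 0 := by
  simp_rw [jackson, Finset.sum_mul]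
  rw [integral_finsetSum]
  · have : ∀ j ∈ Finset.range (m + 1), ∫ v, jacksonCoeff m j * chebT j u * chebT j v * chebT k v ∂ω =
        if j = k then jacksonCoeff m j * chebT j u else 0 := by
      intro j hj
      have hj' := Finset.mem_range.mp hj
      simp_rw [mul_assoc (jacksonCoeff m j * chebT j u)]
      rw [integral_const_mul, h.integral_chebT_mul_chebT (by omega)]
      simp
    rw [Finset.sum_congr rfl this, Finset.sum_ite_eq']
    simp
  · intro j _
    have := chebT_continuous
    exact h.integrable (by fun_prop)

end IsChebQuad

/-- This removes the case distinction from the reproducing formula at k = m + 1, so that the second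
moment, which needs k = 2, is available already for m = 1. -/
theorem jacksonCoeff_of_eq_succ (m : ℕ) : jacksonCoeff m (m + 1) = 0 := by
  have hN : ((m : ℝ) + 2) ≠ 0 := by positivity
  have hs := (sin_pi_div_pos m).ne'
  have h : ((m + 1 : ℕ) : ℝ) * Real.pi / (m + 2) = Real.pi - Real.pi / (m + 2) := by
    push_cast
    field_simp
    ring
  rw [jacksonCoeff, h, Real.cos_pi_sub, Real.sin_pi_sub]
  push_cast
  field_simp
  ring

theorem chebT_zero (x : ℝ) : chebT 0 x = √(1 / Real.pi) := by simp [chebT]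

theorem chebT_one (x : ℝ) : chebT 1 x = √(2 / Real.pi) * x := by simp [chebT]

theorem chebT_two (x : ℝ) : chebT 2 x = √(2 / Real.pi) * (2 * x ^ 2 - 1) := by
  simp [chebT, Polynomial.Chebyshev.T_two]

namespace IsChebQuad

variable {m : ℕ} {ω : Measure ℝ}

theorem integral_jackson_mul_chebT' (h : IsChebQuad m ω) (u : ℝ) {k : ℕ} (hk : k ≤ m + 1) :
    ∫ v, jackson m u v * chebT k v ∂ω = jacksonCoeff m k * chebT k u := by
  rw [h.integral_jackson_mul_chebT u hk]
  split_ifs with hkm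
  · rfl
  · rw [show k = m + 1 by omega, jacksonCoeff_of_eq_succ, zero_mul]

theorem integral_jackson (h : IsChebQuad m ω) (u : ℝ) : ∫ v, jackson m u v ∂ω = 1 := by
  have hπ := Real.pi_pos
  have h0 := h.integral_jackson_mul_chebT' u (Nat.zero_le _)
  simp_rw [chebT_zero] at h0
  rw [integral_mul_const, jacksonCoeff_zero] at h0
  have : √(1 / Real.pi) ≠ 0 := (Real.sqrt_pos.mpr (by positivity)).ne'
  exact mul_right_cancel₀ this h0

theorem integral_jackson_mul_self (h : IsChebQuad m ω) (hm : 1 ≤ m) (u : ℝ) :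
    ∫ v, jackson m u v * v ∂ω = jacksonCoeff m 1 * u := by
  have hπ := Real.pi_pos
  have h0 := h.integral_jackson_mul_chebT' u (k := 1) (by omega)
  simp_rw [chebT_one, mul_left_comm _ (√(2 / Real.pi))] at h0
  rw [integral_const_mul] at h0
  have : √(2 / Real.pi) ≠ 0 := (Real.sqrt_pos.mpr (by positivity)).ne'
  exact mul_left_cancel₀ this h0

theorem integral_jackson_mul_sq (h : IsChebQuad m ω) (hm : 1 ≤ m) (u : ℝ) :
    ∫ v, jackson m u v * v ^ 2 ∂ω = (1 + jacksonCoeff m 2 * (2 * u ^ 2 - 1)) / 2 := by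
  have hπ := Real.pi_pos
  have h0 := h.integral_jackson_mul_chebT' u (k := 2) (by omega)
  simp_rw [chebT_two, mul_left_comm _ (√(2 / Real.pi))] at h0
  rw [integral_const_mul] at h0
  have : √(2 / Real.pi) ≠ 0 := (Real.sqrt_pos.mpr (by positivity)).ne'
  have h1 := mul_left_cancel₀ this h0
  have hJ := jackson_continuous m u
  have h2 : ∫ v, jackson m u v * (2 * v ^ 2 - 1) ∂ω =
      2 * (∫ v, jackson m u v * v ^ 2 ∂ω) - ∫ v, jackson m u v ∂ω := by
    rw [← integral_const_mul, ← integral_sub (h.integrable (by fun_prop)) (h.integrable hJ)]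
    congr 1 with v
    ring
  rw [h2, h.integral_jackson] at h1
  linarith

theorem integral_jackson_mul_sub_sq (h : IsChebQuad m ω) (hm : 1 ≤ m) (u : ℝ) :
    ∫ v, jackson m u v * (u - v) ^ 2 ∂ω =
      u ^ 2 * (1 - 2 * jacksonCoeff m 1 + jacksonCoeff m 2) + (1 - jacksonCoeff m 2) / 2 := by
  have hJ := jackson_continuous m u
  have h2 : ∫ v, jackson m u v * (u - v) ^ 2 ∂ω =
      u ^ 2 * (∫ v, jackson m u v ∂ω) - 2 * u * (∫ v, jackson m u v * v ∂ω) +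
        ∫ v, jackson m u v * v ^ 2 ∂ω := by
    rw [← integral_const_mul, ← integral_const_mul,
      ← integral_sub (h.integrable (by fun_prop)) (h.integrable (by fun_prop)),
      ← integral_add (h.integrable (by fun_prop)) (h.integrable (by fun_prop))]
    congr 1 with v
    ring
  rw [h2, h.integral_jackson, h.integral_jackson_mul_self hm, h.integral_jackson_mul_sq hm]
  ring

theorem integral_jackson_mul_sub_sq_le (h : IsChebQuad m ω) (hm : 1 ≤ m) {u : ℝ}
    (hu : u ∈ Set.Icc (-1 : ℝ) 1) :
    ∫ v, jackson m u v * (u - v) ^ 2 ∂ω ≤ 2 * Real.pi ^ 2 / m ^ 2 := by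
  rw [h.integral_jackson_mul_sub_sq hm, jacksonCoeff_one, jacksonCoeff_two]
  have hm' : (0 : ℝ) < m := by exact_mod_cast hm
  -- With ρ_1 = cos φ and r = ρ_2, both 1 - 2ρ_1 + ρ_2 ≤ 2(1 - cos φ) and (1 - ρ_2)/2 ≤ (1 - cos
  -- 2φ)/2 are at most φ².
  set φ := Real.pi / ((m : ℝ) + 2) with hφ
  have hφ2 : φ ^ 2 ≤ Real.pi ^ 2 / m ^ 2 := by
    rw [← div_pow]
    refine pow_le_pow_left₀ (by positivity) ?_ 2
    exact div_le_div_of_nonneg_left Real.pi_pos.le hm' (by linarith)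
  have h1 := Real.one_sub_sq_div_two_le_cos (x := φ)
  have h2 := Real.one_sub_sq_div_two_le_cos (x := 2 * φ)
  have hc := Real.cos_le_one φ
  have hc2 := Real.cos_le_one (2 * φ)
  set r := (((m : ℝ) + 1) * Real.cos (2 * φ) + 1) / (m + 2) with hr
  have hr1 : 1 - r ≤ 1 - Real.cos (2 * φ) := by
    have : 1 - r = ((m + 1) / (m + 2)) * (1 - Real.cos (2 * φ)) := by
      rw [hr]; field_simp; ring
    rw [this]
    refine mul_le_of_le_one_left (by linarith) ?_
    rw [div_le_one (by positivity)]
    linarith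
  have hr2 : r ≤ 1 := by
    rw [hr, div_le_one (by positivity)]
    nlinarith
  have hu2 : u ^ 2 ≤ 1 := by nlinarith [hu.1, hu.2]
  have h3 : u ^ 2 * (1 - 2 * Real.cos φ + r) ≤ φ ^ 2 := by
    have : u ^ 2 * (1 - 2 * Real.cos φ + r) ≤ u ^ 2 * φ ^ 2 :=
      mul_le_mul_of_nonneg_left (by linarith) (sq_nonneg u)
    nlinarith [sq_nonneg φ]
  have h4 : 2 * Real.pi ^ 2 / (m : ℝ) ^ 2 = 2 * (Real.pi ^ 2 / m ^ 2) := by ring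
  rw [h4]
  nlinarith

theorem integral_jackson_mul_abs_sub_le (h : IsChebQuad m ω) (hm : 1 ≤ m) {u : ℝ}
    (hu : u ∈ Set.Icc (-1 : ℝ) 1) :
    ∫ v, jackson m u v * |u - v| ∂ω ≤ 11 / m := by
  have hm' : (0 : ℝ) < m := by exact_mod_cast hm
  have hJ := jackson_continuous m u
  have hle : ∫ v, jackson m u v * |u - v| ∂ω ≤
      ∫ v, (1 / (2 * m)) * jackson m u v + (m / 2) * (jackson m u v * (u - v) ^ 2) ∂ω := by
    refine integral_mono_ae (h.integrable (by fun_prop)) (h.integrable (by fun_prop)) ?_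
    filter_upwards [h.ae_mem] with v hv
    have h0 := jackson_nonneg m hu hv
    -- The arithmetic-geometric mean inequality, balanced at |u - v| = 1/m, replaces Cauchy-Schwarz
    -- against the kernel and avoids square roots of integrals.
    have h1 : |u - v| ≤ 1 / (2 * m) + (m / 2) * (u - v) ^ 2 := by
      rw [← sq_abs (u - v)]
      have : 1 / (2 * (m : ℝ)) + m / 2 * |u - v| ^ 2 - |u - v| =
          (m * |u - v| - 1) ^ 2 / (2 * m) := by
        field_simp; ring
      have h2 : 0 ≤ (m * |u - v| - 1) ^ 2 / (2 * m) := by positivity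
      linarith
    nlinarith
  refine hle.trans ?_
  rw [integral_add (h.integrable (by fun_prop)) (h.integrable (by fun_prop)),
    integral_const_mul, integral_const_mul, h.integral_jackson]
  have h2 := h.integral_jackson_mul_sub_sq_le hm hu
  have hπ : Real.pi ^ 2 ≤ 10 := by nlinarith [Real.pi_lt_d2, Real.pi_pos]
  calc _ ≤ 1 / (2 * (m : ℝ)) * 1 + m / 2 * (2 * Real.pi ^ 2 / m ^ 2) := by gcongr
    _ = (1 / 2 + Real.pi ^ 2) / m := by field_simp
    _ ≤ 11 / m := by gcongr; linarith

end IsChebQuad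

/-! ## The two quadrature measures -/

/-- The Chebyshev weight `dx / √(1 - x²)` on `[-1, 1]`. -/
noncomputable def chebWeight : Measure ℝ :=
  (volume.restrict (Set.Icc (-1 : ℝ) 1)).withDensity fun x => ENNReal.ofReal (1 / √(1 - x ^ 2))

theorem chebWeight_eq : chebWeight = Polynomial.Chebyshev.measureT := by
  rw [chebWeight, Polynomial.Chebyshev.measureT, restrict_withDensity measurableSet_Ioc,
    Measure.restrict_congr_set Ioc_ae_eq_Icc]
  congr 1 with x
  rw [ENNReal.ofReal, one_div]
  congr 1
  rw [Real.toNNReal_of_nonneg (by positivity)]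
  ext
  exact (Real.sqrt_inv _).symm

theorem isChebQuad_chebWeight (m : ℕ) : IsChebQuad m chebWeight where
  finite := by
    rw [chebWeight_eq]
    have h := Polynomial.Chebyshev.integrable_measureT (f := fun _ => (1 : ℝ)) continuousOn_const
    rwa [integrable_const_iff_isFiniteMeasure one_ne_zero] at h
  supp := by
    rw [chebWeight, withDensity_apply _ measurableSet_Icc.compl,
      Measure.restrict_restrict measurableSet_Icc.compl]
    simp
  total := by
    rw [chebWeight_eq]
    have := Polynomial.Chebyshev.integral_eval_T_real_measureT_zero
    simpa using this
  integral_T k hk _ := by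
    rw [chebWeight_eq]
    exact Polynomial.Chebyshev.integral_eval_T_real_measureT_of_ne_zero hk

/-- The angles of the Gauss-Chebyshev nodes. -/
noncomputable def gaussAngle (m i : ℕ) : ℝ := (2 * i + 1) * Real.pi / (2 * (m + 1))

/-- The Gauss-Chebyshev nodes. -/
noncomputable def gaussNode (m i : ℕ) : ℝ := Real.cos (gaussAngle m i)

/-- The Gauss-Chebyshev quadrature rule with `m + 1` nodes. -/
noncomputable def gaussRule (m : ℕ) : Measure ℝ :=
  ENNReal.ofReal (Real.pi / (m + 1)) •
    ∑ i ∈ Finset.range (m + 1), Measure.dirac (gaussNode m i)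

theorem integral_gaussRule (m : ℕ) (g : ℝ → ℝ) :
    ∫ x, g x ∂gaussRule m =
      Real.pi / (m + 1) * ∑ i ∈ Finset.range (m + 1), g (gaussNode m i) := by
  have hπ := Real.pi_pos
  rw [gaussRule, integral_smul_measure, integral_finsetSum_measure]
  · simp only [integral_dirac, smul_eq_mul]
    rw [ENNReal.toReal_ofReal (by positivity)]
  · intro i _
    exact integrable_dirac (by simp)

theorem lintegral_gaussRule (m : ℕ) (g : ℝ → ℝ≥0∞) :
    ∫⁻ x, g x ∂gaussRule m =
      ENNReal.ofReal (Real.pi / (m + 1)) * ∑ i ∈ Finset.range (m + 1), g (gaussNode m i) := by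
  rw [gaussRule, lintegral_smul_measure, lintegral_finsetSum_measure]
  simp

theorem isChebQuad_gaussRule (m : ℕ) : IsChebQuad m (gaussRule m) where
  finite := by
    refine ⟨?_⟩
    rw [gaussRule, Measure.smul_apply, Measure.finsetSum_apply]
    simp [ENNReal.mul_lt_top_iff]
  supp := by
    rw [gaussRule, Measure.smul_apply, Measure.finsetSum_apply]
    have : ∀ i, gaussNode m i ∈ Set.Icc (-1 : ℝ) 1 := fun i => Real.cos_mem_Icc _
    simp [Measure.dirac_apply' _ measurableSet_Icc.compl, this]
  total := by
    rw [integral_gaussRule]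
    simp
    field_simp
  integral_T k hk hk' := by
    -- The sum of T_k over the zeros of T_{m+1} can only be nonzero when 2(m+1) divides k, which |k|
    -- ≤ 2m + 1 and k ≠ 0 exclude.
    have h := Polynomial.Chebyshev.sumZeroes_T_of_not_dvd (n := m + 1) (k := k) (by
      intro hd
      have := Int.le_of_dvd (abs_pos.mpr hk) ((dvd_abs _ _).mpr hd)
      push_cast at this
      omega)
    rw [integral_gaussRule, ← h, Polynomial.Chebyshev.sumZeroes]
    push_cast
    congr 1
    refine Finset.sum_congr rfl fun i _ => ?_
    rw [gaussNode, gaussAngle]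
    congr 2
    ring

end SpecDens

namespace SpecDens

/-! ## Kernel smoothing of a weighted point configuration -/

/-- The point `s (x + i y)` of the square `[-s, s] + i [-s, s]`. -/
noncomputable def squarePoint (s : ℝ) (q : ℝ × ℝ) : ℂ := (s : ℂ) * (q.1 + Complex.I * q.2)

theorem continuous_squarePoint (s : ℝ) : Continuous (squarePoint s) := by
  unfold squarePoint
  fun_prop

/-- The superposition of tensor products of Jackson kernels centered at the points `(x l, y l)`. -/
noncomputable def jacksonMixture (m : ℕ) {ι : Type*} [Fintype ι] (w x y : ι → ℝ) (q : ℝ × ℝ) : ℝ :=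
  ∑ l, w l * (jackson m (x l) q.1 * jackson m (y l) q.2)

/-- The image under `squarePoint s` of the measure with density `p` relative to `ω ⊗ ω`. -/
noncomputable def kernelMeasure (ω : Measure ℝ) (s : ℝ) (p : ℝ × ℝ → ℝ) : Measure ℂ :=
  Measure.map (squarePoint s) ((ω.prod ω).withDensity fun q => ENNReal.ofReal (p q))

/-- Weights of a probability distribution on points of `[-1, 1]²`. -/
structure IsWeighted {ι : Type*} [Fintype ι] (w x y : ι → ℝ) : Prop where
  nonneg : ∀ l, 0 ≤ w l
  sum_eq : ∑ l, w l = 1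
  left : ∀ l, x l ∈ Set.Icc (-1 : ℝ) 1
  right : ∀ l, y l ∈ Set.Icc (-1 : ℝ) 1

theorem dist_squarePoint_le {s : ℝ} (hs : 0 ≤ s) (p q : ℝ × ℝ) :
    dist (squarePoint s p) (squarePoint s q) ≤ s * (|p.1 - q.1| + |p.2 - q.2|) := by
  have : squarePoint s p - squarePoint s q =
      (s : ℂ) * (((p.1 - q.1 : ℝ) : ℂ) + Complex.I * ((p.2 - q.2 : ℝ) : ℂ)) := by
    simp only [squarePoint]
    push_cast
    ring
  rw [dist_eq_norm, this, norm_mul, Complex.norm_real, Real.norm_of_nonneg hs]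
  refine mul_le_mul_of_nonneg_left ((norm_add_le _ _).trans ?_) hs
  rw [norm_mul, Complex.norm_I, one_mul, Complex.norm_real, Complex.norm_real]
  rfl

section

variable {m : ℕ} {ω : Measure ℝ} {ι : Type*} [Fintype ι] {w x y : ι → ℝ}

theorem continuous_jacksonMixture : Continuous (jacksonMixture m w x y) := by
  unfold jacksonMixture
  have := jackson_continuous m
  fun_prop

theorem IsChebQuad.prod_supp (h : IsChebQuad m ω) :
    (ω.prod ω) (Set.Icc (-1 : ℝ) 1 ×ˢ Set.Icc (-1 : ℝ) 1)ᶜ = 0 := by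
  have := h.finite
  rw [Set.compl_prod_eq_union]
  refine measure_union_null ?_ ?_
  · rw [Measure.prod_prod, h.supp, zero_mul]
  · rw [Measure.prod_prod, h.supp, mul_zero]

theorem IsChebQuad.ae_mem_prod (h : IsChebQuad m ω) :
    ∀ᵐ q ∂(ω.prod ω), q ∈ Set.Icc (-1 : ℝ) 1 ×ˢ Set.Icc (-1 : ℝ) 1 := by
  rw [ae_iff]
  exact h.prod_supp

theorem IsChebQuad.integrable_prod (h : IsChebQuad m ω) {g : ℝ × ℝ → ℝ} (hg : Continuous g) :
    Integrable g (ω.prod ω) :=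
  have := h.finite
  integrable_of_continuousOn_compact (isCompact_Icc.prod isCompact_Icc) h.prod_supp
    hg.continuousOn

theorem IsWeighted.jacksonMixture_nonneg (hw : IsWeighted w x y) {q : ℝ × ℝ}
    (hq : q ∈ Set.Icc (-1 : ℝ) 1 ×ˢ Set.Icc (-1 : ℝ) 1) : 0 ≤ jacksonMixture m w x y q :=
  Finset.sum_nonneg fun l _ => mul_nonneg (hw.nonneg l)
    (mul_nonneg (jackson_nonneg m (hw.left l) hq.1) (jackson_nonneg m (hw.right l) hq.2))

theorem integral_kernelMeasure (h : IsChebQuad m ω) (hw : IsWeighted w x y) (s : ℝ) {f : ℂ → ℝ}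
    (hf : Continuous f) :
    ∫ z, f z ∂kernelMeasure ω s (jacksonMixture m w x y) =
      ∑ l, w l * ∫ q, jackson m (x l) q.1 * jackson m (y l) q.2 * f (squarePoint s q)
        ∂(ω.prod ω) := by
  have := h.finite
  have hc := continuous_jacksonMixture (m := m) (w := w) (x := x) (y := y)
  have hJ := jackson_continuous m
  have hφ := continuous_squarePoint s
  rw [kernelMeasure, integral_map hφ.aemeasurable hf.aestronglyMeasurable,
    integral_withDensity_eq_integral_toReal_smul (by fun_prop) (by simp)]
  have h1 : ∫ q, (ENNReal.ofReal (jacksonMixture m w x y q)).toReal • f (squarePoint s q)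
        ∂(ω.prod ω) =
      ∫ q, ∑ l, w l * (jackson m (x l) q.1 * jackson m (y l) q.2 * f (squarePoint s q))
        ∂(ω.prod ω) := by
    refine integral_congr_ae ?_
    filter_upwards [h.ae_mem_prod] with q hq
    -- `ENNReal.ofReal` would cut off negative values of the density; positivity of the Jackson
    -- kernel on the square is what makes the integral linear in the weights.
    rw [ENNReal.toReal_ofReal (hw.jacksonMixture_nonneg hq), smul_eq_mul, jacksonMixture,
      Finset.sum_mul]
    exact Finset.sum_congr rfl fun l _ => by ring
  rw [h1, integral_finsetSum]
  · simp_rw [integral_const_mul]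
  · intro l _
    exact h.integrable_prod (by fun_prop)

/-- Each kernel has integral one in each variable, so the total mass is the sum of the weights. -/
theorem isProbabilityMeasure_kernelMeasure (h : IsChebQuad m ω) (hw : IsWeighted w x y) (s : ℝ) :
    IsProbabilityMeasure (kernelMeasure ω s (jacksonMixture m w x y)) := by
  have := h.finite
  have hc := continuous_jacksonMixture (m := m) (w := w) (x := x) (y := y)
  have hfin : IsFiniteMeasure (kernelMeasure ω s (jacksonMixture m w x y)) := by
    have : IsFiniteMeasure ((ω.prod ω).withDensity fun q =>
        ENNReal.ofReal (jacksonMixture m w x y q)) :=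
      isFiniteMeasure_withDensity_ofReal (h.integrable_prod hc).2
    unfold kernelMeasure
    infer_instance
  have h1 := integral_kernelMeasure h hw s (f := fun _ => 1) continuous_const
  simp only [mul_one, integral_prod_mul (jackson m _) (jackson m _), h.integral_jackson, hw.sum_eq,
    integral_const, smul_eq_mul] at h1
  refine ⟨?_⟩
  rwa [measureReal_def, ENNReal.toReal_eq_one_iff] at h1

theorem kernelMeasure_compl_square (h : IsChebQuad m ω) {s : ℝ} (hs : 0 ≤ s) (p : ℝ × ℝ → ℝ) :
    kernelMeasure ω s p (square s)ᶜ = 0 := by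
  have hmeas : MeasurableSet (square s) := by
    have h1 : MeasurableSet {z : ℂ | |z.re| ≤ s} := measurableSet_le (by fun_prop) measurable_const
    have h2 : MeasurableSet {z : ℂ | |z.im| ≤ s} := measurableSet_le (by fun_prop) measurable_const
    exact h1.inter h2
  rw [kernelMeasure, Measure.map_apply (continuous_squarePoint s).measurable hmeas.compl]
  refine withDensity_absolutelyContinuous _ _ (measure_mono_null ?_ h.prod_supp)
  intro q hq hmem
  refine hq ?_
  have h1 : |q.1| ≤ 1 := abs_le.mpr hmem.1
  have h2 : |q.2| ≤ 1 := abs_le.mpr hmem.2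
  simp only [square, squarePoint, Set.mem_ofPred_eq]
  simp only [Complex.mul_re, Complex.ofReal_re, Complex.add_re, Complex.I_re, Complex.I_im,
    Complex.ofReal_im, Complex.add_im, Complex.mul_im]
  simp only [zero_mul, mul_zero, sub_zero, one_mul, add_zero, zero_add, sub_self, abs_mul,
    abs_of_nonneg hs]
  exact ⟨mul_le_of_le_one_right hs h1, mul_le_of_le_one_right hs h2⟩

/-- A tensor kernel has mass one, so replacing a point mass by it changes ∫f by an average of
increments of f. The Lipschitz bound splits these into two first absolute moments, each at most
11/m. -/
theorem abs_sum_sub_integral_kernelMeasure_le (h : IsChebQuad m ω) (hm : 1 ≤ m)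
    (hw : IsWeighted w x y) {s : ℝ} (hs : 0 ≤ s) {f : ℂ → ℝ} (hf : LipschitzWith 1 f) :
    |∑ l, w l * f (squarePoint s (x l, y l)) -
      ∫ z, f z ∂kernelMeasure ω s (jacksonMixture m w x y)| ≤ s * (22 / m) := by
  have := h.finite
  have hJ := jackson_continuous m
  have hφ := continuous_squarePoint s
  have hfc := hf.continuous
  have key : ∀ l, |f (squarePoint s (x l, y l)) -
      ∫ q, jackson m (x l) q.1 * jackson m (y l) q.2 * f (squarePoint s q) ∂(ω.prod ω)| ≤
      s * (22 / m) := by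
    intro l
    have hone : ∫ q, jackson m (x l) q.1 * jackson m (y l) q.2 ∂(ω.prod ω) = 1 := by
      rw [integral_prod_mul, h.integral_jackson, h.integral_jackson, one_mul]
    have hconst : f (squarePoint s (x l, y l)) = ∫ q, jackson m (x l) q.1 * jackson m (y l) q.2 *
        f (squarePoint s (x l, y l)) ∂(ω.prod ω) := by
      rw [integral_mul_const, hone, one_mul]
    rw [hconst, ← integral_sub (h.integrable_prod (by fun_prop)) (h.integrable_prod (by fun_prop))]
    calc _ ≤ ∫ q, ‖jackson m (x l) q.1 * jackson m (y l) q.2 * f (squarePoint s (x l, y l)) -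
          jackson m (x l) q.1 * jackson m (y l) q.2 * f (squarePoint s q)‖ ∂(ω.prod ω) :=
          norm_integral_le_integral_norm _
      _ ≤ ∫ q, s * ((jackson m (x l) q.1 * |x l - q.1|) * jackson m (y l) q.2 +
          jackson m (x l) q.1 * (jackson m (y l) q.2 * |y l - q.2|)) ∂(ω.prod ω) := by
          refine integral_mono_ae (h.integrable_prod (by fun_prop))
            (h.integrable_prod (by fun_prop)) ?_
          filter_upwards [h.ae_mem_prod] with q hq
          have h1 := jackson_nonneg m (hw.left l) hq.1
          have h2 := jackson_nonneg m (hw.right l) hq.2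
          rw [← mul_sub, Real.norm_eq_abs, abs_mul, abs_of_nonneg (mul_nonneg h1 h2)]
          have h3 := hf.dist_le_mul (squarePoint s (x l, y l)) (squarePoint s q)
          rw [NNReal.coe_one, one_mul, Real.dist_eq] at h3
          have h4 := h3.trans (dist_squarePoint_le hs _ _)
          calc _ ≤ jackson m (x l) q.1 * jackson m (y l) q.2 *
              (s * (|x l - q.1| + |y l - q.2|)) := by gcongr
            _ = _ := by ring
      _ = s * ((∫ v, jackson m (x l) v * |x l - v| ∂ω) + ∫ v, jackson m (y l) v * |y l - v| ∂ω) := by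
          rw [integral_const_mul, integral_add (h.integrable_prod (by fun_prop))
            (h.integrable_prod (by fun_prop)),
            integral_prod_mul (fun v => jackson m (x l) v * |x l - v|) (jackson m (y l)),
            integral_prod_mul (jackson m (x l)) (fun v => jackson m (y l) v * |y l - v|),
            h.integral_jackson, h.integral_jackson, one_mul, mul_one]
      _ ≤ s * (11 / m + 11 / m) := by
          gcongr
          · exact h.integral_jackson_mul_abs_sub_le hm (hw.left l)
          · exact h.integral_jackson_mul_abs_sub_le hm (hw.right l)
      _ = _ := by ring
  rw [integral_kernelMeasure h hw s hfc, ← Finset.sum_sub_distrib]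
  calc _ ≤ ∑ l, |w l * f (squarePoint s (x l, y l)) - w l *
        ∫ q, jackson m (x l) q.1 * jackson m (y l) q.2 * f (squarePoint s q) ∂(ω.prod ω)| :=
        Finset.abs_sum_le_sum_abs _ _
    _ ≤ ∑ l, w l * (s * (22 / m)) := by
        refine Finset.sum_le_sum fun l _ => ?_
        rw [← mul_sub, abs_mul, abs_of_nonneg (hw.nonneg l)]
        exact mul_le_mul_of_nonneg_left (key l) (hw.nonneg l)
    _ = _ := by rw [← Finset.sum_mul, hw.sum_eq, one_mul]

end

/-! ## Densities and atoms of the kernel measures -/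

theorem densityMeasure_eq_kernelMeasure (m : ℕ) (s : ℝ) (l : List ℂ) :
    densityMeasure m s l = kernelMeasure chebWeight s fun q => kpmPoly m l q.1 q.2 := by
  have hp : Measurable fun q : ℝ × ℝ => ENNReal.ofReal (kpmPoly m l q.1 q.2) := by
    unfold kpmPoly
    have := fun j => (chebT_continuous j).measurable
    fun_prop
  have hd : Measurable fun x : ℝ => ENNReal.ofReal (1 / √(1 - x ^ 2)) := by fun_prop
  rw [densityMeasure, kernelMeasure]
  congr 1
  rw [chebWeight, prod_withDensity hd hd, ← withDensity_mul _ (by fun_prop) hp,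
    Measure.prod_restrict, Measure.volume_eq_prod]
  congr 1 with q
  have h0 : 0 ≤ 1 / √(1 - q.1 ^ 2) := by positivity
  have h1 : 0 ≤ 1 / √(1 - q.1 ^ 2) * (1 / √(1 - q.2 ^ 2)) := by positivity
  -- Only the weights have to be nonnegative here, so the identity holds for every list, whatever
  -- the sign of the polynomial.
  rw [Pi.mul_apply, ← ENNReal.ofReal_mul h0, ← ENNReal.ofReal_mul h1]
  congr 1
  ring

theorem kernelMeasure_gaussRule (m : ℕ) (s : ℝ) {p : ℝ × ℝ → ℝ} (hp : Continuous p) :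
    kernelMeasure (gaussRule m) s p =
      ∑ j ∈ Finset.range (m + 1), ∑ k ∈ Finset.range (m + 1),
        ENNReal.ofReal (Real.pi / (m + 1) * (Real.pi / (m + 1)) *
          p (gaussNode m j, gaussNode m k)) •
        Measure.dirac (squarePoint s (gaussNode m j, gaussNode m k)) := by
  have := (isChebQuad_gaussRule m).finite
  have hπ := Real.pi_pos
  have hφ := (continuous_squarePoint s).measurable
  ext S hS
  have hpm := hp.measurable
  rw [kernelMeasure, Measure.map_apply hφ hS, withDensity_apply _ (hφ hS),
    ← lintegral_indicator (hφ hS), lintegral_prod _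
      ((by fun_prop : Measurable fun q => ENNReal.ofReal (p q)).indicator (hφ hS)).aemeasurable]
  simp_rw [lintegral_gaussRule]
  rw [Measure.finsetSum_apply, Finset.mul_sum]
  refine Finset.sum_congr rfl fun j _ => ?_
  rw [Measure.finsetSum_apply, Finset.mul_sum, Finset.mul_sum]
  refine Finset.sum_congr rfl fun k _ => ?_
  rw [Measure.smul_apply, Measure.dirac_apply' _ hS, smul_eq_mul, ENNReal.ofReal_mul (by positivity),
    ENNReal.ofReal_mul (by positivity)]
  by_cases hmem : squarePoint s (gaussNode m j, gaussNode m k) ∈ S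
  · simp [Set.indicator, hmem, mul_assoc]
  · simp [Set.indicator, hmem]

/-- The finite-sum form of the smoothed integral, in which Chebyshev coefficients on the grid can be
recognized. -/
theorem integral_kernelMeasure_gaussRule {m : ℕ} {ι : Type*} [Fintype ι] {w x y : ι → ℝ}
    (hw : IsWeighted w x y) (s : ℝ) {f : ℂ → ℝ} (hf : Continuous f) :
    ∫ z, f z ∂kernelMeasure (gaussRule m) s (jacksonMixture m w x y) =
      (Real.pi / (m + 1)) ^ 2 * ∑ i ∈ Finset.range (m + 1), ∑ k ∈ Finset.range (m + 1),
        jacksonMixture m w x y (gaussNode m i, gaussNode m k) *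
          f (squarePoint s (gaussNode m i, gaussNode m k)) := by
  have := (isChebQuad_gaussRule m).finite
  have hJ := jackson_continuous m
  have hφ := continuous_squarePoint s
  rw [integral_kernelMeasure (isChebQuad_gaussRule m) hw s hf]
  have h1 : ∀ l, ∫ q, jackson m (x l) q.1 * jackson m (y l) q.2 * f (squarePoint s q)
      ∂((gaussRule m).prod (gaussRule m)) =
      (Real.pi / (m + 1)) ^ 2 * ∑ i ∈ Finset.range (m + 1), ∑ k ∈ Finset.range (m + 1),
        jackson m (x l) (gaussNode m i) * jackson m (y l) (gaussNode m k) *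
          f (squarePoint s (gaussNode m i, gaussNode m k)) := by
    intro l
    rw [integral_prod _ ((isChebQuad_gaussRule m).integrable_prod (by fun_prop))]
    simp_rw [integral_gaussRule]
    rw [sq, ← Finset.mul_sum, mul_assoc]
  simp_rw [h1, jacksonMixture, Finset.sum_mul, Finset.mul_sum]
  rw [Finset.sum_comm]
  refine Finset.sum_congr rfl fun i _ => ?_
  rw [Finset.sum_comm]
  refine Finset.sum_congr rfl fun k _ => Finset.sum_congr rfl fun l _ => by ring

end SpecDens

namespace SpecDens

/-! ## Spectral decomposition of normal matrices -/

/-- Commuting symmetric operators split the space into an orthogonal sum of joint eigenspaces; the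
basis collects orthonormal bases of these. -/
theorem exists_orthonormalBasis_joint_eigenvectors {E : Type*} [NormedAddCommGroup E]
    [InnerProductSpace ℂ E] [FiniteDimensional ℂ E] {n : ℕ} (hn : Module.finrank ℂ E = n)
    {S T : E →ₗ[ℂ] E} (hS : S.IsSymmetric) (hT : T.IsSymmetric) (hST : Commute S T) :
    ∃ (u : OrthonormalBasis (Fin n) ℂ E) (α β : Fin n → ℂ),
      ∀ l, S (u l) = α l • u l ∧ T (u l) = β l • u l := by
  classical
  have hint := LinearMap.IsSymmetric.directSum_isInternal_of_commute hS hT hST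
  have hfam := LinearMap.IsSymmetric.orthogonalFamily_eigenspace_inf_eigenspace hS hT
  -- The pairs of potential eigenvalues form an infinite index type, so the decomposition is first
  -- restricted to the nonzero joint eigenspaces, finitely many by independence.
  have hfin : Finite {i : ℂ × ℂ // Module.End.eigenspace S i.2 ⊓ Module.End.eigenspace T i.1 ≠ ⊥} :=
    WellFoundedGT.finite_ne_bot_of_iSupIndep hfam.independent
  have := Fintype.ofFinite
    {i : ℂ × ℂ // Module.End.eigenspace S i.2 ⊓ Module.End.eigenspace T i.1 ≠ ⊥}
  have hint' := DirectSum.isInternal_ne_bot_iff.mpr hint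
  have hfam' := hfam.comp (f := (Subtype.val :
    {i : ℂ × ℂ // Module.End.eigenspace S i.2 ⊓ Module.End.eigenspace T i.1 ≠ ⊥} → ℂ × ℂ))
    Subtype.val_injective
  refine ⟨hint'.subordinateOrthonormalBasis hn hfam',
    fun l => (hint'.subordinateOrthonormalBasisIndex hn l hfam').1.2,
    fun l => (hint'.subordinateOrthonormalBasisIndex hn l hfam').1.1, fun l => ?_⟩
  have h := hint'.subordinateOrthonormalBasis_subordinate hn l hfam'
  exact ⟨Module.End.mem_eigenspace_iff.mp h.1, Module.End.mem_eigenspace_iff.mp h.2⟩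

/-- An orthonormal basis of eigenvectors of `A` and of `Aᴴ`, with the eigenvalues. -/
structure IsEigenbasis {n : ℕ} (A : Matrix (Fin n) (Fin n) ℂ)
    (u : OrthonormalBasis (Fin n) ℂ (EuclideanSpace ℂ (Fin n))) (lam : Fin n → ℂ) : Prop where
  mulVec : ∀ l, A.mulVec (u l).ofLp = lam l • (u l).ofLp
  conjTranspose_mulVec : ∀ l, A.conjTranspose.mulVec (u l).ofLp = star (lam l) • (u l).ofLp

theorem exists_isEigenbasis {n : ℕ} {A : Matrix (Fin n) (Fin n) ℂ} (hA : IsStarNormal A) :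
    ∃ u lam, IsEigenbasis A u lam := by
  -- These are twice the Hermitian and skew parts, so that A = (H + iK)/2 and Aᴴ = (H - iK)/2.
  set H : Matrix (Fin n) (Fin n) ℂ := A + A.conjTranspose with hH
  set K : Matrix (Fin n) (Fin n) ℂ := Complex.I • (A.conjTranspose - A) with hK
  have hHh : H.IsHermitian := by
    rw [Matrix.IsHermitian, hH, Matrix.conjTranspose_add, Matrix.conjTranspose_conjTranspose,
      add_comm]
  have hKh : K.IsHermitian := by
    rw [Matrix.IsHermitian, hK, Matrix.conjTranspose_smul, Matrix.conjTranspose_sub,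
      Matrix.conjTranspose_conjTranspose]
    simp [smul_sub, neg_add_eq_sub]
  have hcomm : A * A.conjTranspose = A.conjTranspose * A := hA.star_comm_self.eq.symm
  have hHK : Commute H K := by
    rw [hH, hK, Commute, SemiconjBy]
    rw [mul_smul_comm, smul_mul_assoc]
    congr 1
    noncomm_ring
    rw [hcomm]
    abel
  have hlin : Commute (Matrix.toEuclideanLin H) (Matrix.toEuclideanLin K) := by
    ext v i
    have := congrArg (fun M : Matrix (Fin n) (Fin n) ℂ => M.mulVec v.ofLp) hHK.eq
    simp only [← Matrix.mulVec_mulVec] at this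
    simpa using congrFun this i
  obtain ⟨u, α, β, hu⟩ := exists_orthonormalBasis_joint_eigenvectors
    (finrank_euclideanSpace_fin (𝕜 := ℂ) (n := n))
    (Matrix.isSymmetric_toEuclideanLin_iff.mpr hHh) (Matrix.isSymmetric_toEuclideanLin_iff.mpr hKh)
    hlin
  have hH' : ∀ l, A.mulVec (u l).ofLp + A.conjTranspose.mulVec (u l).ofLp = α l • (u l).ofLp := by
    intro l
    have := congrArg WithLp.ofLp (hu l).1
    simpa [hH, Matrix.add_mulVec] using this
  have hK' : ∀ l, A.conjTranspose.mulVec (u l).ofLp - A.mulVec (u l).ofLp =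
      -(Complex.I * β l) • (u l).ofLp := by
    intro l
    have := congrArg (fun v => -Complex.I • WithLp.ofLp v) (hu l).2
    simp only [hK, Matrix.ofLp_toLpLin, Matrix.toLin'_apply, Matrix.smul_mulVec, Matrix.sub_mulVec, smul_smul,
      WithLp.ofLp_smul] at this
    simpa using this
  have hA1 : ∀ l, A.mulVec (u l).ofLp = ((α l + Complex.I * β l) / 2) • (u l).ofLp := by
    intro l
    ext i
    have h1 := congrFun (hH' l) i
    have h2 := congrFun (hK' l) i
    simp only [Pi.add_apply, Pi.sub_apply, Pi.smul_apply, smul_eq_mul] at h1 h2 ⊢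
    linear_combination (h1 - h2) / 2
  have hA2 : ∀ l, A.conjTranspose.mulVec (u l).ofLp =
      ((α l - Complex.I * β l) / 2) • (u l).ofLp := by
    intro l
    ext i
    have h1 := congrFun (hH' l) i
    have h2 := congrFun (hK' l) i
    simp only [Pi.add_apply, Pi.sub_apply, Pi.smul_apply, smul_eq_mul] at h1 h2 ⊢
    linear_combination (h1 + h2) / 2
  refine ⟨u, fun l => (α l + Complex.I * β l) / 2, hA1, fun l => ?_⟩
  rw [hA2]
  congr 1
  -- The eigenvalues α and β are known only as complex numbers. Computing the inner product of u_l
  -- with Aᴴ u_l in two ways gives the conjugacy of the eigenvalues without showing that α and β are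
  -- real.
  have hu1 : star (u l).ofLp ⬝ᵥ (u l).ofLp = 1 := by
    have := u.orthonormal.1 l
    have h2 : inner ℂ (u l) (u l) = (1 : ℂ) := by
      rw [inner_self_eq_norm_sq_to_K, this]; simp
    rwa [EuclideanSpace.inner_eq_star_dotProduct, dotProduct_comm] at h2
  have h1 : star (u l).ofLp ⬝ᵥ A.conjTranspose.mulVec (u l).ofLp =
      (α l - Complex.I * β l) / 2 := by
    rw [hA2, dotProduct_smul, hu1, smul_eq_mul, mul_one]
  have h2 : star (u l).ofLp ⬝ᵥ A.conjTranspose.mulVec (u l).ofLp =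
      star ((α l + Complex.I * β l) / 2) := by
    rw [Matrix.dotProduct_mulVec, ← Matrix.star_mulVec, hA1, star_smul, smul_dotProduct, hu1,
      smul_eq_mul, mul_one]
  rw [← h1, h2]

/-- In the eigenbasis the matrix is diagonal, and the characteristic polynomial does not depend on
the basis; this accounts for multiplicities. -/
theorem IsEigenbasis.roots_charpoly {n : ℕ} {A : Matrix (Fin n) (Fin n) ℂ}
    {u : OrthonormalBasis (Fin n) ℂ (EuclideanSpace ℂ (Fin n))} {lam : Fin n → ℂ}
    (h : IsEigenbasis A u lam) : A.charpoly.roots = Finset.univ.val.map lam := by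
  have h1 : LinearMap.toMatrix u.toBasis u.toBasis (Matrix.toEuclideanLin A) =
      Matrix.diagonal lam := by
    ext i j
    have hj : Matrix.toEuclideanLin A (u j) = lam j • u j := by
      ext k
      simpa using congrFun (h.mulVec j) k
    rw [LinearMap.toMatrix_apply, OrthonormalBasis.coe_toBasis, hj, map_smul]
    rw [← OrthonormalBasis.coe_toBasis, Module.Basis.repr_self]
    by_cases hij : i = j
    · subst hij; simp
    · simp [Matrix.diagonal_apply_ne _ hij, Ne.symm hij]
  have h2 : A.charpoly = ∏ i, (Polynomial.X - Polynomial.C (lam i)) := by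
    rw [← Matrix.charpoly_diagonal, ← h1, LinearMap.charpoly_toMatrix, Matrix.toEuclideanLin, Matrix.toLpLin_eq_toLin,
      Matrix.charpoly_toLin]
  rw [h2, ← Polynomial.roots_multiset_prod_X_sub_C (Finset.univ.val.map lam), Multiset.map_map]
  rfl

theorem IsEigenbasis.norm_le {n : ℕ} {A : Matrix (Fin n) (Fin n) ℂ}
    {u : OrthonormalBasis (Fin n) ℂ (EuclideanSpace ℂ (Fin n))} {lam : Fin n → ℂ}
    (h : IsEigenbasis A u lam) (l : Fin n) : ‖lam l‖ ≤ specNorm A := by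
  have h1 := (Matrix.toEuclideanCLM (𝕜 := ℂ) A).le_opNorm (u l)
  have h2 : Matrix.toEuclideanCLM (𝕜 := ℂ) A (u l) = lam l • u l := by
    ext k
    simpa using congrFun (h.mulVec l) k
  rw [h2, norm_smul, u.orthonormal.1 l, mul_one, mul_one] at h1
  exact h1

theorem IsEigenbasis.integral_spectralDensity {n : ℕ} {A : Matrix (Fin n) (Fin n) ℂ}
    {u : OrthonormalBasis (Fin n) ℂ (EuclideanSpace ℂ (Fin n))} {lam : Fin n → ℂ}
    (h : IsEigenbasis A u lam) (f : ℂ → ℝ) :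
    ∫ z, f z ∂spectralDensity A = ∑ l, (1 / n : ℝ) * f (lam l) := by
  have h1 : (A.charpoly.roots.map (fun z : ℂ => Measure.dirac z)).sum =
      ∑ l, Measure.dirac (lam l) := by
    rw [h.roots_charpoly, Multiset.map_map]
    rfl
  rw [spectralDensity, h1, integral_smul_measure, integral_finsetSum_measure]
  · simp [Finset.mul_sum]
  · intro i _
    exact integrable_dirac (by simp)

end SpecDens

namespace SpecDens

/-! ## Concentration on the complex unit sphere -/

/-- Polar coordinates: on a cone the indicator depends only on the direction, so a radial integrand
factors. Ratios of such integrals are spherical probabilities, which lets a Gaussian weight replace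
the uniform distribution. -/
theorem setLIntegral_cone_eq {E : Type*} [NormedAddCommGroup E] [NormedSpace ℝ E]
    [FiniteDimensional ℝ E] [Nontrivial E] [MeasurableSpace E] [BorelSpace E] (μ : Measure E)
    [μ.IsAddHaarMeasure] {g : ℝ → ℝ≥0∞} (hg : Measurable g) {K : Set E} (hK : MeasurableSet K)
    (hcone : ∀ (r : ℝ) (z : E), 0 < r → (r • z ∈ K ↔ z ∈ K)) :
    ∫⁻ z in K, g ‖z‖ ∂μ = μ.toSphere {b | (b : E) ∈ K} *
      ∫⁻ r, g (r : ℝ) ∂Measure.volumeIoiPow (Module.finrank ℝ E - 1) := by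
  have hS : MeasurableSet {b : Metric.sphere (0 : E) 1 | (b : E) ∈ K} :=
    measurable_subtype_coe hK
  have hind : Measurable ({b : Metric.sphere (0 : E) 1 | (b : E) ∈ K}.indicator
      fun _ => (1 : ℝ≥0∞)) := measurable_const.indicator hS
  have hg' : Measurable fun r : Set.Ioi (0 : ℝ) => g (r : ℝ) := hg.comp measurable_subtype_coe
  have hmp := μ.measurePreserving_homeomorphUnitSphereProd
  have h0 : (MeasurableSet ({0}ᶜ : Set E)) := (measurableSet_singleton _).compl
  calc ∫⁻ z in K, g ‖z‖ ∂μ = ∫⁻ z in ({0}ᶜ : Set E), K.indicator (fun z => g ‖z‖) z ∂μ := by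
        rw [← lintegral_indicator hK, restrict_compl_singleton]
    _ = ∫⁻ z : ({0}ᶜ : Set E), K.indicator (fun z => g ‖z‖) (z : E) ∂(μ.comap (↑)) :=
        (lintegral_subtype_comap h0 _).symm
    _ = ∫⁻ z : ({0}ᶜ : Set E), (fun q : Metric.sphere (0 : E) 1 × Set.Ioi (0 : ℝ) =>
          ({b : Metric.sphere (0 : E) 1 | (b : E) ∈ K}.indicator (fun _ => (1 : ℝ≥0∞)) q.1) *
            g (q.2 : ℝ)) (homeomorphUnitSphereProd E z) ∂(μ.comap (↑)) := by
        refine lintegral_congr fun z => ?_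
        have hz : 0 < ‖(z : E)‖ := norm_pos_iff.mpr z.2
        have hmem : ‖(z : E)‖⁻¹ • (z : E) ∈ K ↔ (z : E) ∈ K := hcone _ _ (inv_pos.mpr hz)
        by_cases hzK : (z : E) ∈ K
        · simp [Set.indicator, hzK, hmem]
        · simp [Set.indicator, hzK, hmem]
    _ = ∫⁻ q, (fun q : Metric.sphere (0 : E) 1 × Set.Ioi (0 : ℝ) =>
          ({b : Metric.sphere (0 : E) 1 | (b : E) ∈ K}.indicator (fun _ => (1 : ℝ≥0∞)) q.1) *
            g (q.2 : ℝ)) q ∂(μ.toSphere.prod (Measure.volumeIoiPow (Module.finrank ℝ E - 1))) :=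
        hmp.lintegral_comp ((hind.comp measurable_fst).mul (hg'.comp measurable_snd))
    _ = _ := by
        rw [lintegral_prod_mul hind.aemeasurable hg'.aemeasurable]
        congr 1
        exact lintegral_indicator_one hS

theorem lintegral_exp_neg_sum_sq {n : ℕ} {κ : Fin n → ℝ} (hκ : ∀ l, 0 < κ l) :
    ∫⁻ z : Fin n → ℂ, ENNReal.ofReal (Real.exp (-∑ l, κ l * ‖z l‖ ^ 2)) =
      ENNReal.ofReal (∏ l, Real.pi / κ l) := by
  have h1 : ∀ z : Fin n → ℂ, Real.exp (-∑ l, κ l * ‖z l‖ ^ 2) =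
      ∏ l, Real.exp (-κ l * ‖z l‖ ^ 2) := by
    intro z
    rw [← Real.exp_sum, ← Finset.sum_neg_distrib]
    simp
  have hone : ∀ l, ∫ z : ℂ, Real.exp (-κ l * ‖z‖ ^ 2) = Real.pi / κ l := by
    intro l
    rw [GaussianFourier.integral_rexp_neg_mul_sq_norm (hκ l), Complex.finrank_real_complex]
    norm_num
  have hint : ∀ l, Integrable fun z : ℂ => Real.exp (-κ l * ‖z‖ ^ 2) := by
    intro l
    -- A non-integrable function has integral 0 by convention, so the nonzero value already implies
    -- integrability.
    refine MeasureTheory.Integrable.of_integral_ne_zero ?_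
    rw [hone]
    exact (div_pos Real.pi_pos (hκ l)).ne'
  simp_rw [h1]
  rw [← ofReal_integral_eq_lintegral_ofReal]
  · rw [integral_fintype_prod_volume_eq_prod (fun l (z : ℂ) => Real.exp (-κ l * ‖z‖ ^ 2))]
    simp_rw [hone]
  · exact Integrable.fintype_prod hint
  · exact Filter.Eventually.of_forall fun z => Finset.prod_nonneg fun l _ => (Real.exp_pos _).le

/-- A bound on the moment generating factor of |z|² for a complex Gaussian: -log(1-v) ≤ v + v² near
0. -/
theorem inv_one_sub_le_exp {v : ℝ} (hv : |v| ≤ 1 / 4) : 1 / (1 - v) ≤ Real.exp (v + v ^ 2) := by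
  obtain ⟨h1, h2⟩ := abs_le.mp hv
  rw [div_le_iff₀ (by linarith)]
  rcases le_or_gt 0 v with h0 | h0
  · have h3 := Real.quadratic_le_exp_of_nonneg (x := v + v ^ 2) (by positivity)
    have h4 : 1 ≤ (1 + (v + v ^ 2) + (v + v ^ 2) ^ 2 / 2) * (1 - v) := by
      have : (1 + (v + v ^ 2) + (v + v ^ 2) ^ 2 / 2) * (1 - v) - 1 =
          v ^ 2 * ((1 - v) * (1 + v) ^ 2 / 2 - v) := by ring
      have h5 : 0 ≤ (1 - v) * (1 + v) ^ 2 / 2 - v := by nlinarith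
      nlinarith [mul_nonneg (sq_nonneg v) h5]
    exact h4.trans (mul_le_mul_of_nonneg_right h3 (by linarith))
  · have h3 := Real.add_one_le_exp (v + v ^ 2)
    have h4 : 1 ≤ (v + v ^ 2 + 1) * (1 - v) := by
      have : (v + v ^ 2 + 1) * (1 - v) = 1 + v ^ 2 * (-v) := by ring
      rw [this]
      nlinarith [mul_nonneg (sq_nonneg v) (by linarith : 0 ≤ -v)]
    exact h4.trans (mul_le_mul_of_nonneg_right h3 (by linarith))

variable {n : ℕ}

theorem sum_norm_inner_sq (u : OrthonormalBasis (Fin n) ℂ (EuclideanSpace ℂ (Fin n)))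
    (z : EuclideanSpace ℂ (Fin n)) : ∑ l, ‖inner ℂ (u l) z‖ ^ 2 = ‖z‖ ^ 2 :=
  u.sum_sq_norm_inner_right z

/-- Up to a constant, the Lebesgue measure in the coordinates of an orthonormal basis is the
product measure. -/
theorem exists_lintegral_inner_eq (u : OrthonormalBasis (Fin n) ℂ (EuclideanSpace ℂ (Fin n))) :
    ∃ c : ℝ≥0∞, c ≠ 0 ∧ c ≠ ∞ ∧ ∀ g : (Fin n → ℂ) → ℝ≥0∞, Measurable g →
      ∫⁻ z : EuclideanSpace ℂ (Fin n), g (fun l => inner ℂ (u l) z) = c * ∫⁻ z, g z := by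
  let e : EuclideanSpace ℂ (Fin n) ≃L[ℝ] (Fin n → ℂ) :=
    ((u.repr.toLinearEquiv.trans (WithLp.linearEquiv 2 ℂ (Fin n → ℂ))).restrictScalars
      ℝ).toContinuousLinearEquiv
  have he : ∀ z, e z = fun l => inner ℂ (u l) z := by
    intro z
    ext l
    simp [e, u.repr_apply_apply]
  have hhaar : (Measure.map e (volume : Measure (EuclideanSpace ℂ (Fin n)))).IsAddHaarMeasure :=
    -- Uniqueness of Haar measure suffices: the factor cancels in ratios, so volume preservation of
    -- the coordinate map is not needed.
    e.isAddHaarMeasure_map _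
  have hs := Measure.isAddLeftInvariant_eq_smul
    (Measure.map e (volume : Measure (EuclideanSpace ℂ (Fin n)))) (volume : Measure (Fin n → ℂ))
  set c := (Measure.map e (volume : Measure (EuclideanSpace ℂ (Fin n)))).addHaarScalarFactor
    (volume : Measure (Fin n → ℂ)) with hc
  refine ⟨c, ?_, ENNReal.coe_ne_top, fun g hg => ?_⟩
  · simpa using (Measure.addHaarScalarFactor_pos_of_isAddHaarMeasure _ _).ne'
  · have h := lintegral_map hg e.continuous.measurable
      (μ := (volume : Measure (EuclideanSpace ℂ (Fin n))))
    rw [hs, lintegral_smul_measure] at h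
    simp_rw [he] at h
    rw [← h]
    rfl

/-- The event is the trace on the sphere of the cone where a quadratic form is positive, so its
probability is the Gaussian probability of that cone. There the coordinates are independent and the
exponential Markov inequality gives a product of one-dimensional factors. -/
theorem unifSphere_tail (hn : 1 ≤ n) (u : OrthonormalBasis (Fin n) ℂ (EuclideanSpace ℂ (Fin n)))
    {a : Fin n → ℝ} (ha : ∀ l, |a l| ≤ 1) {t : ℝ} (ht : 0 < t) :
    unifSphere n {b | t < ∑ l, (‖inner ℂ (u l) b.1‖ ^ 2 - 1 / n) * a l} ≤
      ENNReal.ofReal (Real.exp (-(n * t ^ 2 / 64))) := by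
  have hn' : (0 : ℝ) < n := by exact_mod_cast hn
  have : Nonempty (Fin n) := ⟨⟨0, hn⟩⟩
  have hb1 : ∀ b : Metric.sphere (0 : EuclideanSpace ℂ (Fin n)) 1,
      ∑ l, ‖inner ℂ (u l) b.1‖ ^ 2 = 1 := by
    intro b
    have : ‖b.1‖ = 1 := by simp
    rw [sum_norm_inner_sq, this, one_pow]
  -- For t > 2 the event is empty, since the two total masses are 1 and |a_l| ≤ 1. The bound t ≤ 2
  -- then keeps |d_l| ≤ 4.
  rcases le_or_gt t 2 with ht2 | ht2
  swap
  · have : {b : Metric.sphere (0 : EuclideanSpace ℂ (Fin n)) 1 |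
        t < ∑ l, (‖inner ℂ (u l) b.1‖ ^ 2 - 1 / n) * a l} = ∅ := by
      refine Set.eq_empty_of_forall_notMem fun b hb => ?_
      have h1 : ∑ l, (‖inner ℂ (u l) b.1‖ ^ 2 - 1 / n) * a l ≤
          ∑ l, (‖inner ℂ (u l) b.1‖ ^ 2 + 1 / (n : ℝ)) := by
        refine Finset.sum_le_sum fun l _ => ?_
        obtain ⟨h1, h2⟩ := abs_le.mp (ha l)
        have h3 : 0 ≤ ‖inner ℂ (u l) b.1‖ ^ 2 := by positivity
        have h4 : 0 ≤ 1 / (n : ℝ) := by positivity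
        nlinarith
      rw [Finset.sum_add_distrib, hb1] at h1
      simp only [Finset.sum_const, Finset.card_univ, Fintype.card_fin, nsmul_eq_mul] at h1
      have h5 : (n : ℝ) * (1 / n) = 1 := by field_simp
      have h6 : t < ∑ l, (‖inner ℂ (u l) b.1‖ ^ 2 - 1 / n) * a l := hb
      linarith
    rw [this]
    simp
  set abar : ℝ := (∑ l, a l) / n with habar
  have habar1 : |abar| ≤ 1 := by
    rw [habar, abs_div, abs_of_pos hn', div_le_one hn']
    calc _ ≤ ∑ l, |a l| := Finset.abs_sum_le_sum_abs _ _
      _ ≤ ∑ _l : Fin n, (1 : ℝ) := Finset.sum_le_sum fun l _ => ha l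
      _ = n := by simp
  -- On the sphere the constants can be multiplied by Σ|⟨u_l,b⟩|² = 1; absorbing the mean of a and
  -- the threshold t into the coefficients makes the condition homogeneous.
  set d : Fin n → ℝ := fun l => a l - abar - t with hd
  have hd4 : ∀ l, |d l| ≤ 4 := by
    intro l
    obtain ⟨h1, h2⟩ := abs_le.mp (ha l)
    obtain ⟨h3, h4⟩ := abs_le.mp habar1
    rw [abs_le]
    constructor <;> simp only [hd] <;> linarith
  have hdsum : ∑ l, d l = -(n * t) := by
    simp only [hd, Finset.sum_sub_distrib, Finset.sum_const, Finset.card_univ, Fintype.card_fin,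
      nsmul_eq_mul]
    have : (n : ℝ) * abar = ∑ l, a l := by rw [habar]; field_simp
    linarith
  set Q : EuclideanSpace ℂ (Fin n) → ℝ := fun z => ∑ l, ‖inner ℂ (u l) z‖ ^ 2 * d l with hQ
  have hQc : Continuous Q := by
    simp only [hQ]
    fun_prop
  set K : Set (EuclideanSpace ℂ (Fin n)) := {z | 0 < Q z} with hKdef
  have hKm : MeasurableSet K := measurableSet_lt measurable_const hQc.measurable
  have hcone : ∀ (r : ℝ) (z : EuclideanSpace ℂ (Fin n)), 0 < r → (r • z ∈ K ↔ z ∈ K) := by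
    intro r z hr
    have : Q (r • z) = r ^ 2 * Q z := by
      simp only [hQ, Finset.mul_sum]
      refine Finset.sum_congr rfl fun l _ => ?_
      have h1 : r • z = (r : ℂ) • z := rfl
      rw [h1, inner_smul_right, norm_mul, mul_pow, Complex.norm_real, Real.norm_eq_abs, sq_abs]
      ring
    simp only [hKdef, Set.mem_ofPred_eq, this]
    exact mul_pos_iff_of_pos_left (by positivity)
  have hset : {b : Metric.sphere (0 : EuclideanSpace ℂ (Fin n)) 1 |
      t < ∑ l, (‖inner ℂ (u l) b.1‖ ^ 2 - 1 / n) * a l} =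
      {b : Metric.sphere (0 : EuclideanSpace ℂ (Fin n)) 1 | b.1 ∈ K} := by
    ext b
    have h1 : Q b.1 = (∑ l, (‖inner ℂ (u l) b.1‖ ^ 2 - 1 / n) * a l) - t := by
      simp only [hQ, hd, mul_sub, sub_mul, Finset.sum_sub_distrib, ← Finset.sum_mul, hb1,
        ← Finset.mul_sum]
      rw [habar]
      ring
    simp only [Set.mem_ofPred_eq, hKdef, h1, sub_pos]
  set g : ℝ → ℝ≥0∞ := fun r => ENNReal.ofReal (Real.exp (-r ^ 2)) with hg
  have hgm : Measurable g := by fun_prop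
  have hc1 := setLIntegral_cone_eq (volume : Measure (EuclideanSpace ℂ (Fin n))) hgm hKm hcone
  have hc2 := setLIntegral_cone_eq (volume : Measure (EuclideanSpace ℂ (Fin n))) hgm
    MeasurableSet.univ (by simp)
  obtain ⟨c, hc0, hctop, hc⟩ := exists_lintegral_inner_eq u
  -- With |d_l| ≤ 4 this keeps θ|d_l| ≤ 1/4, and it minimizes the exponent -θnt + 16nθ², whose value
  -- is then -nt²/64.
  set θ := t / 32 with hθ
  have hv : ∀ l, |θ * d l| ≤ 1 / 4 := by
    intro l
    rw [abs_mul, abs_of_pos (by positivity : 0 < θ)]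
    nlinarith [hd4 l, abs_nonneg (d l)]
  have hκ : ∀ l, 0 < 1 - θ * d l := fun l => by
    have := (abs_le.mp (hv l)).2
    linarith
  -- exponential Markov inequality
  have hmarkov : ∫⁻ z in K, g ‖z‖ ≤ c * ENNReal.ofReal (∏ l, Real.pi / (1 - θ * d l)) := by
    calc ∫⁻ z in K, g ‖z‖ ≤ ∫⁻ z in K, ENNReal.ofReal (Real.exp
          (-∑ l, (1 - θ * d l) * ‖inner ℂ (u l) z‖ ^ 2)) := by
          refine setLIntegral_mono' hKm fun z hz => ?_
          refine ENNReal.ofReal_le_ofReal (Real.exp_le_exp.mpr ?_)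
          have h1 : ∑ l, (1 - θ * d l) * ‖inner ℂ (u l) z‖ ^ 2 = ‖z‖ ^ 2 - θ * Q z := by
            simp only [sub_mul, one_mul, Finset.sum_sub_distrib, sum_norm_inner_sq, hQ,
              Finset.mul_sum]
            congr 1
            exact Finset.sum_congr rfl fun l _ => by ring
          have h2 : 0 ≤ θ * Q z := mul_nonneg (by positivity) (le_of_lt hz)
          linarith
      _ ≤ ∫⁻ z, ENNReal.ofReal (Real.exp (-∑ l, (1 - θ * d l) * ‖inner ℂ (u l) z‖ ^ 2)) :=
          setLIntegral_le_lintegral _ _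
      _ = _ := by
          rw [hc (fun z => ENNReal.ofReal (Real.exp (-∑ l, (1 - θ * d l) * ‖z l‖ ^ 2)))
            (by fun_prop), lintegral_exp_neg_sum_sq hκ]
  have htotal : ∫⁻ z : EuclideanSpace ℂ (Fin n), g ‖z‖ = c * ENNReal.ofReal (∏ _l : Fin n, Real.pi) := by
    have h1 := hc (fun z => ENNReal.ofReal (Real.exp (-∑ l, (1 : ℝ) * ‖z l‖ ^ 2))) (by fun_prop)
    rw [lintegral_exp_neg_sum_sq (fun _ => one_pos)] at h1
    simp only [one_mul, sum_norm_inner_sq, div_one] at h1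
    exact h1
  rw [setLIntegral_univ] at hc2
  set I := ∫⁻ r : Set.Ioi (0 : ℝ), g (r : ℝ)
    ∂Measure.volumeIoiPow (Module.finrank ℝ (EuclideanSpace ℂ (Fin n)) - 1) with hI
  set τ := (volume : Measure (EuclideanSpace ℂ (Fin n))).toSphere with hτ
  have huniv : {b : Metric.sphere (0 : EuclideanSpace ℂ (Fin n)) 1 |
      (b : EuclideanSpace ℂ (Fin n)) ∈ (Set.univ : Set (EuclideanSpace ℂ (Fin n)))} = Set.univ := by
    simp
  rw [huniv] at hc2
  have hprob := isProbabilityMeasure_unifSphere hn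
  have hU : ∀ S, unifSphere n S * (τ Set.univ * I) = τ S * I := by
    intro S
    have h1 : τ Set.univ ≠ 0 := by
      intro h0
      have := hprob.measure_univ
      rw [unifSphere, Measure.smul_apply, ← hτ, h0] at this
      simp at this
    rw [unifSphere, Measure.smul_apply, ← hτ, smul_eq_mul]
    calc _ = ((τ Set.univ)⁻¹ * τ Set.univ) * (τ S * I) := by ring
      _ = _ := by rw [ENNReal.inv_mul_cancel h1 (measure_ne_top _ _), one_mul]
  -- The comparison is made after multiplication by the total Gaussian integral; the radial factor I
  -- therefore never has to be evaluated.
  have hle : unifSphere n {b | (b : EuclideanSpace ℂ (Fin n)) ∈ K} *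
      (c * ENNReal.ofReal (∏ _l : Fin n, Real.pi)) ≤
      ENNReal.ofReal (Real.exp (-(n * t ^ 2 / 64))) *
        (c * ENNReal.ofReal (∏ _l : Fin n, Real.pi)) := by
    rw [← htotal, hc2, hU, ← hc1, ← hc2, htotal, mul_left_comm,
      ← ENNReal.ofReal_mul (Real.exp_pos _).le]
    refine hmarkov.trans ?_
    gcongr
    have h1 : ∏ l, Real.pi / (1 - θ * d l) =
        (∏ l, 1 / (1 - θ * d l)) * ∏ _l : Fin n, Real.pi := by
      rw [← Finset.prod_mul_distrib]
      exact Finset.prod_congr rfl fun l _ => by ring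
    rw [h1]
    refine mul_le_mul_of_nonneg_right ?_ (Finset.prod_nonneg fun _ _ => Real.pi_pos.le)
    calc ∏ l, 1 / (1 - θ * d l) ≤ ∏ l, Real.exp (θ * d l + (θ * d l) ^ 2) :=
          Finset.prod_le_prod (fun l _ => (one_div_pos.mpr (hκ l)).le)
            fun l _ => inv_one_sub_le_exp (hv l)
      _ = Real.exp (θ * ∑ l, d l + ∑ l, (θ * d l) ^ 2) := by
          rw [← Real.exp_sum, Finset.sum_add_distrib, Finset.mul_sum]
      _ ≤ _ := by
          refine Real.exp_le_exp.mpr ?_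
          have h2 : ∑ l, (θ * d l) ^ 2 ≤ ∑ _l : Fin n, θ ^ 2 * 16 := by
            refine Finset.sum_le_sum fun l _ => ?_
            rw [mul_pow]
            refine mul_le_mul_of_nonneg_left ?_ (sq_nonneg θ)
            have := hd4 l
            rw [← sq_abs]
            nlinarith [abs_nonneg (d l)]
          rw [Finset.sum_const, Finset.card_univ, Fintype.card_fin, nsmul_eq_mul] at h2
          rw [hdsum]
          rw [hθ] at h2 ⊢
          have : t / 32 * -(n * t) + n * ((t / 32) ^ 2 * 16) = -(n * t ^ 2 / 64) := by ring
          linarith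
  rw [hset]
  refine (ENNReal.mul_le_mul_iff_left ?_ ?_).mp hle
  · refine mul_ne_zero hc0 ?_
    have : 0 < ∏ _l : Fin n, Real.pi := Finset.prod_pos fun _ _ => Real.pi_pos
    simpa using this
  · exact ENNReal.mul_ne_top hctop ENNReal.ofReal_ne_top

end SpecDens

namespace SpecDens

/-! ## Chebyshev coefficients of Lipschitz functions on the Gauss-Chebyshev grid -/

/-- Bessel's inequality for an orthogonal family of common squared norm N, read off from the squared
length of N·d minus its projection sum. -/
theorem sum_sq_le_of_orthogonal {ι J : Type*} [DecidableEq J] (S : Finset ι) (t : Finset J)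
    (e : J → ι → ℝ) (d : ι → ℝ) {N : ℝ} (hN : 0 < N)
    (he : ∀ j ∈ t, ∀ j' ∈ t, ∑ i ∈ S, e j i * e j' i = if j = j' then N else 0) :
    ∑ j ∈ t, (∑ i ∈ S, d i * e j i) ^ 2 ≤ N * ∑ i ∈ S, d i ^ 2 := by
  set a : J → ℝ := fun j => ∑ i ∈ S, d i * e j i with ha
  have h0 : 0 ≤ ∑ i ∈ S, (N * d i - ∑ j ∈ t, a j * e j i) ^ 2 :=
    Finset.sum_nonneg fun i _ => sq_nonneg _
  have h1 : ∑ i ∈ S, (d i * ∑ j ∈ t, a j * e j i) = ∑ j ∈ t, a j ^ 2 := by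
    simp_rw [Finset.mul_sum]
    rw [Finset.sum_comm]
    refine Finset.sum_congr rfl fun j _ => ?_
    rw [sq]
    conv_rhs => rw [ha]
    simp only
    rw [Finset.mul_sum]
    exact Finset.sum_congr rfl fun i _ => by ring
  have h2 : ∑ i ∈ S, (∑ j ∈ t, a j * e j i) ^ 2 = N * ∑ j ∈ t, a j ^ 2 := by
    simp_rw [sq, Finset.sum_mul_sum]
    rw [Finset.sum_comm, Finset.mul_sum]
    refine Finset.sum_congr rfl fun j hj => ?_
    rw [Finset.sum_comm]
    have : ∀ j' ∈ t, ∑ i ∈ S, a j * e j i * (a j' * e j' i) =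
        if j = j' then a j * a j' * N else 0 := by
      intro j' hj'
      have h3 : ∑ i ∈ S, a j * e j i * (a j' * e j' i) = a j * a j' * ∑ i ∈ S, e j i * e j' i := by
        rw [Finset.mul_sum]
        exact Finset.sum_congr rfl fun i _ => by ring
      rw [h3, he j hj j' hj']
      split_ifs <;> simp
    rw [Finset.sum_congr rfl this, Finset.sum_ite_eq, if_pos hj]
    ring
  have h3 : ∑ i ∈ S, (N * d i - ∑ j ∈ t, a j * e j i) ^ 2 =
      N ^ 2 * (∑ i ∈ S, d i ^ 2) - 2 * N * (∑ i ∈ S, (d i * ∑ j ∈ t, a j * e j i)) +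
        ∑ i ∈ S, (∑ j ∈ t, a j * e j i) ^ 2 := by
    rw [Finset.mul_sum, Finset.mul_sum, ← Finset.sum_sub_distrib, ← Finset.sum_add_distrib]
    exact Finset.sum_congr rfl fun i _ => by ring
  rw [h3, h1, h2] at h0
  have h4 : N * ∑ j ∈ t, a j ^ 2 ≤ N * (N * ∑ i ∈ S, d i ^ 2) := by nlinarith
  exact le_of_mul_le_mul_left h4 hN

/-- Multiplication by 2 sin(pπ/2M) makes the sum telescope; p < 2M keeps this factor positive. Only
the parity of p remains. -/
theorem sum_cos_mul_pi_div {M p : ℕ} (hp : 0 < p) (hpM : p < 2 * M) :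
    ∑ i ∈ Finset.range M, Real.cos (p * (i * (Real.pi / M))) = (1 - (-1) ^ p) / 2 := by
  have hM : (0 : ℝ) < M := by
    have : 0 < M := by omega
    exact_mod_cast this
  have hπ := Real.pi_pos
  have hp' : (0 : ℝ) < p := by exact_mod_cast hp
  have hpM' : (p : ℝ) < 2 * M := by exact_mod_cast hpM
  set x := p * Real.pi / (2 * M) with hx
  have htel : ∀ K : ℕ, 2 * Real.sin x * ∑ i ∈ Finset.range K, Real.cos (p * (i * (Real.pi / M))) =
      Real.sin ((2 * K - 1) * x) + Real.sin x := by
    intro K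
    induction K with
    | zero => simp
    | succ K ih =>
      rw [Finset.sum_range_succ, mul_add, ih]
      have h1 : (p : ℝ) * (K * (Real.pi / M)) = 2 * K * x := by rw [hx]; field_simp
      have h2 : (2 * ((K + 1 : ℕ) : ℝ) - 1) * x = 2 * K * x + x := by push_cast; ring
      have h3 : (2 * (K : ℝ) - 1) * x = 2 * K * x - x := by ring
      rw [h1, h2, h3, Real.sin_add, Real.sin_sub]
      ring
  have h := htel M
  have hMx : (2 * (M : ℝ) - 1) * x = p * Real.pi - x := by
    have : 2 * (M : ℝ) * x = p * Real.pi := by rw [hx]; field_simp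
    linarith
  rw [hMx, Real.sin_nat_mul_pi_sub] at h
  have hs : 0 < Real.sin x := by
    refine Real.sin_pos_of_pos_of_lt_pi (by positivity) ?_
    rw [hx, div_lt_iff₀ (by positivity)]
    nlinarith
  have h2 : Real.sin x * (2 * ∑ i ∈ Finset.range M, Real.cos (p * (i * (Real.pi / M)))) =
      Real.sin x * (1 - (-1) ^ p) := by linarith
  have h3 := mul_left_cancel₀ hs.ne' h2
  linarith

theorem sum_sin_mul_sin {m j j' : ℕ} (hj : j ∈ Finset.Icc 1 m) (hj' : j' ∈ Finset.Icc 1 m) :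
    ∑ i ∈ Finset.range m, Real.sin (j * (((i + 1 : ℕ) : ℝ) * (Real.pi / (m + 1 : ℕ)))) *
      Real.sin (j' * (((i + 1 : ℕ) : ℝ) * (Real.pi / (m + 1 : ℕ)))) =
      if j = j' then ((m : ℝ) + 1) / 2 else 0 := by
  rw [Finset.mem_Icc] at hj hj'
  have hshift : ∑ i ∈ Finset.range m,
        Real.sin (j * (((i + 1 : ℕ) : ℝ) * (Real.pi / (m + 1 : ℕ)))) *
        Real.sin (j' * (((i + 1 : ℕ) : ℝ) * (Real.pi / (m + 1 : ℕ)))) =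
      ∑ i ∈ Finset.range (m + 1), Real.sin (j * ((i : ℝ) * (Real.pi / (m + 1 : ℕ)))) *
        Real.sin (j' * ((i : ℝ) * (Real.pi / (m + 1 : ℕ)))) := by
    rw [Finset.sum_range_succ']
    simp
  rw [hshift]
  wlog hle : j' ≤ j generalizing j j'
  · have := this hj' hj (by rw [Finset.sum_range_succ']; simp) (by omega)
    simp_rw [mul_comm (Real.sin ((j : ℝ) * _))]
    rw [this]
    simp only [eq_comm]
  -- The frequencies j - j' and j + j' have the same parity, so for j ≠ j' their cosine sums cancel.
  have hterm : ∀ φ : ℝ, Real.sin (j * φ) * Real.sin (j' * φ) =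
      (Real.cos ((j - j' : ℕ) * φ) - Real.cos ((j + j' : ℕ) * φ)) / 2 := by
    intro φ
    rw [Nat.cast_sub hle, Nat.cast_add, sub_mul, add_mul, Real.cos_sub, Real.cos_add]
    ring
  simp_rw [hterm]
  rw [← Finset.sum_div, Finset.sum_sub_distrib, sum_cos_mul_pi_div (p := j + j') (by omega) (by omega)]
  split_ifs with h
  · subst h
    simp [Even.neg_one_pow ⟨j, rfl⟩]
  · rw [sum_cos_mul_pi_div (p := j - j') (by omega) (by omega)]
    have : j + j' = (j - j') + 2 * j' := by omega
    rw [this, pow_add, pow_mul]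
    simp

theorem sum_chebT_mul_chebT {m j k : ℕ} (hj : j ≤ m) (hk : k ≤ m) :
    ∑ i ∈ Finset.range (m + 1), chebT j (gaussNode m i) * chebT k (gaussNode m i) =
      if j = k then ((m : ℝ) + 1) / Real.pi else 0 := by
  have h := (isChebQuad_gaussRule m).integral_chebT_mul_chebT (j := j) (k := k) (by omega)
  rw [integral_gaussRule] at h
  have hπ := Real.pi_pos
  have h2 : ∑ i ∈ Finset.range (m + 1), chebT j (gaussNode m i) * chebT k (gaussNode m i) =
      (if j = k then 1 else 0) * (((m : ℝ) + 1) / Real.pi) := by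
    rw [← h]
    field_simp
  rw [h2]
  split_ifs <;> simp

theorem sum_mul_sub_by_parts (g S : ℕ → ℝ) (m : ℕ) :
    ∑ i ∈ Finset.range (m + 1), g i * (S (i + 1) - S i) =
      g m * S (m + 1) - g 0 * S 0 - ∑ i ∈ Finset.range m, (g (i + 1) - g i) * S (i + 1) := by
  induction m with
  | zero => simp; ring
  | succ m ih =>
    rw [Finset.sum_range_succ, ih, Finset.sum_range_succ (fun i => (g (i + 1) - g i) * S (i + 1))]
    ring

/-- The discrete Chebyshev coefficients of a function on the Gauss-Chebyshev grid. -/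
noncomputable def gridCoeff (m : ℕ) (g : ℕ → ℕ → ℝ) (j k : ℕ) : ℝ :=
  (Real.pi / (m + 1)) ^ 2 * ∑ i ∈ Finset.range (m + 1), ∑ l ∈ Finset.range (m + 1),
    g i l * (chebT j (gaussNode m i) * chebT k (gaussNode m l))

theorem gridCoeff_swap (m : ℕ) (g : ℕ → ℕ → ℝ) (j k : ℕ) :
    gridCoeff m (fun i l => g l i) k j = gridCoeff m g j k := by
  rw [gridCoeff, gridCoeff, Finset.sum_comm]
  congr 1
  exact Finset.sum_congr rfl fun i _ => Finset.sum_congr rfl fun l _ => by ring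

/-- The Gauss angles are the midpoints of the grid iπ/(m+1), so 2 sin(h) cos(jα_i) is a difference
of values of sin(j·) on that grid. Summation by parts moves the difference to g; the sines vanish at
0 and π, so no boundary terms survive. This is the discrete form of differentiating a cosine series
into a sine series. -/
theorem mul_gridCoeff_eq (m : ℕ) (g : ℕ → ℕ → ℝ) {j : ℕ} (hj : 1 ≤ j) (k : ℕ) :
    2 * Real.sin (j * (Real.pi / (2 * (m + 1)))) * gridCoeff m g j k =
      -((Real.pi / (m + 1)) ^ 2 * √(2 / Real.pi) *
        ∑ q ∈ Finset.range m ×ˢ Finset.range (m + 1), (g (q.1 + 1) q.2 - g q.1 q.2) *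
          (Real.sin (j * (((q.1 + 1 : ℕ) : ℝ) * (Real.pi / (m + 1 : ℕ)))) *
            chebT k (gaussNode m q.2))) := by
  set h := j * (Real.pi / (2 * ((m : ℝ) + 1))) with hh
  set S : ℕ → ℝ := fun i => Real.sin (j * ((i : ℝ) * (Real.pi / (m + 1 : ℕ)))) with hS
  have hm : ((m : ℝ) + 1) ≠ 0 := by positivity
  have hS0 : S 0 = 0 := by simp [hS]
  have hSM : S (m + 1) = 0 := by
    simp only [hS]
    rw [show (j : ℝ) * (((m + 1 : ℕ) : ℝ) * (Real.pi / (m + 1 : ℕ))) = j * Real.pi by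
      push_cast; field_simp]
    exact Real.sin_nat_mul_pi j
  have hcheb : ∀ i, 2 * Real.sin h * chebT j (gaussNode m i) =
      √(2 / Real.pi) * (S (i + 1) - S i) := by
    intro i
    rw [gaussNode, chebT_cos, if_neg (by omega)]
    have h1 : (j : ℝ) * (((i + 1 : ℕ) : ℝ) * (Real.pi / (m + 1 : ℕ))) = j * gaussAngle m i + h := by
      rw [hh, gaussAngle]; push_cast; field_simp; ring
    have h2 : (j : ℝ) * ((i : ℝ) * (Real.pi / (m + 1 : ℕ))) = j * gaussAngle m i - h := by
      rw [hh, gaussAngle]; push_cast; field_simp; ring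
    simp only [hS]
    rw [h1, h2, Real.sin_add, Real.sin_sub]
    ring
  have hcol : ∀ l, ∑ i ∈ Finset.range (m + 1), g i l * (S (i + 1) - S i) =
      -∑ i ∈ Finset.range m, (g (i + 1) l - g i l) * S (i + 1) := by
    intro l
    rw [sum_mul_sub_by_parts (fun i => g i l), hS0, hSM]
    ring
  calc _ = (Real.pi / (m + 1)) ^ 2 * √(2 / Real.pi) * ∑ l ∈ Finset.range (m + 1),
        (∑ i ∈ Finset.range (m + 1), g i l * (S (i + 1) - S i)) * chebT k (gaussNode m l) := by
        rw [gridCoeff, Finset.sum_comm]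
        simp only [Finset.mul_sum, Finset.sum_mul]
        refine Finset.sum_congr rfl fun l _ => Finset.sum_congr rfl fun i _ => ?_
        linear_combination ((Real.pi / (m + 1)) ^ 2 * g i l * chebT k (gaussNode m l)) * hcheb i
    _ = _ := by
        simp_rw [hcol]
        rw [Finset.sum_product_right]
        rw [← mul_neg, ← Finset.sum_neg_distrib]
        congr 1
        refine Finset.sum_congr rfl fun l _ => ?_
        rw [neg_mul, Finset.sum_mul]
        congr 1
        exact Finset.sum_congr rfl fun i _ => by simp only [hS]; ring

theorem sum_sin_chebT_orthogonal {m : ℕ} :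
    ∀ p ∈ Finset.Icc 1 m ×ˢ Finset.range (m + 1), ∀ p' ∈ Finset.Icc 1 m ×ˢ Finset.range (m + 1),
      ∑ q ∈ Finset.range m ×ˢ Finset.range (m + 1),
        (Real.sin (p.1 * (((q.1 + 1 : ℕ) : ℝ) * (Real.pi / (m + 1 : ℕ)))) *
            chebT p.2 (gaussNode m q.2)) *
          (Real.sin (p'.1 * (((q.1 + 1 : ℕ) : ℝ) * (Real.pi / (m + 1 : ℕ)))) *
            chebT p'.2 (gaussNode m q.2)) =
        if p = p' then ((m : ℝ) + 1) / 2 * ((m + 1) / Real.pi) else 0 := by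
  rintro ⟨j, k⟩ hp ⟨j', k'⟩ hp'
  rw [Finset.mem_product] at hp hp'
  have h1 := sum_sin_mul_sin hp.1 hp'.1
  have h2 := sum_chebT_mul_chebT (Nat.lt_succ_iff.mp (Finset.mem_range.mp hp.2))
    (Nat.lt_succ_iff.mp (Finset.mem_range.mp hp'.2))
  rw [Finset.sum_product]
  calc _ = (∑ i ∈ Finset.range m, Real.sin (j * (((i + 1 : ℕ) : ℝ) * (Real.pi / (m + 1 : ℕ)))) *
        Real.sin (j' * (((i + 1 : ℕ) : ℝ) * (Real.pi / (m + 1 : ℕ))))) *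
        ∑ i ∈ Finset.range (m + 1), chebT k (gaussNode m i) * chebT k' (gaussNode m i) := by
        rw [Finset.sum_mul_sum]
        exact Finset.sum_congr rfl fun i _ => Finset.sum_congr rfl fun l _ => by ring
    _ = _ := by
        rw [h1, h2]
        by_cases hj : j = j' <;> by_cases hk : k = k' <;> simp [hj, hk]

/-- Bessel's inequality for the differences of g, whose sine-Chebyshev coefficients are
sin(jπ/(2(m+1))) times those of g up to a factor. Steps of size sπ/(m+1) are what a function of
Lipschitz constant s produces on the nodes. -/
theorem sum_sq_mul_gridCoeff_le (m : ℕ) (g : ℕ → ℕ → ℝ) {s : ℝ}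
    (hg : ∀ i l, |g (i + 1) l - g i l| ≤ s * (Real.pi / (m + 1))) :
    ∑ j ∈ Finset.range (m + 1), ∑ k ∈ Finset.range (m + 1), (j : ℝ) ^ 2 * gridCoeff m g j k ^ 2 ≤
      Real.pi ^ 4 * s ^ 2 / 4 := by
  have hπ := Real.pi_pos
  have hm : (0 : ℝ) < (m : ℝ) + 1 := by positivity
  set a : ℕ × ℕ → ℝ := fun p => ∑ q ∈ Finset.range m ×ˢ Finset.range (m + 1),
    (g (q.1 + 1) q.2 - g q.1 q.2) *
      (Real.sin (p.1 * (((q.1 + 1 : ℕ) : ℝ) * (Real.pi / (m + 1 : ℕ)))) *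
        chebT p.2 (gaussNode m q.2)) with ha
  have hbessel : ∑ p ∈ Finset.Icc 1 m ×ˢ Finset.range (m + 1), a p ^ 2 ≤
      (((m : ℝ) + 1) / 2 * ((m + 1) / Real.pi)) *
        ∑ q ∈ Finset.range m ×ˢ Finset.range (m + 1), (g (q.1 + 1) q.2 - g q.1 q.2) ^ 2 := by
    exact sum_sq_le_of_orthogonal (Finset.range m ×ˢ Finset.range (m + 1))
      (Finset.Icc 1 m ×ˢ Finset.range (m + 1)) (fun p q =>
        Real.sin (p.1 * (((q.1 + 1 : ℕ) : ℝ) * (Real.pi / (m + 1 : ℕ)))) *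
          chebT p.2 (gaussNode m q.2)) (fun q => g (q.1 + 1) q.2 - g q.1 q.2)
      (by positivity) sum_sin_chebT_orthogonal
  have hd : ∑ q ∈ Finset.range m ×ˢ Finset.range (m + 1), (g (q.1 + 1) q.2 - g q.1 q.2) ^ 2 ≤
      s ^ 2 * Real.pi ^ 2 := by
    calc _ ≤ ∑ q ∈ Finset.range m ×ˢ Finset.range (m + 1), (s * (Real.pi / (m + 1))) ^ 2 := by
          refine Finset.sum_le_sum fun q _ => ?_
          rw [← sq_abs]
          exact pow_le_pow_left₀ (abs_nonneg _) (hg _ _) 2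
      _ = s ^ 2 * Real.pi ^ 2 * (m / (m + 1)) := by
          rw [Finset.sum_const, Finset.card_product, Finset.card_range, Finset.card_range,
            nsmul_eq_mul]
          push_cast
          field_simp
      _ ≤ _ := by
          refine mul_le_of_le_one_right (by positivity) ?_
          rw [div_le_one hm]
          linarith
  have hterm : ∀ p ∈ Finset.Icc 1 m ×ˢ Finset.range (m + 1),
      (p.1 : ℝ) ^ 2 * gridCoeff m g p.1 p.2 ^ 2 ≤ Real.pi ^ 3 / (2 * (m + 1) ^ 2) * a p ^ 2 := by
    rintro ⟨j, k⟩ hp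
    simp only [Finset.mem_product, Finset.mem_Icc] at hp
    have hjm : (j : ℝ) ≤ m := by exact_mod_cast hp.1.2
    have hj1 : (1 : ℝ) ≤ j := by exact_mod_cast hp.1.1
    have h1 := mul_gridCoeff_eq m g hp.1.1 k
    -- Jordan's inequality: the discrete derivative is comparable with multiplication by j for all j
    -- ≤ m.
    have hsin : (j : ℝ) / (m + 1) ≤ Real.sin (j * (Real.pi / (2 * (m + 1)))) := by
      refine le_trans (le_of_eq ?_) (Real.mul_le_sin (by positivity) ?_)
      · field_simp
      · rw [← mul_div_assoc, div_le_div_iff₀ (by positivity) (by positivity)]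
        nlinarith
    have h2 : (2 * Real.sin (j * (Real.pi / (2 * (m + 1)))) * gridCoeff m g j k) ^ 2 =
        (Real.pi / (m + 1)) ^ 4 * (2 / Real.pi) * a (j, k) ^ 2 := by
      rw [h1, neg_sq, mul_pow, mul_pow, Real.sq_sqrt (by positivity)]
      ring
    have h3 : (2 * (j / ((m : ℝ) + 1)) * gridCoeff m g j k) ^ 2 ≤
        (2 * Real.sin (j * (Real.pi / (2 * (m + 1)))) * gridCoeff m g j k) ^ 2 := by
      rw [mul_pow, mul_pow _ (gridCoeff m g j k)]
      gcongr
    rw [h2] at h3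
    have h4 : (j : ℝ) ^ 2 * gridCoeff m g j k ^ 2 =
        (m + 1) ^ 2 / 4 * (2 * (j / ((m : ℝ) + 1)) * gridCoeff m g j k) ^ 2 := by
      field_simp
      ring
    rw [h4]
    calc _ ≤ ((m : ℝ) + 1) ^ 2 / 4 * ((Real.pi / (m + 1)) ^ 4 * (2 / Real.pi) * a (j, k) ^ 2) := by
          gcongr
      _ = _ := by field_simp; ring
  calc _ = ∑ p ∈ Finset.Icc 1 m ×ˢ Finset.range (m + 1),
        (p.1 : ℝ) ^ 2 * gridCoeff m g p.1 p.2 ^ 2 := by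
        rw [Finset.sum_product, Finset.range_eq_Ico, Finset.sum_eq_sum_Ico_succ_bot (by omega)]
        simp only [Nat.cast_zero, ne_eq, OfNat.ofNat_ne_zero, not_false_eq_true, zero_pow, zero_mul,
          Finset.sum_const_zero, zero_add]
        rfl
    _ ≤ ∑ p ∈ Finset.Icc 1 m ×ˢ Finset.range (m + 1),
        Real.pi ^ 3 / (2 * (m + 1) ^ 2) * a p ^ 2 := Finset.sum_le_sum hterm
    _ ≤ Real.pi ^ 3 / (2 * (m + 1) ^ 2) * ((((m : ℝ) + 1) / 2 * ((m + 1) / Real.pi)) *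
        (s ^ 2 * Real.pi ^ 2)) := by
        rw [← Finset.mul_sum]
        gcongr
        exact hbessel.trans (by gcongr)
    _ = _ := by field_simp; ring

/-- Passing from m to M = m + 1 adds an L-shaped shell: two sides of M terms at most 1/M² each and
one corner, together at most 3/M. The term at the origin is 1/0 = 0. -/
theorem sum_inv_sq_add_sq_le (m : ℕ) :
    ∑ j ∈ Finset.range (m + 1), ∑ k ∈ Finset.range (m + 1), 1 / ((j : ℝ) ^ 2 + (k : ℝ) ^ 2) ≤
      3 * (1 + Real.log m) := by
  have key : ∑ j ∈ Finset.range (m + 1), ∑ k ∈ Finset.range (m + 1),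
      1 / ((j : ℝ) ^ 2 + (k : ℝ) ^ 2) ≤ 3 * (harmonic m : ℝ) := by
    induction m with
    | zero => simp
    | succ m ih =>
      rw [Finset.sum_range_succ]
      simp_rw [Finset.sum_range_succ _ (m + 1)]
      rw [Finset.sum_add_distrib, harmonic_succ]
      have hM : (0 : ℝ) < ((m + 1 : ℕ) : ℝ) := by positivity
      have hM1 : (1 : ℝ) ≤ ((m + 1 : ℕ) : ℝ) := by exact_mod_cast Nat.succ_pos m
      set M : ℝ := ((m + 1 : ℕ) : ℝ) with hMdef
      have h1 : ∑ j ∈ Finset.range (m + 1), 1 / ((j : ℝ) ^ 2 + M ^ 2) ≤ M * (1 / M ^ 2) := by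
        calc _ ≤ ∑ _j ∈ Finset.range (m + 1), 1 / M ^ 2 := by
              refine Finset.sum_le_sum fun j _ => ?_
              exact one_div_le_one_div_of_le (by positivity) (by nlinarith [sq_nonneg (j : ℝ)])
          _ = _ := by rw [Finset.sum_const, Finset.card_range, nsmul_eq_mul]
      have h2 : ∑ j ∈ Finset.range (m + 1), 1 / (M ^ 2 + (j : ℝ) ^ 2) ≤ M * (1 / M ^ 2) := by
        simp_rw [add_comm (M ^ 2)]
        exact h1
      have h3 : 1 / (M ^ 2 + M ^ 2) ≤ 1 / M := by
        refine one_div_le_one_div_of_le hM ?_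
        nlinarith
      have h4 : M * (1 / M ^ 2) = 1 / M := by field_simp
      rw [h4] at h1 h2
      push_cast
      rw [← one_div, show ((m : ℝ) + 1) = M by rw [hMdef]; push_cast; rfl]
      linarith
  have h := harmonic_le_one_add_log m
  linarith

/-- Pairing of the coefficients of a Lipschitz function with small numbers. -/
theorem abs_sum_mul_gridCoeff_le {m : ℕ} (g : ℕ → ℕ → ℝ) {s τ : ℝ} (hs : 0 ≤ s)
    (hg : ∀ i l, |g (i + 1) l - g i l| ≤ s * (Real.pi / (m + 1)))
    (hg' : ∀ i l, |g i (l + 1) - g i l| ≤ s * (Real.pi / (m + 1)))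
    {c : ℕ → ℕ → ℝ} (hc0 : c 0 0 = 0) (hc : ∀ j ≤ m, ∀ k ≤ m, |c j k| ≤ τ) :
    |∑ j ∈ Finset.range (m + 1), ∑ k ∈ Finset.range (m + 1), c j k * gridCoeff m g j k| ≤
      s * (τ * (13 * √(1 + Real.log m))) := by
  have hτ : 0 ≤ τ := (abs_nonneg _).trans (hc 0 (Nat.zero_le _) 0 (Nat.zero_le _))
  have hlog : 0 ≤ Real.log m := Real.log_natCast_nonneg m
  set R := Finset.range (m + 1) ×ˢ Finset.range (m + 1) with hR
  set ν : ℕ × ℕ → ℝ := fun p => √((p.1 : ℝ) ^ 2 + (p.2 : ℝ) ^ 2) with hν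
  have hνsq : ∀ p, ν p ^ 2 = (p.1 : ℝ) ^ 2 + (p.2 : ℝ) ^ 2 := fun p => Real.sq_sqrt (by positivity)
  have hle : |∑ j ∈ Finset.range (m + 1), ∑ k ∈ Finset.range (m + 1), c j k * gridCoeff m g j k| ≤
      τ * ∑ p ∈ R, (ν p * |gridCoeff m g p.1 p.2|) * (1 / ν p) := by
    rw [← Finset.sum_product', Finset.mul_sum]
    refine (Finset.abs_sum_le_sum_abs _ _).trans (Finset.sum_le_sum ?_)
    rintro ⟨j, k⟩ hp
    simp only [Finset.mem_product, Finset.mem_range] at hp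
    -- The weight vanishes only at the origin, where `hc0` kills the term, in agreement with 1/0 = 0
    -- on the right.
    by_cases h0 : ν (j, k) = 0
    · have h1 := hνsq (j, k)
      rw [h0] at h1
      have hj : j = 0 := by
        have : (j : ℝ) = 0 := by nlinarith [sq_nonneg (j : ℝ), sq_nonneg (k : ℝ)]
        exact_mod_cast this
      have hk : k = 0 := by
        have : (k : ℝ) = 0 := by nlinarith [sq_nonneg (j : ℝ), sq_nonneg (k : ℝ)]
        exact_mod_cast this
      subst hj hk
      simp [hc0, h0]
    · rw [abs_mul]
      have : ν (j, k) * |gridCoeff m g j k| * (1 / ν (j, k)) = |gridCoeff m g j k| := by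
        field_simp
      rw [this]
      exact mul_le_mul_of_nonneg_right (hc j (by omega) k (by omega)) (abs_nonneg _)
  have hcs := Finset.sum_mul_sq_le_sq_mul_sq R (fun p => ν p * |gridCoeff m g p.1 p.2|)
    (fun p => 1 / ν p)
  have h1 : ∑ p ∈ R, (ν p * |gridCoeff m g p.1 p.2|) ^ 2 ≤ Real.pi ^ 4 * s ^ 2 / 2 := by
    have ha := sum_sq_mul_gridCoeff_le m g hg
    -- The bound with k² is the bound with j² for the transposed grid function.
    have hb := sum_sq_mul_gridCoeff_le m (fun i l => g l i) (fun i l => hg' l i)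
    simp_rw [gridCoeff_swap] at hb
    rw [Finset.sum_comm] at hb
    have : ∑ p ∈ R, (ν p * |gridCoeff m g p.1 p.2|) ^ 2 =
        (∑ j ∈ Finset.range (m + 1), ∑ k ∈ Finset.range (m + 1),
          (j : ℝ) ^ 2 * gridCoeff m g j k ^ 2) +
        ∑ j ∈ Finset.range (m + 1), ∑ k ∈ Finset.range (m + 1),
          (k : ℝ) ^ 2 * gridCoeff m g j k ^ 2 := by
      rw [← Finset.sum_add_distrib, hR, Finset.sum_product]
      refine Finset.sum_congr rfl fun j _ => ?_
      rw [← Finset.sum_add_distrib]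
      refine Finset.sum_congr rfl fun k _ => ?_
      rw [mul_pow, hνsq, sq_abs]
      ring
    rw [this]
    linarith
  have h2 : ∑ p ∈ R, (1 / ν p) ^ 2 ≤ 3 * (1 + Real.log m) := by
    refine le_trans (le_of_eq ?_) (sum_inv_sq_add_sq_le m)
    rw [hR, Finset.sum_product]
    refine Finset.sum_congr rfl fun j _ => Finset.sum_congr rfl fun k _ => ?_
    rw [div_pow, hνsq, one_pow]
  have h3 : (∑ p ∈ R, (ν p * |gridCoeff m g p.1 p.2|) * (1 / ν p)) ^ 2 ≤
      (s * (13 * √(1 + Real.log m))) ^ 2 := by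
    calc _ ≤ (Real.pi ^ 4 * s ^ 2 / 2) * (3 * (1 + Real.log m)) := by
          refine hcs.trans (mul_le_mul h1 h2 (Finset.sum_nonneg fun _ _ => sq_nonneg _)
            (by positivity))
      _ ≤ 169 * (s ^ 2 * (1 + Real.log m)) := by
          have hπ : Real.pi ^ 4 ≤ 100 := by
            have : Real.pi ^ 2 ≤ 10 := by nlinarith [Real.pi_lt_d2, Real.pi_pos]
            nlinarith [sq_nonneg Real.pi]
          have hx : 0 ≤ s ^ 2 * (1 + Real.log m) := by positivity
          nlinarith
      _ = _ := by
          rw [mul_pow, mul_pow, Real.sq_sqrt (by positivity)]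
          ring
  have h4 := abs_le_of_sq_le_sq h3 (by positivity)
  calc _ ≤ τ * (s * (13 * √(1 + Real.log m))) :=
        hle.trans (mul_le_mul_of_nonneg_left ((le_abs_self _).trans h4) hτ)
    _ = _ := by ring

end SpecDens

namespace SpecDens

/-! ## The error bound -/

/-- The mixed Chebyshev moments of a weighted point configuration. -/
noncomputable def mixedMoment {ι : Type*} [Fintype ι] (w x y : ι → ℝ) (j k : ℕ) : ℝ :=
  ∑ l, w l * (chebT j (x l) * chebT k (y l))

theorem jacksonMixture_eq (m : ℕ) {ι : Type*} [Fintype ι] (w x y : ι → ℝ) (q : ℝ × ℝ) :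
    jacksonMixture m w x y q =
      ∑ j ∈ Finset.range (m + 1), ∑ k ∈ Finset.range (m + 1),
        jacksonCoeff m j * jacksonCoeff m k * mixedMoment w x y j k *
          (chebT j q.1 * chebT k q.2) := by
  simp only [jacksonMixture, jackson, mixedMoment, Finset.mul_sum, Finset.sum_mul]
  conv_rhs => rw [Finset.sum_comm]
  rw [Finset.sum_comm]
  refine Finset.sum_congr rfl fun j _ => ?_
  rw [Finset.sum_comm]
  exact Finset.sum_congr rfl fun k _ => Finset.sum_congr rfl fun l _ => by ring

/-- A discrete Parseval identity. It makes the smoothed integral linear in the moments, which are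
the only quantities controlled by concentration. -/
theorem integral_kernelMeasure_gaussRule_eq_gridCoeff {m : ℕ} {ι : Type*} [Fintype ι]
    {w x y : ι → ℝ} (hw : IsWeighted w x y) (s : ℝ) {f : ℂ → ℝ} (hf : Continuous f) :
    ∫ z, f z ∂kernelMeasure (gaussRule m) s (jacksonMixture m w x y) =
      ∑ j ∈ Finset.range (m + 1), ∑ k ∈ Finset.range (m + 1),
        jacksonCoeff m j * jacksonCoeff m k * mixedMoment w x y j k *
          gridCoeff m (fun i l => f (squarePoint s (gaussNode m i, gaussNode m l))) j k := by
  rw [integral_kernelMeasure_gaussRule hw s hf]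
  simp only [jacksonMixture_eq, gridCoeff, Finset.mul_sum, Finset.sum_mul]
  calc _ = ∑ i ∈ Finset.range (m + 1), ∑ j ∈ Finset.range (m + 1), ∑ l ∈ Finset.range (m + 1),
        ∑ k ∈ Finset.range (m + 1), (Real.pi / (m + 1)) ^ 2 *
          (jacksonCoeff m j * jacksonCoeff m k * mixedMoment w x y j k *
            (chebT j (gaussNode m i) * chebT k (gaussNode m l)) *
              f (squarePoint s (gaussNode m i, gaussNode m l))) :=
        Finset.sum_congr rfl fun i _ => Finset.sum_comm
    _ = ∑ j ∈ Finset.range (m + 1), ∑ i ∈ Finset.range (m + 1), ∑ k ∈ Finset.range (m + 1),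
        ∑ l ∈ Finset.range (m + 1), (Real.pi / (m + 1)) ^ 2 *
          (jacksonCoeff m j * jacksonCoeff m k * mixedMoment w x y j k *
            (chebT j (gaussNode m i) * chebT k (gaussNode m l)) *
              f (squarePoint s (gaussNode m i, gaussNode m l))) := by
        rw [Finset.sum_comm]
        exact Finset.sum_congr rfl fun j _ => Finset.sum_congr rfl fun i _ => Finset.sum_comm
    _ = _ := by
        refine Finset.sum_congr rfl fun j _ => ?_
        rw [Finset.sum_comm]
        exact Finset.sum_congr rfl fun k _ => Finset.sum_congr rfl fun i _ =>
          Finset.sum_congr rfl fun l _ => by ring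

theorem abs_gaussNode_succ_sub_le (m i : ℕ) :
    |gaussNode m (i + 1) - gaussNode m i| ≤ Real.pi / (m + 1) := by
  have hπ := Real.pi_pos
  have h := Real.lipschitzWith_cos.dist_le_mul (gaussAngle m (i + 1)) (gaussAngle m i)
  rw [Real.dist_eq, Real.dist_eq, NNReal.coe_one, one_mul] at h
  refine h.trans (le_of_eq ?_)
  have : gaussAngle m (i + 1) - gaussAngle m i = Real.pi / (m + 1) := by
    rw [gaussAngle, gaussAngle]
    push_cast
    field_simp
    ring
  rw [this, abs_of_pos (by positivity)]

/-- Weighted point configurations on the same points with close mixed moments are close. -/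
theorem abs_sum_sub_sum_le {m : ℕ} (hm : 1 ≤ m) {ι : Type*} [Fintype ι] {w w' x y : ι → ℝ}
    (hw : IsWeighted w x y) (hw' : IsWeighted w' x y) {s τ : ℝ} (hs : 0 ≤ s)
    (hτ : ∀ j ≤ m, ∀ k ≤ m, |mixedMoment w x y j k - mixedMoment w' x y j k| ≤ τ)
    {f : ℂ → ℝ} (hf : LipschitzWith 1 f) :
    |∑ l, w l * f (squarePoint s (x l, y l)) - ∑ l, w' l * f (squarePoint s (x l, y l))| ≤
      s * (44 / m + τ * (13 * √(1 + Real.log m))) := by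
  have hq := isChebQuad_gaussRule m
  -- Both configurations are first smoothed with the Gauss rule, at cost 22s/m each; only the
  -- smoothed integrals are compared through moments.
  have h1 := abs_le.mp (abs_sum_sub_integral_kernelMeasure_le hq hm hw hs hf)
  have h2 := abs_le.mp (abs_sum_sub_integral_kernelMeasure_le hq hm hw' hs hf)
  set g : ℕ → ℕ → ℝ := fun i l => f (squarePoint s (gaussNode m i, gaussNode m l)) with hg
  have hfd : ∀ p q, |f (squarePoint s p) - f (squarePoint s q)| ≤
      s * (|p.1 - q.1| + |p.2 - q.2|) := by
    intro p q
    have h3 := hf.dist_le_mul (squarePoint s p) (squarePoint s q)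
    rw [NNReal.coe_one, one_mul, Real.dist_eq] at h3
    exact h3.trans (dist_squarePoint_le hs _ _)
  have h3 : |∑ j ∈ Finset.range (m + 1), ∑ k ∈ Finset.range (m + 1),
      (jacksonCoeff m j * jacksonCoeff m k * (mixedMoment w x y j k - mixedMoment w' x y j k)) *
        gridCoeff m g j k| ≤ s * (τ * (13 * √(1 + Real.log m))) := by
    refine abs_sum_mul_gridCoeff_le g hs ?_ ?_ (c := fun j k => jacksonCoeff m j *
      jacksonCoeff m k * (mixedMoment w x y j k - mixedMoment w' x y j k)) ?_ ?_
    · intro i l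
      refine (hfd _ _).trans (mul_le_mul_of_nonneg_left ?_ hs)
      simpa using abs_gaussNode_succ_sub_le m i
    · intro i l
      refine (hfd _ _).trans (mul_le_mul_of_nonneg_left ?_ hs)
      simpa using abs_gaussNode_succ_sub_le m l
    · simp only [mixedMoment, chebT_zero, ← Finset.sum_mul, hw.sum_eq, hw'.sum_eq, sub_self,
        mul_zero]
    · intro j hj k hk
      rw [abs_mul, abs_mul]
      have hρ := mul_le_one₀ (abs_jacksonCoeff_le_one hj) (abs_nonneg _)
        (abs_jacksonCoeff_le_one hk)
      exact (mul_le_of_le_one_left (abs_nonneg _) hρ).trans (hτ j hj k hk)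
  have h4 : ∫ z, f z ∂kernelMeasure (gaussRule m) s (jacksonMixture m w x y) -
      ∫ z, f z ∂kernelMeasure (gaussRule m) s (jacksonMixture m w' x y) =
      ∑ j ∈ Finset.range (m + 1), ∑ k ∈ Finset.range (m + 1),
      (jacksonCoeff m j * jacksonCoeff m k * (mixedMoment w x y j k - mixedMoment w' x y j k)) *
        gridCoeff m g j k := by
    rw [integral_kernelMeasure_gaussRule_eq_gridCoeff hw s hf.continuous,
      integral_kernelMeasure_gaussRule_eq_gridCoeff hw' s hf.continuous, ← Finset.sum_sub_distrib]
    refine Finset.sum_congr rfl fun j _ => ?_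
    rw [← Finset.sum_sub_distrib]
    exact Finset.sum_congr rfl fun k _ => by ring
  rw [← h4] at h3
  have h5 := abs_le.mp h3
  have h6 : s * (44 / m + τ * (13 * √(1 + Real.log m))) =
      s * (22 / m) + s * (22 / m) + s * (τ * (13 * √(1 + Real.log m))) := by ring
  rw [h6, abs_le]
  constructor <;> linarith

/-- The normalizing factors are below 1 because π > 2, so deviations of the normalized moments are
controlled by those with the plain T_j, which are bounded by 1 on [-1,1]. -/
theorem abs_chebT_mul_chebT_eq_le (j k : ℕ) : ∃ c : ℝ, |c| ≤ 1 ∧ ∀ x y : ℝ,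
    chebT j x * chebT k y = c * ((Polynomial.Chebyshev.T ℝ j).eval x *
      (Polynomial.Chebyshev.T ℝ k).eval y) := by
  have hπ := Real.pi_gt_three
  have h : ∀ i : ℕ, |if i = 0 then √(1 / Real.pi) else √(2 / Real.pi)| ≤ 1 := by
    intro i
    split_ifs
    · rw [abs_of_nonneg (Real.sqrt_nonneg _), Real.sqrt_le_iff, one_pow, div_le_one (by positivity)]
      exact ⟨zero_le_one, by linarith⟩
    · rw [abs_of_nonneg (Real.sqrt_nonneg _), Real.sqrt_le_iff, one_pow, div_le_one (by positivity)]
      exact ⟨zero_le_one, by linarith⟩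
  refine ⟨(if j = 0 then √(1 / Real.pi) else √(2 / Real.pi)) *
    (if k = 0 then √(1 / Real.pi) else √(2 / Real.pi)), ?_, fun x y => ?_⟩
  · rw [abs_mul]
    exact mul_le_one₀ (h j) (abs_nonneg _) (h k)
  · rw [chebT, chebT]
    ring

/-- The spectral weights of a vector in an orthonormal basis. -/
noncomputable def basisWeight {n : ℕ} (u : OrthonormalBasis (Fin n) ℂ (EuclideanSpace ℂ (Fin n)))
    (b : EuclideanSpace ℂ (Fin n)) (l : Fin n) : ℝ := ‖inner ℂ (u l) b‖ ^ 2

theorem unifSphere_abs_tail {n : ℕ} (hn : 1 ≤ n)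
    (u : OrthonormalBasis (Fin n) ℂ (EuclideanSpace ℂ (Fin n))) {a : Fin n → ℝ}
    (ha : ∀ l, |a l| ≤ 1) {t : ℝ} (ht : 0 < t) :
    unifSphere n {b | t < |∑ l, (basisWeight u b.1 l - 1 / n) * a l|} ≤
      ENNReal.ofReal (2 * Real.exp (-(n * t ^ 2 / 64))) := by
  have h1 := unifSphere_tail hn u ha ht
  have h2 := unifSphere_tail hn u (a := fun l => -a l) (fun l => by rw [abs_neg]; exact ha l) ht
  have hsub : {b : Metric.sphere (0 : EuclideanSpace ℂ (Fin n)) 1 |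
      t < |∑ l, (basisWeight u b.1 l - 1 / n) * a l|} ⊆
      {b | t < ∑ l, (‖inner ℂ (u l) b.1‖ ^ 2 - 1 / n) * a l} ∪
      {b | t < ∑ l, (‖inner ℂ (u l) b.1‖ ^ 2 - 1 / n) * -a l} := by
    intro b hb
    have hb' : t < |∑ l, (basisWeight u b.1 l - 1 / n) * a l| := hb
    rcases lt_abs.mp hb' with h | h
    · exact Or.inl h
    · refine Or.inr ?_
      simp only [Set.mem_ofPred_eq, mul_neg, Finset.sum_neg_distrib]
      exact h
  refine (measure_mono hsub).trans ((measure_union_le _ _).trans ?_)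
  rw [two_mul, ENNReal.ofReal_add (Real.exp_pos _).le (Real.exp_pos _).le]
  exact add_le_add h1 h2

theorem unifSphere_exists_moment_le {n m : ℕ} (hn : 1 ≤ n) (hm : 2 ≤ m)
    (u : OrthonormalBasis (Fin n) ℂ (EuclideanSpace ℂ (Fin n))) {x y : Fin n → ℝ}
    (hx : ∀ l, x l ∈ Set.Icc (-1 : ℝ) 1) (hy : ∀ l, y l ∈ Set.Icc (-1 : ℝ) 1)
    {δ : ℝ} (hδ : 0 < δ) (hδ1 : δ < 1) :
    unifSphere n {b | ∃ j ≤ m, ∃ k ≤ m, √(320 * Real.log (m / δ) / n) <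
      |mixedMoment (fun _ => 1 / (n : ℝ)) x y j k -
        mixedMoment (basisWeight u b.1) x y j k|} ≤ ENNReal.ofReal δ := by
  have hm' : (2 : ℝ) ≤ m := by exact_mod_cast hm
  have hn' : (0 : ℝ) < n := by exact_mod_cast hn
  have hL : 0 < Real.log (m / δ) := Real.log_pos (by rw [lt_div_iff₀ hδ]; linarith)
  -- As 320 = 5·64, each tail becomes 2(δ/m)⁵, and 2(m+1)² ≤ m⁵ for m ≥ 2 pays for the union bound.
  set t := √(320 * Real.log (m / δ) / n) with ht
  have ht0 : 0 < t := Real.sqrt_pos.mpr (by positivity)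
  set F : ℕ → ℕ → Set (Metric.sphere (0 : EuclideanSpace ℂ (Fin n)) 1) := fun j k =>
    {b | t < |∑ l, (basisWeight u b.1 l - 1 / n) * ((Polynomial.Chebyshev.T ℝ j).eval (x l) *
      (Polynomial.Chebyshev.T ℝ k).eval (y l))|} with hF
  have hsub : {b : Metric.sphere (0 : EuclideanSpace ℂ (Fin n)) 1 | ∃ j ≤ m, ∃ k ≤ m, t <
      |mixedMoment (fun _ => 1 / (n : ℝ)) x y j k -
        mixedMoment (basisWeight u b.1) x y j k|} ⊆
      ⋃ p ∈ Finset.range (m + 1) ×ˢ Finset.range (m + 1), F p.1 p.2 := by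
    rintro b ⟨j, hj, k, hk, hjk⟩
    simp only [Set.mem_iUnion, exists_prop]
    refine ⟨(j, k), by simp; omega, ?_⟩
    refine hjk.trans_le ?_
    obtain ⟨c, hc, hck⟩ := abs_chebT_mul_chebT_eq_le j k
    rw [abs_sub_comm, mixedMoment, mixedMoment, ← Finset.sum_sub_distrib]
    have : ∑ l, (basisWeight u b.1 l * (chebT j (x l) * chebT k (y l)) -
        1 / (n : ℝ) * (chebT j (x l) * chebT k (y l))) =
        c * ∑ l, (basisWeight u b.1 l - 1 / n) * ((Polynomial.Chebyshev.T ℝ j).eval (x l) *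
          (Polynomial.Chebyshev.T ℝ k).eval (y l)) := by
      rw [Finset.mul_sum]
      refine Finset.sum_congr rfl fun l _ => ?_
      rw [hck]
      ring
    rw [this, abs_mul]
    exact mul_le_of_le_one_left (abs_nonneg _) hc
  have hFle : ∀ j k, unifSphere n (F j k) ≤
      ENNReal.ofReal (2 * Real.exp (-(n * t ^ 2 / 64))) := by
    intro j k
    refine unifSphere_abs_tail hn u (fun l => ?_) ht0
    rw [abs_mul]
    exact mul_le_one₀ (Polynomial.Chebyshev.abs_eval_T_real_le_one _ (abs_le.mpr (hx l)))
      (abs_nonneg _) (Polynomial.Chebyshev.abs_eval_T_real_le_one _ (abs_le.mpr (hy l)))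
  refine (measure_mono hsub).trans ((measure_biUnion_finset_le _ _).trans ?_)
  refine (Finset.sum_le_sum fun p _ => hFle p.1 p.2).trans ?_
  rw [Finset.sum_const, Finset.card_product, Finset.card_range, nsmul_eq_mul,
    ← ENNReal.ofReal_natCast, ← ENNReal.ofReal_mul (by positivity)]
  refine ENNReal.ofReal_le_ofReal ?_
  have hexp : Real.exp (-(n * t ^ 2 / 64)) = (δ / m) ^ 5 := by
    rw [ht, Real.sq_sqrt (by positivity)]
    have h1 : -(n * (320 * Real.log (m / δ) / n) / 64) = (5 : ℕ) * Real.log (δ / m) := by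
      rw [← inv_div (m : ℝ) δ, Real.log_inv]
      push_cast
      field_simp
      ring
    rw [h1, Real.exp_nat_mul, Real.exp_log (by positivity)]
  rw [hexp]
  push_cast
  have hδ5 : δ ^ 5 ≤ δ := pow_le_of_le_one hδ.le hδ1.le (by norm_num)
  have hpoly : (((m : ℝ) + 1) * (m + 1)) * 2 ≤ (m : ℝ) ^ 5 := by
    have h3 : ((m : ℝ) + 1) * (m + 1) ≤ (m * 3 / 2) * (m * 3 / 2) := by nlinarith
    have h4 : (8 : ℝ) ≤ (m : ℝ) ^ 3 := by
      calc (8 : ℝ) = 2 ^ 3 := by norm_num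
        _ ≤ (m : ℝ) ^ 3 := pow_le_pow_left₀ (by norm_num) hm' 3
    nlinarith [sq_nonneg (m : ℝ)]
  have hm5 : (0 : ℝ) < (m : ℝ) ^ 5 := by positivity
  calc _ = ((((m : ℝ) + 1) * (m + 1)) * 2 / m ^ 5) * δ ^ 5 := by rw [div_pow]; ring
    _ ≤ 1 * δ := by
        refine mul_le_mul ?_ hδ5 (by positivity) zero_le_one
        rw [div_le_one hm5]
        exact hpoly
    _ = δ := one_mul δ

section

variable {n : ℕ} {A : Matrix (Fin n) (Fin n) ℂ}
  {u : OrthonormalBasis (Fin n) ℂ (EuclideanSpace ℂ (Fin n))} {lam : Fin n → ℂ} {s : ℝ}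

theorem IsEigenbasis.re_mem (h : IsEigenbasis A u lam) (hs : 0 < s) (hA : specNorm A ≤ s)
    (l : Fin n) : (lam l).re / s ∈ Set.Icc (-1 : ℝ) 1 := by
  rw [Set.mem_Icc, ← abs_le, abs_div, abs_of_pos hs, div_le_one hs]
  exact (Complex.abs_re_le_norm _).trans ((h.norm_le l).trans hA)

theorem IsEigenbasis.im_mem (h : IsEigenbasis A u lam) (hs : 0 < s) (hA : specNorm A ≤ s)
    (l : Fin n) : (lam l).im / s ∈ Set.Icc (-1 : ℝ) 1 := by
  rw [Set.mem_Icc, ← abs_le, abs_div, abs_of_pos hs, div_le_one hs]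
  exact (Complex.abs_im_le_norm _).trans ((h.norm_le l).trans hA)

theorem squarePoint_re_im (hs : 0 < s) (z : ℂ) : squarePoint s (z.re / s, z.im / s) = z := by
  have hs' : (s : ℂ) ≠ 0 := by exact_mod_cast hs.ne'
  have hz := Complex.re_add_im z
  rw [squarePoint]
  push_cast
  rw [mul_add, mul_div_cancel₀ _ hs', mul_left_comm, mul_div_cancel₀ _ hs', mul_comm Complex.I]
  exact hz

theorem IsEigenbasis.isWeighted (h : IsEigenbasis A u lam) (hs : 0 < s) (hA : specNorm A ≤ s)
    (b : Metric.sphere (0 : EuclideanSpace ℂ (Fin n)) 1) :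
    IsWeighted (basisWeight u b.1) (fun l => (lam l).re / s) (fun l => (lam l).im / s) where
  nonneg l := by unfold basisWeight; positivity
  sum_eq := by
    have : ‖b.1‖ = 1 := by simp
    simp only [basisWeight]
    rw [sum_norm_inner_sq, this, one_pow]
  left := h.re_mem hs hA
  right := h.im_mem hs hA

theorem IsEigenbasis.isWeighted_const (h : IsEigenbasis A u lam) (hn : 1 ≤ n) (hs : 0 < s)
    (hA : specNorm A ≤ s) :
    IsWeighted (fun _ => 1 / (n : ℝ)) (fun l => (lam l).re / s) (fun l => (lam l).im / s) where
  nonneg l := by positivity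
  sum_eq := by
    have : (n : ℝ) ≠ 0 := by positivity
    simp [this]
  left := h.re_mem hs hA
  right := h.im_mem hs hA

theorem earthMover_div_le {μ ν : Measure ℂ} {B : ℝ} (hs : 0 < s)
    (h : ∀ f : ℂ → ℝ, LipschitzWith 1 f → (∫ z, f z ∂μ) - ∫ z, f z ∂ν ≤ s * B) :
    earthMover μ ν / ENNReal.ofReal s ≤ ENNReal.ofReal B := by
  refine ENNReal.div_le_of_le_mul ?_
  rw [← ENNReal.ofReal_mul' hs.le, mul_comm]
  exact iSup_le fun f => ENNReal.ofReal_le_ofReal (h f.1 f.2)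

/-- A triangle inequality through the spectral measure of b: concentration compares it with the
spectral density, and the smoothing bound compares it with the output, for either quadrature
measure. -/
theorem IsEigenbasis.unifSphere_error_le (h : IsEigenbasis A u lam) {m : ℕ} (hn : 1 ≤ n)
    (hm : 1 ≤ m) (hs : 0 < s) (hA : specNorm A ≤ s) {ω : Measure ℝ} (hω : IsChebQuad m ω)
    {est : Metric.sphere (0 : EuclideanSpace ℂ (Fin n)) 1 → Measure ℂ}
    (hest : ∀ b, est b = kernelMeasure ω s (jacksonMixture m (basisWeight u b.1)
      (fun l => (lam l).re / s) (fun l => (lam l).im / s)))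
    {C : ℝ} (hC : 400 ≤ C) {δ : ℝ} (hδ : 0 < δ) (hδ1 : δ < 1) :
    unifSphere n {b | ¬ earthMover (spectralDensity A) (est b) / ENNReal.ofReal s ≤
      ENNReal.ofReal (errorBound C n m δ)} ≤ ENNReal.ofReal δ := by
  have hn' : (0 : ℝ) < n := by exact_mod_cast hn
  have hm' : (1 : ℝ) ≤ m := by exact_mod_cast hm
  have hδm : 1 ≤ m / δ := by rw [le_div_iff₀ hδ]; linarith
  have hw' := h.isWeighted_const hn hs hA
  have hdist : ∀ (b : Metric.sphere (0 : EuclideanSpace ℂ (Fin n)) 1) (B : ℝ),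
      (∀ f : ℂ → ℝ, LipschitzWith 1 f →
        ∑ l, (1 / (n : ℝ)) * f (lam l) - ∑ l, basisWeight u b.1 l * f (lam l) ≤ s * B) →
      earthMover (spectralDensity A) (est b) / ENNReal.ofReal s ≤ ENNReal.ofReal (B + 22 / m) := by
    intro b B hB
    refine earthMover_div_le hs fun f hf => ?_
    have h1 := hB f hf
    have h2 := abs_le.mp
      (abs_sum_sub_integral_kernelMeasure_le hω hm (h.isWeighted hs hA b) hs.le hf)
    rw [← hest b] at h2
    simp only [squarePoint_re_im hs] at h2
    rw [h.integral_spectralDensity]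
    linarith [h2.2]
  rcases hm.eq_or_lt with hm1 | hm2
  -- For m = 1 the logarithmic term vanishes and only the constant C is left. The trivial bound is
  -- used: both measures live in the disc of radius s, so integrals of f differ by at most 2s.
  · have : {b | ¬ earthMover (spectralDensity A) (est b) / ENNReal.ofReal s ≤
        ENNReal.ofReal (errorBound C n m δ)} = ∅ := by
      refine Set.eq_empty_of_forall_notMem fun b hb => hb ?_
      have hw := h.isWeighted hs hA b
      refine (hdist b 2 fun f hf => ?_).trans (ENNReal.ofReal_le_ofReal ?_)
      · have hf0 : ∀ l, |f (lam l) - f 0| ≤ s := by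
          intro l
          have h3 := hf.dist_le_mul (lam l) 0
          rw [NNReal.coe_one, one_mul, Real.dist_eq, dist_zero_right] at h3
          exact h3.trans ((h.norm_le l).trans hA)
        have hmean : ∀ v : Fin n → ℝ, (∀ l, 0 ≤ v l) → ∑ l, v l = 1 →
            |∑ l, v l * f (lam l) - f 0| ≤ s := by
          intro v hv hv1
          have : ∑ l, v l * f (lam l) - f 0 = ∑ l, v l * (f (lam l) - f 0) := by
            simp only [mul_sub, Finset.sum_sub_distrib, ← Finset.sum_mul, hv1, one_mul]
          rw [this]
          calc _ ≤ ∑ l, |v l * (f (lam l) - f 0)| := Finset.abs_sum_le_sum_abs _ _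
            _ ≤ ∑ l, v l * s := by
                refine Finset.sum_le_sum fun l _ => ?_
                rw [abs_mul, abs_of_nonneg (hv l)]
                exact mul_le_mul_of_nonneg_left (hf0 l) (hv l)
            _ = s := by rw [← Finset.sum_mul, hv1, one_mul]
        have h1 := abs_le.mp (hmean _ hw.nonneg hw.sum_eq)
        have h2 := abs_le.mp (hmean _ hw'.nonneg hw'.sum_eq)
        linarith [h1.1, h2.2]
      · subst hm1
        simp only [errorBound, Nat.cast_one, Real.log_one, mul_zero, zero_div, Real.sqrt_zero]
        linarith
    rw [this]
    simp
  · have hm2' : (2 : ℝ) ≤ m := by exact_mod_cast hm2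
    refine (measure_mono ?_).trans
      (unifSphere_exists_moment_le hn hm2 u (h.re_mem hs hA) (h.im_mem hs hA) hδ hδ1)
    intro b hb
    by_contra hgood
    simp only [Set.mem_ofPred_eq, not_exists, not_and, not_lt] at hgood
    refine hb ((hdist b (44 / m + √(320 * Real.log (m / δ) / n) * (13 * √(1 + Real.log m)))
      fun f hf => ?_).trans (ENNReal.ofReal_le_ofReal ?_))
    · have h1 := abs_le.mp (abs_sum_sub_sum_le hm hw' (h.isWeighted hs hA b) hs.le hgood hf)
      simp only [squarePoint_re_im hs] at h1
      exact h1.2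
    · have hL : 0 ≤ Real.log (m / δ) := Real.log_nonneg hδm
      -- Here m ≥ 2 enters: log m is bounded below, so 1 + log m ≤ 2.5 log m.
      have hlog2 : 0.69 ≤ Real.log m :=
        (by linarith [Real.log_two_gt_d9] : (0.69 : ℝ) ≤ Real.log 2).trans
          (Real.log_le_log (by norm_num) hm2')
      have hprod : √(320 * Real.log (m / δ) / n) * (13 * √(1 + Real.log m)) ≤
          400 * √(Real.log (m / δ) * Real.log m / n) := by
        have h1 : √(320 * Real.log (m / δ) / n) * (13 * √(1 + Real.log m)) =
            13 * √(320 * Real.log (m / δ) / n * (1 + Real.log m)) := by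
          rw [Real.sqrt_mul (by positivity)]
          ring
        have h2 : 320 * Real.log (m / δ) / n * (1 + Real.log m) ≤
            28.5 ^ 2 * (Real.log (m / δ) * Real.log m / n) := by
          have h3 : 1 + Real.log m ≤ 2.5 * Real.log m := by linarith
          calc _ ≤ 320 * Real.log (m / δ) / n * (2.5 * Real.log m) := by gcongr
            _ = 800 * (Real.log (m / δ) * Real.log m / n) := by ring
            _ ≤ _ := by
                refine mul_le_mul_of_nonneg_right (by norm_num) ?_
                have : 0 ≤ Real.log m := by linarith
                positivity
        rw [h1]
        calc _ ≤ 13 * √(28.5 ^ 2 * (Real.log (m / δ) * Real.log m / n)) := by gcongr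
          _ = 13 * (28.5 * √(Real.log (m / δ) * Real.log m / n)) := by
              rw [Real.sqrt_mul (by positivity), Real.sqrt_sq (by norm_num)]
          _ ≤ _ := by nlinarith [Real.sqrt_nonneg (Real.log (m / δ) * Real.log m / n)]
      rw [errorBound]
      have hR := Real.sqrt_nonneg (Real.log (m / δ) * Real.log m / n)
      have hinv : 0 ≤ 1 / (m : ℝ) := by positivity
      calc _ ≤ 44 / (m : ℝ) + 400 * √(Real.log (m / δ) * Real.log m / n) + 22 / m := by linarith
        _ = 66 * (1 / (m : ℝ)) + 400 * √(Real.log (m / δ) * Real.log m / n) := by ring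
        _ ≤ C * (1 / m) + C * √(Real.log (m / δ) * Real.log m / n) := by
            gcongr
            linarith
        _ = _ := by ring

end

end SpecDens

namespace SpecDens

/-! ## Resources used by a program -/

/-- The number of elementary steps of a program; it does not depend on the memory. -/
def Prog.timeCost (inp : Input) : Prog → (Idx → ℕ) → ℕ
  | .skip, _ => 0
  | .seq p q, env => p.timeCost inp env + q.timeCost inp env
  | .assign _ r c e, _ => r.cost + c.cost + e.cost + 1
  | .output e, _ => e.cost + 1
  | .sample _ r, _ => r.cost + inp.n + 1
  | .mulA _ r _ r', _ => r.cost + r'.cost + 2 * inp.n + 1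
  | .mulAStar _ r _ r', _ => r.cost + r'.cost + 2 * inp.n + 1
  | .loop x e body, env => e.cost + 1 +
      ∑ v ∈ Finset.range (e.eval inp env), (body.timeCost inp (Function.update env x v) + 1)

/-- The number of products with `A`. -/
def Prog.queryCost (inp : Input) : Prog → (Idx → ℕ) → ℕ
  | .seq p q, env => p.queryCost inp env + q.queryCost inp env
  | .mulA _ _ _ _, _ => 1
  | .loop x e body, env =>
      ∑ v ∈ Finset.range (e.eval inp env), body.queryCost inp (Function.update env x v)
  | _, _ => 0

/-- The number of products with `A*`. -/
def Prog.queryStarCost (inp : Input) : Prog → (Idx → ℕ) → ℕ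
  | .seq p q, env => p.queryStarCost inp env + q.queryStarCost inp env
  | .mulAStar _ _ _ _, _ => 1
  | .loop x e body, env =>
      ∑ v ∈ Finset.range (e.eval inp env), body.queryStarCost inp (Function.update env x v)
  | _, _ => 0

/-- All cells written by the program lie in `S`. -/
def Prog.WritesIn (inp : Input) (S : Set Cell) : Prog → (Idx → ℕ) → Prop
  | .skip, _ => True
  | .seq p q, env => p.WritesIn inp S env ∧ q.WritesIn inp S env
  | .assign a r c _, env => (a, r.eval inp env, c.eval inp env) ∈ S
  | .output _, _ => True
  | .sample a r, env => ∀ c < inp.n, (a, r.eval inp env, c) ∈ S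
  | .mulA a r _ _, env => ∀ c < inp.n, (a, r.eval inp env, c) ∈ S
  | .mulAStar a r _ _, env => ∀ c < inp.n, (a, r.eval inp env, c) ∈ S
  | .loop x e body, env =>
      ∀ v < e.eval inp env, body.WritesIn inp S (Function.update env x v)

/-- Induction over the iterations of a loop. -/
theorem Prog.exec_loop_induction {inp : Input} {x : Idx} {e : IExp} {body : Prog}
    {env : Idx → ℕ} {σ : State} (I : ℕ → State → Prop)
    (h0 : I 0 { σ with time := σ.time + (e.cost + 1) })
    (hstep : ∀ v < e.eval inp env, ∀ τ, I v τ →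
      I (v + 1) { body.exec inp (Function.update env x v) τ with
        time := (body.exec inp (Function.update env x v) τ).time + 1 }) :
    I (e.eval inp env) ((Prog.loop x e body).exec inp env σ) := by
  rw [Prog.exec]
  generalize e.eval inp env = N at hstep
  induction N with
  | zero => simpa using h0
  | succ N ih =>
    rw [List.range_succ, List.foldl_append]
    exact hstep N (Nat.lt_succ_self N) _ (ih fun v hv => hstep v (Nat.lt_succ_of_lt hv))

theorem Prog.exec_time (inp : Input) (p : Prog) (env : Idx → ℕ) (σ : State) :
    (p.exec inp env σ).time = σ.time + p.timeCost inp env := by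
  induction p generalizing env σ with
  | skip => rfl
  | seq p q hp hq => rw [Prog.exec, hq, hp, Prog.timeCost, add_assoc]
  | loop x e body ih =>
    rw [Prog.timeCost]
    refine Prog.exec_loop_induction (fun v τ => τ.time = σ.time + (e.cost + 1 +
      ∑ v ∈ Finset.range v, (body.timeCost inp (Function.update env x v) + 1))) (by simp) ?_
    intro v _ τ hτ
    simp only [ih, hτ, Finset.sum_range_succ]
    ring
  | _ => rfl

theorem Prog.exec_queries (inp : Input) (p : Prog) (env : Idx → ℕ) (σ : State) :
    (p.exec inp env σ).queries = σ.queries + p.queryCost inp env := by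
  induction p generalizing env σ with
  | seq p q hp hq => rw [Prog.exec, hq, hp, Prog.queryCost, add_assoc]
  | loop x e body ih =>
    rw [Prog.queryCost]
    refine Prog.exec_loop_induction (fun v τ => τ.queries = σ.queries +
      ∑ v ∈ Finset.range v, body.queryCost inp (Function.update env x v)) (by simp) ?_
    intro v _ τ hτ
    simp only [ih, hτ, Finset.sum_range_succ]
    ring
  | _ => rfl

theorem Prog.exec_queriesStar (inp : Input) (p : Prog) (env : Idx → ℕ) (σ : State) :
    (p.exec inp env σ).queriesStar = σ.queriesStar + p.queryStarCost inp env := by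
  induction p generalizing env σ with
  | seq p q hp hq => rw [Prog.exec, hq, hp, Prog.queryStarCost, add_assoc]
  | loop x e body ih =>
    rw [Prog.queryStarCost]
    refine Prog.exec_loop_induction (fun v τ => τ.queriesStar = σ.queriesStar +
      ∑ v ∈ Finset.range v, body.queryStarCost inp (Function.update env x v)) (by simp) ?_
    intro v _ τ hτ
    simp only [ih, hτ, Finset.sum_range_succ]
    ring
  | _ => rfl

theorem rowCells_subset {a : Arr} {r n : ℕ} {S : Set Cell} (h : ∀ c < n, (a, r, c) ∈ S) :
    (rowCells a r n : Set Cell) ⊆ S := by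
  intro c hc
  simp only [rowCells, Finset.coe_image, Finset.coe_range, Set.mem_image, Set.mem_Iio] at hc
  obtain ⟨l, hl, rfl⟩ := hc
  exact h l hl

theorem Prog.exec_used_subset {inp : Input} {S : Set Cell} (p : Prog) {env : Idx → ℕ} {σ : State}
    (hp : p.WritesIn inp S env) (hσ : (σ.used : Set Cell) ⊆ S) :
    ((p.exec inp env σ).used : Set Cell) ⊆ S := by
  induction p generalizing env σ with
  | skip => exact hσ
  | seq p q ihp ihq => exact ihq hp.2 (ihp hp.1 hσ)
  | assign a r c e =>
    simp only [Prog.exec, Finset.coe_insert]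
    exact Set.insert_subset hp hσ
  | output e => exact hσ
  | sample a r =>
    simp only [Prog.exec, Finset.coe_union]
    exact Set.union_subset hσ (rowCells_subset hp)
  | mulA a r a' r' =>
    simp only [Prog.exec, Finset.coe_union]
    exact Set.union_subset hσ (rowCells_subset hp)
  | mulAStar a r a' r' =>
    simp only [Prog.exec, Finset.coe_union]
    exact Set.union_subset hσ (rowCells_subset hp)
  | loop x e body ih =>
    exact Prog.exec_loop_induction (fun _ τ => (τ.used : Set Cell) ⊆ S) hσ
      fun v hv τ hτ => ih (hp v hv) hτ

/-- The cells available to the two programs. -/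
def workspace (n m : ℕ) : Finset Cell :=
  {.b, .X, .Y, .P, .Q, .rho, .nrm, .U, .V, .t, .acc} ×ˢ
    ((Finset.range (m + 3) ×ˢ Finset.range n) ∪ ({0} ×ˢ Finset.range (m + 1)))

theorem mem_workspace {n m : ℕ} {a : Arr} {r c : ℕ} :
    (a, r, c) ∈ workspace n m ↔ (r < m + 3 ∧ c < n) ∨ (r = 0 ∧ c < m + 1) := by
  have : a ∈ ({.b, .X, .Y, .P, .Q, .rho, .nrm, .U, .V, .t, .acc} : Finset Arr) := by
    cases a <;> decide
  simp only [workspace, Finset.mem_product, this, true_and, Finset.mem_union, Finset.mem_range,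
    Finset.mem_singleton]

theorem card_workspace_le (n m : ℕ) : (workspace n m).card ≤ 11 * ((m + 3) * n + (m + 1)) := by
  rw [workspace, Finset.card_product]
  refine Nat.mul_le_mul (le_of_eq (by decide)) ((Finset.card_union_le _ _).trans ?_)
  simp

/-- Storage is bounded by a fixed workspace containing every written cell. The constant 66 comes
from eleven arrays, with (m+3)n ≤ 4mn and m + 1 ≤ 2mn. -/
theorem withinBudget_of_costs {p : Prog} {inp : Input} {C : ℕ}
    (ht : p.timeCost inp (fun _ => 0) ≤ C * (inp.m ^ 2 * inp.n))
    (hq : p.queryCost inp (fun _ => 0) ≤ C * inp.m)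
    (hqs : p.queryStarCost inp (fun _ => 0) ≤ C * inp.m)
    (hw : p.WritesIn inp (workspace inp.n inp.m) fun _ => 0)
    (hC : 66 ≤ C) (hn : 1 ≤ inp.n) (hm : 1 ≤ inp.m) :
    WithinBudget C inp.n inp.m (p.run inp) := by
  have hst : (p.run inp).storage ≤ C * (inp.m * inp.n) := by
    have h1 : (p.run inp).used ⊆ workspace inp.n inp.m := by
      have := Prog.exec_used_subset p (σ := State.init) hw (by simp [State.init])
      exact_mod_cast this
    have h2 := (Finset.card_le_card h1).trans (card_workspace_le _ _)
    refine h2.trans ?_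
    have h3 : inp.m + 1 ≤ 2 * (inp.m * inp.n) := by nlinarith
    have h4 : (inp.m + 3) * inp.n ≤ 4 * (inp.m * inp.n) := by nlinarith
    calc _ ≤ 66 * (inp.m * inp.n) := by linarith
      _ ≤ _ := Nat.mul_le_mul_right _ hC
  have ht' := Prog.exec_time inp p (fun _ => 0) State.init
  have hq' := Prog.exec_queries inp p (fun _ => 0) State.init
  have hqs' := Prog.exec_queriesStar inp p (fun _ => 0) State.init
  simp only [State.init, zero_add] at ht' hq' hqs'
  refine ⟨?_, ?_, ?_, ?_⟩
  · rw [← hq'] at hq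
    exact_mod_cast hq
  · rw [← hqs'] at hqs
    exact_mod_cast hqs
  · exact_mod_cast hst
  · rw [← ht'] at ht
    exact_mod_cast ht

end SpecDens

/-! ### Budgets of the two programs. -/

namespace SpecDens

theorem withinBudget_specDens {inp : Input} (hn : 1 ≤ inp.n) (hm : 1 ≤ inp.m) :
    WithinBudget 5000 inp.n inp.m (specDens.run inp) := by
  have hmn : inp.m ≤ inp.m ^ 2 * inp.n := by nlinarith [sq_nonneg inp.m]
  have hmn' : inp.m * inp.n ≤ inp.m ^ 2 * inp.n := by nlinarith
  have hn2 : inp.n ≤ inp.m ^ 2 * inp.n := by nlinarith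
  have hm2 : inp.m ^ 2 ≤ inp.m ^ 2 * inp.n := by nlinarith
  refine withinBudget_of_costs (C := 5000) ?_ ?_ ?_ ?_ (by norm_num) hn hm
  · simp only [specDens, chebVectors, block, recurrenceStart, recurrenceStep, query, entryH, entryK,
      Prog.timeCost, IExp.cost, SExp.cost, num, iv, jv, kv, IExp.eval, damping, degs, angle,
      innerProd, Finset.sum_const, Finset.card_range, smul_eq_mul]
    have h2 : inp.m - 2 ≤ inp.m := Nat.sub_le _ _
    -- Only m - 2 ≤ m matters for the time bound; what remains is a polynomial whose monomials are
    -- all at most m²n.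
    generalize inp.m - 2 = k at h2
    have hkn : k * inp.n ≤ inp.m * inp.n := Nat.mul_le_mul_right _ h2
    nlinarith
  · simp [specDens, chebVectors, block, recurrenceStart, recurrenceStep, query, Prog.queryCost,
      IExp.eval, damping, innerProd]
    omega
  · simp [specDens, chebVectors, block, recurrenceStart, recurrenceStep, query, Prog.queryStarCost,
      IExp.eval, damping, innerProd]
    omega
  · simp [specDens, chebVectors, block, recurrenceStart, recurrenceStep, query, Prog.WritesIn,
      IExp.eval, damping, innerProd, iv, jv, degs, mem_workspace]
    refine ⟨?_, ⟨?_, fun v hv => ⟨?_, ?_⟩⟩, ?_⟩ <;> intros <;> omega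

theorem withinBudget_specDensAtomic {inp : Input} (hn : 1 ≤ inp.n) (hm : 1 ≤ inp.m) :
    WithinBudget 5000 inp.n inp.m (specDensAtomic.run inp) := by
  have hmn : inp.m ≤ inp.m ^ 2 * inp.n := by nlinarith [sq_nonneg inp.m]
  have hmn' : inp.m * inp.n ≤ inp.m ^ 2 * inp.n := by nlinarith
  have hn2 : inp.n ≤ inp.m ^ 2 * inp.n := by nlinarith
  have hm2 : inp.m ^ 2 ≤ inp.m ^ 2 * inp.n := by nlinarith
  refine withinBudget_of_costs (C := 5000) ?_ ?_ ?_ ?_ (by norm_num) hn hm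
  · simp only [specDensAtomic, chebVectors, block, recurrenceStart, recurrenceStep, query, entryH,
      entryK, Prog.timeCost, IExp.cost, SExp.cost, num, iv, jv, kv, IExp.eval, damping, degs, angle,
      innerProd, normalizers, nodeVectors, nodeAngle, Finset.sum_const, Finset.card_range,
      smul_eq_mul]
    have h2 : inp.m - 2 ≤ inp.m := Nat.sub_le _ _
    generalize inp.m - 2 = k at h2
    have hkn : k * inp.n ≤ inp.m * inp.n := Nat.mul_le_mul_right _ h2
    nlinarith
  · simp [specDensAtomic, chebVectors, block, recurrenceStart, recurrenceStep, query,
      Prog.queryCost, IExp.eval, damping, innerProd, normalizers, nodeVectors]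
    omega
  · simp [specDensAtomic, chebVectors, block, recurrenceStart, recurrenceStep, query,
      Prog.queryStarCost, IExp.eval, damping, innerProd, normalizers, nodeVectors]
    omega
  · simp [specDensAtomic, chebVectors, block, recurrenceStart, recurrenceStep, query,
      Prog.WritesIn, IExp.eval, damping, innerProd, normalizers, nodeVectors, iv, jv, kv, degs,
      mem_workspace]
    refine ⟨?_, ⟨?_, fun v hv => ⟨?_, ?_⟩⟩, ?_, fun v hv => ⟨?_, ?_⟩⟩ <;> intros <;> omega

end SpecDens

namespace SpecDens

/-! ## Memory contents during a run -/

/-- Induction over the iterations of a loop, for properties of memory and output. -/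
theorem Prog.exec_loop_invariant {inp : Input} {x : Idx} {e : IExp} {body : Prog}
    {env : Idx → ℕ} {σ : State} (I : ℕ → (Cell → ℂ) → List ℂ → Prop) (h0 : I 0 σ.mem σ.out)
    (hstep : ∀ v < e.eval inp env, ∀ τ : State, I v τ.mem τ.out →
      I (v + 1) (body.exec inp (Function.update env x v) τ).mem
        (body.exec inp (Function.update env x v) τ).out) :
    I (e.eval inp env) ((Prog.loop x e body).exec inp env σ).mem
      ((Prog.loop x e body).exec inp env σ).out :=
  Prog.exec_loop_induction (fun v τ => I v τ.mem τ.out) h0 hstep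

theorem writeRow_same {n : ℕ} (mem : Cell → ℂ) (a : Arr) (r : ℕ) (v : Fin n → ℂ) (l : Fin n) :
    writeRow mem a r v (a, r, l) = v l := by
  simp [writeRow]

theorem writeRow_of_ne {n : ℕ} (mem : Cell → ℂ) {a : Arr} {r : ℕ} (v : Fin n → ℂ) {c : Cell}
    (h : ¬ (c.1 = a ∧ c.2.1 = r)) : writeRow mem a r v c = mem c := by
  rw [writeRow, dif_neg]
  exact fun hc => h ⟨hc.1, hc.2.1⟩

/-- A loop that fills one row of an array. -/
theorem exec_loop_assign {inp : Input} {x : Idx} {e : IExp} {a : Arr} {r : IExp} {ex : SExp}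
    {env : Idx → ℕ} {σ : State} {r' : ℕ} (val : ℕ → ℂ)
    (hr : ∀ v, r.eval inp (Function.update env x v) = r')
    (hval : ∀ v < e.eval inp env, ∀ mem : Cell → ℂ,
      (∀ c : Cell, ¬ (c.1 = a ∧ c.2.1 = r' ∧ c.2.2 < v) → mem c = σ.mem c) →
      ex.eval inp (Function.update env x v) mem = val v) :
    let τ := (Prog.loop x e (.assign a r (.var x) ex)).exec inp env σ
    (∀ v < e.eval inp env, τ.mem (a, r', v) = val v) ∧
      (∀ c : Cell, ¬ (c.1 = a ∧ c.2.1 = r' ∧ c.2.2 < e.eval inp env) → τ.mem c = σ.mem c) ∧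
      τ.out = σ.out := by
  refine Prog.exec_loop_invariant (fun v mem out => (∀ w < v, mem (a, r', w) = val w) ∧
    (∀ c : Cell, ¬ (c.1 = a ∧ c.2.1 = r' ∧ c.2.2 < v) → mem c = σ.mem c) ∧ out = σ.out)
    ⟨by simp, by simp, rfl⟩ ?_
  rintro v hv τ ⟨h1, h2, h3⟩
  simp only [Prog.exec, IExp.eval, Function.update_self, hr, hval v hv τ.mem h2]
  refine ⟨fun w hw => ?_, fun c hc => ?_, h3⟩
  · rcases Nat.lt_succ_iff_lt_or_eq.mp hw with hw | rfl
    · rw [Function.update_of_ne (by simp; omega), h1 w hw]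
    · rw [Function.update_self]
  · rw [Function.update_of_ne, h2]
    · exact fun h => hc ⟨h.1, h.2.1, by omega⟩
    · rintro rfl
      exact hc ⟨rfl, rfl, Nat.lt_succ_self v⟩

/-- Row `r` of array `a` holds the vector `v`. -/
def HoldsRow {n : ℕ} (mem : Cell → ℂ) (a : Arr) (r : ℕ) (v : Fin n → ℂ) : Prop :=
  ∀ l : Fin n, mem (a, r, l) = v l

/-- Both products with the vector in row `r` of array `a`. -/
theorem exec_query {inp : Input} {a : Arr} {r : IExp} {env : Idx → ℕ} {σ : State}
    (haP : a ≠ .P) {z : Fin inp.n → ℂ} (hz : HoldsRow σ.mem a (r.eval inp env) z) :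
    let τ := (query a r).exec inp env σ
    HoldsRow τ.mem .P 0 (inp.A.mulVec z) ∧ HoldsRow τ.mem .Q 0 (inp.A.conjTranspose.mulVec z) ∧
      (∀ c : Cell, c.1 ≠ .P → c.1 ≠ .Q → τ.mem c = σ.mem c) ∧ τ.out = σ.out := by
  have hz1 : (fun l : Fin inp.n => σ.mem (a, r.eval inp env, l)) = z := funext hz
  -- The second product reads the source row after P has been overwritten, hence the condition a ≠
  -- P.
  have hz2 : ∀ v : Fin inp.n → ℂ,
      (fun l : Fin inp.n => writeRow σ.mem .P 0 v (a, r.eval inp env, l)) = z := by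
    intro v
    ext l
    rw [writeRow_of_ne _ _ (fun h => haP h.1), hz l]
  simp only [query, block, Prog.exec, IExp.eval, hz1, hz2]
  refine ⟨fun l => ?_, fun l => writeRow_same _ _ _ _ _, fun c hP hQ => ?_, trivial⟩
  · rw [writeRow_of_ne _ _ (fun h => by simp at h), writeRow_same]
  · rw [writeRow_of_ne _ _ (fun h => hQ h.1), writeRow_of_ne _ _ (fun h => hP h.1)]

/-- The scalar expression `entry` reads off the entries of `B z` from those of `A z` and `A* z`. -/
def ReadsOff (inp : Input) (entry : SExp) (B : (Fin inp.n → ℂ) → Fin inp.n → ℂ) : Prop :=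
  ∀ (z : Fin inp.n → ℂ) (mem : Cell → ℂ) (env : Idx → ℕ) (l : Fin inp.n), env .i = l →
    HoldsRow mem .P 0 (inp.A.mulVec z) → HoldsRow mem .Q 0 (inp.A.conjTranspose.mulVec z) →
    entry.eval inp env mem = B z l

theorem readsOff_entryH (inp : Input) : ReadsOff inp entryH fun z l =>
    (inp.A.mulVec z l + inp.A.conjTranspose.mulVec z l) / (2 * inp.s) := by
  intro z mem env l hl hP hQ
  simp only [entryH, SExp.eval, IExp.eval, num, iv, hl, hP l, hQ l]
  norm_num

theorem readsOff_entryK (inp : Input) : ReadsOff inp entryK fun z l =>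
    (inp.A.mulVec z l - inp.A.conjTranspose.mulVec z l) / (2 * Complex.I * inp.s) := by
  intro z mem env l hl hP hQ
  simp only [entryK, SExp.eval, IExp.eval, num, iv, hl, hP l, hQ l]
  norm_num

/-- A query followed by a loop that fills a row. -/
theorem exec_query_loop {inp : Input} {a : Arr} {r r₂ : IExp} {ex : SExp} {env : Idx → ℕ}
    {σ : State} {r' : ℕ} (haP : a ≠ .P) (haQ : a ≠ .Q) {z : Fin inp.n → ℂ}
    (hz : HoldsRow σ.mem a (r.eval inp env) z)
    (hr : ∀ v, r₂.eval inp (Function.update env .i v) = r') (val : Fin inp.n → ℂ)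
    (hval : ∀ (l : Fin inp.n) (mem : Cell → ℂ), HoldsRow mem .P 0 (inp.A.mulVec z) →
      HoldsRow mem .Q 0 (inp.A.conjTranspose.mulVec z) →
      (∀ c : Cell, c.1 ≠ .P → c.1 ≠ .Q → ¬ (c.1 = a ∧ c.2.1 = r') → mem c = σ.mem c) →
      ex.eval inp (Function.update env .i l) mem = val l) :
    let τ := (Prog.loop .i .dimN (.assign a r₂ iv ex)).exec inp env ((query a r).exec inp env σ)
    HoldsRow τ.mem a r' val ∧
      (∀ c : Cell, c.1 ≠ .P → c.1 ≠ .Q → ¬ (c.1 = a ∧ c.2.1 = r') → τ.mem c = σ.mem c) ∧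
      τ.out = σ.out := by
  obtain ⟨h1, h2, h3, h4⟩ := exec_query (env := env) (σ := σ) haP hz
  obtain ⟨k1, k2, k3⟩ := exec_loop_assign (x := .i) (e := .dimN) (a := a) (ex := ex)
    (σ := (query a r).exec inp env σ) (fun v => if h : v < inp.n then val ⟨v, h⟩ else 0) hr (by
      intro v hv mem hmem
      have hv' : v < inp.n := hv
      rw [dif_pos hv']
      refine hval ⟨v, hv'⟩ mem (fun l => ?_) (fun l => ?_) fun c hP hQ hc => ?_
      · rw [hmem _ (fun h => haP h.1.symm), h1 l]
      · rw [hmem _ (fun h => haQ h.1.symm), h2 l]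
      · rw [hmem c fun h => hc ⟨h.1, h.2.1⟩, h3 c hP hQ])
  refine ⟨fun l => ?_, fun c hP hQ hc => ?_, k3.trans h4⟩
  · exact (k1 l l.2).trans (dif_pos l.2)
  · rw [← h3 c hP hQ]
    exact k2 c fun h => hc ⟨h.1, h.2.1⟩

/-- The three-term recurrence started from `b / √π`. -/
structure IsChebSeq {n : ℕ} (b : Fin n → ℂ) (B : (Fin n → ℂ) → Fin n → ℂ)
    (xv : ℕ → Fin n → ℂ) : Prop where
  zero : ∀ l, xv 0 l = b l / (√Real.pi : ℝ)
  one : ∀ l, xv 1 l = (√2 : ℝ) * B (xv 0) l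
  two : ∀ l, xv 2 l = 2 * B (xv 1) l - (√2 : ℝ) * xv 0 l
  step : ∀ j l, xv (j + 3) l = 2 * B (xv (j + 2)) l - xv (j + 1) l

theorem exec_recurrenceStart {inp : Input} {a : Arr} {entry : SExp}
    {B : (Fin inp.n → ℂ) → Fin inp.n → ℂ} {xv : ℕ → Fin inp.n → ℂ} {env : Idx → ℕ} {σ : State}
    (haP : a ≠ .P) (haQ : a ≠ .Q) (hab : a ≠ .b) (hentry : ReadsOff inp entry B)
    (hx : IsChebSeq inp.b B xv) (hb : HoldsRow σ.mem .b 0 inp.b) :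
    let τ := (recurrenceStart a entry).exec inp env σ
    (∀ j ≤ 2, HoldsRow τ.mem a j (xv j)) ∧
      (∀ c : Cell, c.1 ≠ .P → c.1 ≠ .Q → c.1 ≠ a → τ.mem c = σ.mem c) ∧ τ.out = σ.out := by
  obtain ⟨k1, k2, k3⟩ := exec_loop_assign (inp := inp) (x := .i) (e := .dimN) (a := a)
    (r := .lit 0) (r' := 0) (env := env)
    (ex := .div (.cell .b (.lit 0) iv) (.sqrt .pi)) (σ := σ)
    (fun v => if h : v < inp.n then xv 0 ⟨v, h⟩ else 0) (fun _ => rfl) (by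
      intro v hv mem hmem
      have hv' : v < inp.n := hv
      rw [dif_pos hv', hx.zero, ← hb ⟨v, hv'⟩, ← hmem _ (fun h => hab h.1.symm)]
      simp [SExp.eval, IExp.eval, iv])
  set σ₁ := (Prog.loop .i .dimN
    (.assign a (.lit 0) iv (.div (.cell .b (.lit 0) iv) (.sqrt .pi)))).exec inp env σ with hσ₁
  have h0 : HoldsRow σ₁.mem a 0 (xv 0) := fun l =>
    (k1 l l.2).trans (dif_pos l.2)
  obtain ⟨p1, p2, p3⟩ := exec_query_loop (env := env) (σ := σ₁) (a := a) (r := .lit 0)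
    (r₂ := .lit 1) (r' := 1) (ex := .mul (.sqrt (num 2)) entry) haP haQ h0 (fun _ => rfl) (xv 1) (by
      intro l mem hP hQ hmem
      rw [hx.one, SExp.eval, hentry (xv 0) mem _ l (by simp) hP hQ]
      simp [SExp.eval, IExp.eval, num])
  set σ₂ := (Prog.loop .i .dimN (.assign a (.lit 1) iv (.mul (.sqrt (num 2)) entry))).exec inp env
    ((query a (.lit 0)).exec inp env σ₁) with hσ₂
  have h02 : HoldsRow σ₂.mem a 0 (xv 0) := fun l => by
    rw [← h0 l]
    exact p2 _ haP haQ (by simp)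
  obtain ⟨q1, q2, q3⟩ := exec_query_loop (env := env) (σ := σ₂) (a := a) (r := .lit 1)
    (r₂ := .lit 2) (r' := 2) (ex := .sub (.mul (num 2) entry)
      (.mul (.sqrt (num 2)) (.cell a (.lit 0) iv))) haP haQ p1 (fun _ => rfl) (xv 2) (by
      intro l mem hP hQ hmem
      rw [hx.two, SExp.eval, SExp.eval, hentry (xv 1) mem _ l (by simp) hP hQ, ← h02 l,
        ← hmem _ haP haQ (by simp)]
      simp [SExp.eval, IExp.eval, num, iv])
  refine ⟨fun j hj => ?_, fun c hP hQ hc => ?_, q3.trans (p3.trans k3)⟩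
  · interval_cases j
    · intro l
      rw [← h02 l]
      exact q2 _ haP haQ (by simp)
    · intro l
      rw [← p1 l]
      exact q2 _ haP haQ (by simp)
    · exact q1
  · exact (q2 c hP hQ fun h => hc h.1).trans ((p2 c hP hQ fun h => hc h.1).trans
      (k2 c fun h => hc h.1))

theorem exec_recurrenceStep {inp : Input} {a : Arr} {entry : SExp}
    {B : (Fin inp.n → ℂ) → Fin inp.n → ℂ} {xv : ℕ → Fin inp.n → ℂ} {env : Idx → ℕ} {σ : State}
    {b : Fin inp.n → ℂ} (haP : a ≠ .P) (haQ : a ≠ .Q) (hentry : ReadsOff inp entry B)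
    (hx : IsChebSeq b B xv) (h : ∀ j ≤ env .j + 2, HoldsRow σ.mem a j (xv j)) :
    let τ := (recurrenceStep a entry).exec inp env σ
    (∀ j ≤ env .j + 3, HoldsRow τ.mem a j (xv j)) ∧
      (∀ c : Cell, c.1 ≠ .P → c.1 ≠ .Q → c.1 ≠ a → τ.mem c = σ.mem c) ∧ τ.out = σ.out := by
  obtain ⟨q1, q2, q3⟩ := exec_query_loop (env := env) (σ := σ) (a := a) (r := .add jv (.lit 2))
    (r₂ := .add jv (.lit 3)) (r' := env .j + 3) (ex := .sub (.mul (num 2) entry)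
      (.cell a (.add jv (.lit 1)) iv)) haP haQ (h (env .j + 2) le_rfl)
    (fun _ => by simp [IExp.eval, jv]) (xv (env .j + 3)) (by
      intro l mem hP hQ hmem
      simp only [SExp.eval]
      rw [hx.step, hentry (xv (env .j + 2)) mem _ l (by simp) hP hQ,
        ← h (env .j + 1) (by omega) l, ← hmem _ haP haQ (by simp)]
      simp [SExp.eval, IExp.eval, num, iv, jv])
  refine ⟨fun j hj => ?_, fun c hP hQ hc => q2 c hP hQ fun h => hc h.1, q3⟩
  rcases Nat.lt_or_ge j (env .j + 3) with hlt | hge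
  · intro l
    rw [← h j (by omega) l]
    exact q2 _ haP haQ fun h => by simp at h; omega
  · rw [show j = env .j + 3 by omega]
    exact q1

/-- The memory holds the Chebyshev vectors. -/
theorem exec_chebVectors {inp : Input} {B B' : (Fin inp.n → ℂ) → Fin inp.n → ℂ}
    {xv yv : ℕ → Fin inp.n → ℂ} {env : Idx → ℕ} {σ : State} (hB : ReadsOff inp entryH B)
    (hB' : ReadsOff inp entryK B') (hx : IsChebSeq inp.b B xv) (hy : IsChebSeq inp.b B' yv)
    (hb : HoldsRow σ.mem .b 0 inp.b) :
    let τ := chebVectors.exec inp env σ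
    (∀ j ≤ inp.m, HoldsRow τ.mem .X j (xv j)) ∧ (∀ j ≤ inp.m, HoldsRow τ.mem .Y j (yv j)) ∧
      τ.out = σ.out := by
  obtain ⟨x1, x2, x3⟩ := exec_recurrenceStart (env := env) (σ := σ) (a := .X) (by simp) (by simp)
    (by simp) hB hx hb
  set σ₁ := (recurrenceStart .X entryH).exec inp env σ
  have hb₁ : HoldsRow σ₁.mem .b 0 inp.b := fun l => by
    rw [← hb l]
    exact x2 _ (by simp) (by simp) (by simp)
  obtain ⟨y1, y2, y3⟩ := exec_recurrenceStart (env := env) (σ := σ₁) (a := .Y) (by simp) (by simp)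
    (by simp) hB' hy hb₁
  set σ₂ := (recurrenceStart .Y entryK).exec inp env σ₁
  have hloop := Prog.exec_loop_invariant (inp := inp) (x := .j) (e := .sub .degM (.lit 2))
    (body := block [recurrenceStep .X entryH, recurrenceStep .Y entryK]) (env := env) (σ := σ₂)
    (fun v mem out => (∀ j ≤ v + 2, HoldsRow mem .X j (xv j)) ∧
      (∀ j ≤ v + 2, HoldsRow mem .Y j (yv j)) ∧ out = σ₂.out)
    ⟨fun j hj l => (y2 _ (by simp) (by simp) (by simp)).trans (x1 j hj l), y1, rfl⟩ (by
      rintro v _ τ ⟨i1, i2, i3⟩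
      obtain ⟨s1, s2, s3⟩ := exec_recurrenceStep (env := Function.update env .j v) (σ := τ)
        (a := .X) (by simp) (by simp) hB hx (by simpa using i1)
      set τ₁ := (recurrenceStep .X entryH).exec inp (Function.update env .j v) τ
      obtain ⟨t1, t2, t3⟩ := exec_recurrenceStep (env := Function.update env .j v) (σ := τ₁)
        (a := .Y) (by simp) (by simp) hB' hy (by
          intro j hj l
          rw [← i2 j (by simpa using hj) l]
          exact s2 _ (by simp) (by simp) (by simp))
      simp only [Function.update_self] at s1 t1
      refine ⟨fun j hj l => ?_, t1, t3.trans (s3.trans i3)⟩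
      rw [← s1 j hj l]
      exact t2 _ (by simp) (by simp) (by simp))
  simp only [IExp.eval] at hloop
  -- Truncated subtraction is harmless: m - 2 + 2 ≥ m always, and for m = 1 the rows up to 2 come
  -- from the start phase.
  exact ⟨fun j hj => hloop.1 j (by omega), fun j hj => hloop.2.1 j (by omega),
    hloop.2.2.trans (y3.trans x3)⟩

end SpecDens

/-! ### Outputs of the two programs. -/

namespace SpecDens

theorem exec_damping {inp : Input} {env : Idx → ℕ} {σ : State} :
    let τ := damping.exec inp env σ
    (∀ j ≤ inp.m, τ.mem (.rho, 0, j) = (jacksonCoeff inp.m j : ℂ)) ∧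
      (∀ c : Cell, c.1 ≠ .rho → τ.mem c = σ.mem c) ∧ τ.out = σ.out := by
  obtain ⟨k1, k2, k3⟩ := exec_loop_assign (inp := inp) (x := .j) (e := degs) (a := .rho)
    (r := .lit 0) (r' := 0) (env := env)
    (ex := .div
      (.add
        (.mul (.ofInt (.sub (.add .degM (.lit 2)) jv)) (.cos (angle jv (.add .degM (.lit 2)))))
        (.mul (.sin (angle jv (.add .degM (.lit 2))))
          (.div (.cos (angle (.lit 1) (.add .degM (.lit 2))))
            (.sin (angle (.lit 1) (.add .degM (.lit 2)))))))
      (.ofInt (.add .degM (.lit 2)))) (σ := σ)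
    (fun j => (jacksonCoeff inp.m j : ℂ)) (fun _ => rfl) (by
      intro v hv mem _
      have hv' : v ≤ inp.m + 2 := by
        simp only [degs, IExp.eval] at hv
        omega
      simp only [SExp.eval, IExp.eval, angle, jv, Function.update_self, jacksonCoeff,
        Nat.cast_sub hv']
      push_cast
      norm_num)
  refine ⟨fun j hj => k1 j ?_, fun c hc => k2 c fun h => hc h.1, k3⟩
  simp only [degs, IExp.eval]
  omega

theorem exec_innerProd {inp : Input} {a a' : Arr} (ha : a ≠ .acc) (ha' : a' ≠ .acc)
    {env : Idx → ℕ} {σ : State} {v w : Fin inp.n → ℂ} (hv : HoldsRow σ.mem a (env .j) v)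
    (hw : HoldsRow σ.mem a' (env .k) w) :
    let τ := (innerProd a a').exec inp env σ
    τ.mem (.acc, 0, 0) = ∑ i, star (v i) * w i ∧
      (∀ c : Cell, c.1 ≠ .acc → τ.mem c = σ.mem c) ∧ τ.out = σ.out := by
  have hloop := Prog.exec_loop_invariant (inp := inp) (x := .i) (e := .dimN)
    (body := .assign .acc (.lit 0) (.lit 0) (.add (.cell .acc (.lit 0) (.lit 0))
        (.mul (.conj (.cell a jv iv)) (.cell a' kv iv)))) (env := env)
    (σ := (Prog.assign .acc (.lit 0) (.lit 0) (num 0)).exec inp env σ)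
    (fun i mem out => mem (.acc, 0, 0) =
        ∑ l ∈ Finset.range i, star (σ.mem (a, env .j, l)) * σ.mem (a', env .k, l) ∧
      (∀ c : Cell, c.1 ≠ .acc → mem c = σ.mem c) ∧ out = σ.out)
    ⟨by simp [Prog.exec, IExp.eval, SExp.eval, num], fun c hc => by
      simp only [Prog.exec]
      exact Function.update_of_ne (fun h => hc (by rw [h])) _ _, rfl⟩ (by
      rintro i _ τ ⟨h1, h2, h3⟩
      refine ⟨?_, fun c hc => ?_, h3⟩
      · simp only [Prog.exec, IExp.eval, SExp.eval, jv, kv, iv, Function.update_self]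
        rw [h1, Finset.sum_range_succ, h2 _ (by simpa using ha), h2 _ (by simpa using ha')]
        simp
      · simp only [Prog.exec]
        rw [Function.update_of_ne (fun h => hc (by rw [h])), h2 c hc])
  refine ⟨hloop.1.trans ?_, hloop.2.1, hloop.2.2⟩
  rw [show IExp.dimN.eval inp env = inp.n from rfl, Finset.sum_range]
  exact Finset.sum_congr rfl fun l _ => by rw [hv l, hw l]

/-- The output of two nested loops. -/
theorem exec_double_loop_out {inp : Input} {body : Prog} {env : Idx → ℕ} {σ : State}
    (I : (Cell → ℂ) → Prop) (L : ℕ → ℕ → List ℂ) (h0 : I σ.mem)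
    (hbody : ∀ (env' : Idx → ℕ) (τ : State), env' .j ≤ inp.m → env' .k ≤ inp.m → I τ.mem →
      I (body.exec inp env' τ).mem ∧
        (body.exec inp env' τ).out = τ.out ++ L (env' .j) (env' .k)) :
    ((Prog.loop .j degs (.loop .k degs body)).exec inp env σ).out = σ.out ++
      (List.range (inp.m + 1)).flatMap fun j => (List.range (inp.m + 1)).flatMap (L j) := by
  refine (Prog.exec_loop_invariant (fun v mem out => I mem ∧ out = σ.out ++
    (List.range v).flatMap fun j => (List.range (inp.m + 1)).flatMap (L j)) ⟨h0, by simp⟩ ?_).2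
  rintro v hv τ ⟨h1, h2⟩
  have hin := Prog.exec_loop_invariant (inp := inp) (x := .k) (e := degs) (body := body)
    (env := Function.update env .j v) (σ := τ)
    (fun w mem out => I mem ∧ out = τ.out ++ (List.range w).flatMap (L v)) ⟨h1, by simp⟩ (by
      rintro w hw ρ ⟨h3, h4⟩
      simp only [degs, IExp.eval] at hv hw
      obtain ⟨h5, h6⟩ := hbody (Function.update (Function.update env .j v) .k w) ρ
        (by simp; omega) (by simp; omega) h3
      refine ⟨h5, h6.trans ?_⟩
      rw [h4, List.range_succ, List.flatMap_append]
      simp)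
  refine ⟨hin.1, hin.2.trans ?_⟩
  rw [h2, List.range_succ (n := v), List.flatMap_append]
  simp [degs, IExp.eval]

theorem exec_sample {inp : Input} {env : Idx → ℕ} {σ : State} :
    HoldsRow ((Prog.sample .b (.lit 0)).exec inp env σ).mem .b 0 inp.b :=
  fun l => writeRow_same _ _ _ _ l

section

variable {inp : Input} {B B' : (Fin inp.n → ℂ) → Fin inp.n → ℂ} {xv yv : ℕ → Fin inp.n → ℂ}

theorem specDens_out (hB : ReadsOff inp entryH B) (hB' : ReadsOff inp entryK B')
    (hx : IsChebSeq inp.b B xv) (hy : IsChebSeq inp.b B' yv) :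
    (specDens.run inp).out =
      (List.range (inp.m + 1)).flatMap fun j => (List.range (inp.m + 1)).flatMap fun k =>
        [(jacksonCoeff inp.m j : ℂ) * jacksonCoeff inp.m k * ∑ i, star (xv j i) * yv k i] := by
  rw [Prog.run]
  set env : Idx → ℕ := fun _ => 0
  set σ₁ := (Prog.sample .b (.lit 0)).exec inp env State.init with hσ₁
  obtain ⟨c1, c2, c3⟩ := exec_chebVectors (env := env) (σ := σ₁) hB hB' hx hy exec_sample
  set σ₂ := chebVectors.exec inp env σ₁
  obtain ⟨d1, d2, d3⟩ := exec_damping (inp := inp) (env := env) (σ := σ₂)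
  set σ₃ := damping.exec inp env σ₂
  have hout := exec_double_loop_out (inp := inp) (env := env) (σ := σ₃)
    (body := block [innerProd .X .Y,
      .output (.mul (.mul (.cell .rho (.lit 0) jv) (.cell .rho (.lit 0) kv))
        (.cell .acc (.lit 0) (.lit 0)))])
    (fun mem => ∀ c : Cell, c.1 ≠ .acc → mem c = σ₃.mem c)
    (fun j k => [(jacksonCoeff inp.m j : ℂ) * jacksonCoeff inp.m k * ∑ i, star (xv j i) * yv k i])
    (fun _ _ => rfl) (by
      intro env' τ hj hk hτ
      obtain ⟨i1, i2, i3⟩ := exec_innerProd (env := env') (σ := τ) (a := .X) (a' := .Y)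
        (v := xv (env' .j)) (w := yv (env' .k)) (by simp) (by simp)
        (fun l => by rw [hτ _ (by simp), d2 _ (by simp), c1 _ hj])
        (fun l => by rw [hτ _ (by simp), d2 _ (by simp), c2 _ hk])
      refine ⟨fun c hc => (i2 c hc).trans (hτ c hc), ?_⟩
      simp only [block, Prog.exec, SExp.eval, IExp.eval, jv, kv, i1, i3]
      rw [i2 _ (by simp), hτ _ (by simp), d1 _ hj, i2 _ (by simp), hτ _ (by simp), d1 _ hk])
  have hinit : σ₃.out = [] := d3.trans (c3.trans rfl)
  rw [hinit, List.nil_append] at hout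
  exact hout

theorem exec_normalizers {env : Idx → ℕ} {σ : State} :
    let τ := normalizers.exec inp env σ
    (∀ j ≤ inp.m, τ.mem (.nrm, 0, j) =
      ((if j = 0 then √(1 / Real.pi) else √(2 / Real.pi) : ℝ) : ℂ)) ∧
      (∀ c : Cell, c.1 ≠ .nrm → τ.mem c = σ.mem c) ∧ τ.out = σ.out := by
  -- The square root of the machine acts on the real part of its argument.
  have hre : ∀ k : ℕ, ((k : ℂ) / (Real.pi : ℂ)).re = k / Real.pi := fun k => by
    rw [show (k : ℂ) / (Real.pi : ℂ) = ((k / Real.pi : ℝ) : ℂ) by push_cast; rfl, Complex.ofReal_re]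
  obtain ⟨k1, k2, k3⟩ := exec_loop_assign (inp := inp) (x := .j) (e := degs) (a := .nrm)
    (r := .lit 0) (r' := 0) (env := env) (ex := .sqrt (.div (num 2) .pi)) (σ := σ)
    (fun _ => ((√(2 / Real.pi) : ℝ) : ℂ)) (fun _ => rfl) (by
      intro v hv mem _
      simp only [SExp.eval, IExp.eval, num, hre]
      norm_num)
  set σ₁ := (Prog.loop .j degs (.assign .nrm (.lit 0) jv (.sqrt (.div (num 2) .pi)))).exec inp env σ
    with hσ₁
  have hmem : (normalizers.exec inp env σ).mem =
      Function.update σ₁.mem (.nrm, 0, 0) ((√(1 / Real.pi) : ℝ) : ℂ) := by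
    have h : (normalizers.exec inp env σ).mem = Function.update σ₁.mem (.nrm, 0, 0)
        ((√(((1 : ℕ) : ℂ) / (Real.pi : ℂ)).re : ℝ) : ℂ) := rfl
    rw [h, hre, Nat.cast_one]
  refine ⟨fun j hj => ?_, fun c hc => ?_, k3⟩
  · rw [hmem]
    split_ifs with h
    · rw [h, Function.update_self]
    · rw [Function.update_of_ne (by simpa using h)]
      refine k1 j ?_
      simp only [degs, IExp.eval]
      omega
  · rw [hmem, Function.update_of_ne (fun h => hc (by rw [h]))]
    exact k2 c fun h => hc h.1

/-- A loop that fills one row of `U` and one row of `V`. -/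
theorem exec_loop_assign_pair {ex ex' : SExp} {env : Idx → ℕ} {σ : State} (val val' : ℕ → ℂ)
    (hval : ∀ v < inp.n, ∀ mem : Cell → ℂ,
      (∀ c : Cell, ¬ ((c.1 = .U ∨ c.1 = .V) ∧ c.2.1 = env .k ∧ c.2.2 < v) → mem c = σ.mem c) →
      ex.eval inp (Function.update env .i v) mem = val v)
    (hval' : ∀ v < inp.n, ∀ mem : Cell → ℂ,
      (∀ c : Cell, c.1 ≠ .U → ¬ (c.1 = .V ∧ c.2.1 = env .k ∧ c.2.2 < v) → mem c = σ.mem c) →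
      ex'.eval inp (Function.update env .i v) mem = val' v) :
    let τ := (Prog.loop .i .dimN (block [.assign .U kv iv ex, .assign .V kv iv ex'])).exec inp env σ
    (∀ v < inp.n, τ.mem (.U, env .k, v) = val v) ∧ (∀ v < inp.n, τ.mem (.V, env .k, v) = val' v) ∧
      (∀ c : Cell, ¬ ((c.1 = .U ∨ c.1 = .V) ∧ c.2.1 = env .k) → τ.mem c = σ.mem c) ∧
      τ.out = σ.out := by
  have key := Prog.exec_loop_invariant (inp := inp) (x := .i) (e := .dimN) (env := env) (σ := σ)
    (body := block [.assign .U kv iv ex, .assign .V kv iv ex'])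
    (fun v mem out => (∀ w < v, mem (.U, env .k, w) = val w) ∧
      (∀ w < v, mem (.V, env .k, w) = val' w) ∧
      (∀ c : Cell, ¬ ((c.1 = .U ∨ c.1 = .V) ∧ c.2.1 = env .k ∧ c.2.2 < v) → mem c = σ.mem c) ∧
      out = σ.out) ⟨by simp, by simp, by simp, rfl⟩ (by
      rintro v hv τ ⟨h1, h2, h3, h4⟩
      have hU : ex.eval inp (Function.update env .i v) τ.mem = val v := hval v hv τ.mem h3
      have hV : ex'.eval inp (Function.update env .i v)
          (Function.update τ.mem (.U, env .k, v) (val v)) = val' v := by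
        -- The second assignment runs after the current cell of U has changed, so its value may
        -- depend on no cell of U; this is the asymmetry between `hval` and `hval'`.
        refine hval' v hv _ fun c hc1 hc2 => ?_
        rw [Function.update_of_ne (fun h => hc1 (by rw [h])), h3 c]
        rintro ⟨h | h, h'⟩
        · exact hc1 h
        · exact hc2 ⟨h, h'⟩
      have hk : Function.update env .i v .k = env .k := by simp
      simp only [block, Prog.exec, kv, iv, IExp.eval, Function.update_self, hU, hk, hV]
      refine ⟨fun w hw => ?_, fun w hw => ?_, fun c hc => ?_, h4⟩
      · rw [Function.update_of_ne (by simp)]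
        rcases Nat.lt_succ_iff_lt_or_eq.mp hw with hw | rfl
        · rw [Function.update_of_ne (by simp; omega), h1 w hw]
        · rw [Function.update_self]
      · rcases Nat.lt_succ_iff_lt_or_eq.mp hw with hw | rfl
        · rw [Function.update_of_ne (by simp; omega), Function.update_of_ne (by simp), h2 w hw]
        · rw [Function.update_self]
      · rw [Function.update_of_ne, Function.update_of_ne, h3]
        · exact fun h => hc ⟨h.1, h.2.1, by omega⟩
        · rintro rfl
          exact hc ⟨Or.inl rfl, rfl, Nat.lt_succ_self v⟩
        · rintro rfl
          exact hc ⟨Or.inr rfl, rfl, Nat.lt_succ_self v⟩)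
  exact ⟨key.1, key.2.1, fun c hc => key.2.2.1 c fun h => hc ⟨h.1, h.2.1⟩, key.2.2.2⟩

theorem eval_nodeAngle (env : Idx → ℕ) (mem : Cell → ℂ) (x : Idx) :
    (nodeAngle (.var x)).eval inp env mem = (gaussAngle inp.m (env x) : ℂ) := by
  simp only [nodeAngle, SExp.eval, IExp.eval, degs, gaussAngle]
  push_cast
  rfl

/-- The contribution of the `j`-th Chebyshev vector to the `k`-th node vector. -/
noncomputable def nodeFactor (m j k : ℕ) : ℂ :=
  ((jacksonCoeff m j * chebT j (gaussNode m k) : ℝ) : ℂ)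

theorem exec_nodeVectors {env : Idx → ℕ} {σ : State}
    (hX : ∀ j ≤ inp.m, HoldsRow σ.mem .X j (xv j)) (hY : ∀ j ≤ inp.m, HoldsRow σ.mem .Y j (yv j))
    (hρ : ∀ j ≤ inp.m, σ.mem (.rho, 0, j) = (jacksonCoeff inp.m j : ℂ))
    (hnrm : ∀ j ≤ inp.m, σ.mem (.nrm, 0, j) =
      ((if j = 0 then √(1 / Real.pi) else √(2 / Real.pi) : ℝ) : ℂ)) :
    let τ := nodeVectors.exec inp env σ
    (∀ k ≤ inp.m, HoldsRow τ.mem .U k fun i =>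
        ∑ j ∈ Finset.range (inp.m + 1), nodeFactor inp.m j k * xv j i) ∧
      (∀ k ≤ inp.m, HoldsRow τ.mem .V k fun i =>
        ∑ j ∈ Finset.range (inp.m + 1), nodeFactor inp.m j k * yv j i) ∧
      τ.out = σ.out := by
  have houter := Prog.exec_loop_invariant (inp := inp) (x := .k) (e := degs) (env := env) (σ := σ)
    (body := block [
      .loop .i .dimN (block [.assign .U kv iv (num 0), .assign .V kv iv (num 0)]),
      .loop .j degs (block [
        .assign .t (.lit 0) (.lit 0)
          (.mul (.mul (.cell .rho (.lit 0) jv) (.cell .nrm (.lit 0) jv))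
            (.cos (.mul (.ofInt jv) (nodeAngle kv)))),
        .loop .i .dimN (block [
          .assign .U kv iv
            (.add (.cell .U kv iv) (.mul (.cell .t (.lit 0) (.lit 0)) (.cell .X jv iv))),
          .assign .V kv iv
            (.add (.cell .V kv iv) (.mul (.cell .t (.lit 0) (.lit 0)) (.cell .Y jv iv)))])])])
    (fun v mem out =>
      (∀ k < v, HoldsRow mem .U k fun i =>
        ∑ j ∈ Finset.range (inp.m + 1), nodeFactor inp.m j k * xv j i) ∧
      (∀ k < v, HoldsRow mem .V k fun i =>
        ∑ j ∈ Finset.range (inp.m + 1), nodeFactor inp.m j k * yv j i) ∧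
      (∀ c : Cell, c.1 ≠ .U → c.1 ≠ .V → c.1 ≠ .t → mem c = σ.mem c) ∧ out = σ.out)
    ⟨by simp, by simp, fun _ _ _ _ => rfl, rfl⟩ (by
      rintro v hv τ ⟨h1, h2, h3, h4⟩
      set env₁ := Function.update env .k v with henv₁
      have hk₁ : env₁ .k = v := by simp [henv₁]
      obtain ⟨z1, z2, z3, z4⟩ := exec_loop_assign_pair (inp := inp) (env := env₁) (σ := τ)
        (ex := num 0) (ex' := num 0) (fun _ => 0) (fun _ => 0)
        (by intros; simp [num, SExp.eval, IExp.eval]) (by intros; simp [num, SExp.eval, IExp.eval])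
      set τ₁ := (Prog.loop .i .dimN
        (block [.assign .U kv iv (num 0), .assign .V kv iv (num 0)])).exec inp env₁ τ with hτ₁
      rw [hk₁] at z1 z2 z3
      have hmid := Prog.exec_loop_invariant (inp := inp) (x := .j) (e := degs) (env := env₁)
        (σ := τ₁) (body := block [
          .assign .t (.lit 0) (.lit 0)
            (.mul (.mul (.cell .rho (.lit 0) jv) (.cell .nrm (.lit 0) jv))
              (.cos (.mul (.ofInt jv) (nodeAngle kv)))),
          .loop .i .dimN (block [
            .assign .U kv iv
              (.add (.cell .U kv iv) (.mul (.cell .t (.lit 0) (.lit 0)) (.cell .X jv iv))),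
            .assign .V kv iv
              (.add (.cell .V kv iv) (.mul (.cell .t (.lit 0) (.lit 0)) (.cell .Y jv iv)))])])
        -- After w passes row v of U and V holds the partial sums over j < w; everything else except
        -- the scratch cell is as before the node was started.
        (fun w mem out =>
          (∀ i : Fin inp.n, mem (.U, v, i) =
            ∑ j ∈ Finset.range w, nodeFactor inp.m j v * xv j i) ∧
          (∀ i : Fin inp.n, mem (.V, v, i) =
            ∑ j ∈ Finset.range w, nodeFactor inp.m j v * yv j i) ∧
          (∀ c : Cell, ¬ ((c.1 = .U ∨ c.1 = .V) ∧ c.2.1 = v) → c.1 ≠ .t → mem c = τ.mem c) ∧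
          out = τ.out)
        ⟨fun i => by simpa using z1 i i.2, fun i => by simpa using z2 i i.2,
          fun c hc _ => z3 c hc, z4⟩ (by
        rintro w hw ρ ⟨r1, r2, r3, r4⟩
        have hwm : w ≤ inp.m := by
          simp only [degs, IExp.eval] at hw
          omega
        set env₂ := Function.update env₁ .j w with henv₂
        have hk₂ : env₂ .k = v := by simp [henv₂, hk₁]
        have hj₂ : env₂ .j = w := by simp [henv₂]
        have hread : ∀ c : Cell, c.1 ≠ .U → c.1 ≠ .V → c.1 ≠ .t → ρ.mem c = σ.mem c := by
          intro c hU hV ht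
          rw [r3 c (fun h => h.1.elim hU hV) ht, h3 c hU hV ht]
        set ρ₁ := (Prog.assign .t (.lit 0) (.lit 0)
            (.mul (.mul (.cell .rho (.lit 0) jv) (.cell .nrm (.lit 0) jv))
              (.cos (.mul (.ofInt jv) (nodeAngle kv))))).exec inp env₂ ρ with hρ₁
        have hρmem : ρ₁.mem = Function.update ρ.mem (.t, 0, 0) (nodeFactor inp.m w v) := by
          simp only [hρ₁, Prog.exec, SExp.eval, IExp.eval, jv, kv, eval_nodeAngle, hk₂, hj₂]
          rw [hread _ (by simp) (by simp) (by simp), hread _ (by simp) (by simp) (by simp),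
            hρ w hwm, hnrm w hwm, nodeFactor, gaussNode, chebT_cos]
          congr 1
          push_cast
          ring
        have ht : ρ₁.mem (.t, 0, 0) = nodeFactor inp.m w v := by
          rw [hρmem, Function.update_self]
        have hne : ∀ c : Cell, c.1 ≠ .t → ρ₁.mem c = ρ.mem c := fun c hc => by
          rw [hρmem, Function.update_of_ne (fun h => hc (by rw [h]))]
        obtain ⟨p1, p2, p3, p4⟩ := exec_loop_assign_pair (inp := inp) (env := env₂) (σ := ρ₁)
          (ex := .add (.cell .U kv iv) (.mul (.cell .t (.lit 0) (.lit 0)) (.cell .X jv iv)))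
          (ex' := .add (.cell .V kv iv) (.mul (.cell .t (.lit 0) (.lit 0)) (.cell .Y jv iv)))
          (fun i => ρ.mem (.U, v, i) + nodeFactor inp.m w v * σ.mem (.X, w, i))
          (fun i => ρ.mem (.V, v, i) + nodeFactor inp.m w v * σ.mem (.Y, w, i))
          (by
            intro i hi mem hmem
            have e1 : Function.update env₂ .i i .k = v := by simp [hk₂]
            have e2 : Function.update env₂ .i i .j = w := by simp [hj₂]
            simp only [SExp.eval, IExp.eval, kv, iv, jv, e1, e2, Function.update_self]
            rw [hmem _ (by simp), hmem _ (by simp), ht, hmem _ (by simp), hne _ (by simp),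
              hne _ (by simp), hread (.X, w, i) (by simp) (by simp) (by simp)])
          (by
            intro i hi mem hmem
            have e1 : Function.update env₂ .i i .k = v := by simp [hk₂]
            have e2 : Function.update env₂ .i i .j = w := by simp [hj₂]
            simp only [SExp.eval, IExp.eval, kv, iv, jv, e1, e2, Function.update_self]
            rw [hmem _ (by simp) (by simp), hmem _ (by simp) (by simp), ht,
              hmem _ (by simp) (by simp), hne _ (by simp),
              hne _ (by simp), hread (.Y, w, i) (by simp) (by simp) (by simp)])
        rw [hk₂] at p1 p2 p3
        refine ⟨fun i => ?_, fun i => ?_, fun c hc hct => ?_, p4.trans r4⟩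
        · refine (p1 i i.2).trans ?_
          rw [r1 i, hX w hwm i, Finset.sum_range_succ]
        · refine (p2 i i.2).trans ?_
          rw [r2 i, hY w hwm i, Finset.sum_range_succ]
        · exact (p3 c hc).trans ((hne c hct).trans (r3 c hc hct)))
      obtain ⟨m1, m2, m3, m4⟩ := hmid
      refine ⟨fun k hk i => ?_, fun k hk i => ?_, fun c hU hV ht => ?_, m4.trans h4⟩
      · rcases Nat.lt_succ_iff_lt_or_eq.mp hk with hk | rfl
        · rw [← h1 k hk i]
          exact m3 _ (by simp; omega) (by simp)
        · exact m1 i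
      · rcases Nat.lt_succ_iff_lt_or_eq.mp hk with hk | rfl
        · rw [← h2 k hk i]
          exact m3 _ (by simp; omega) (by simp)
        · exact m2 i
      · rw [← h3 c hU hV ht]
        exact m3 c (fun h => h.1.elim hU hV) ht)
  have hd : degs.eval inp env = inp.m + 1 := rfl
  rw [hd] at houter
  exact ⟨fun k hk => houter.1 k (by omega), fun k hk => houter.2.1 k (by omega), houter.2.2.2⟩

theorem specDensAtomic_out (hB : ReadsOff inp entryH B) (hB' : ReadsOff inp entryK B')
    (hx : IsChebSeq inp.b B xv) (hy : IsChebSeq inp.b B' yv) :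
    (specDensAtomic.run inp).out =
      (List.range (inp.m + 1)).flatMap fun j => (List.range (inp.m + 1)).flatMap fun k =>
        [squarePoint inp.s (gaussNode inp.m j, gaussNode inp.m k),
          ((Real.pi / (inp.m + 1) * (Real.pi / (inp.m + 1)) : ℝ) : ℂ) *
            ∑ i, star (∑ a ∈ Finset.range (inp.m + 1), nodeFactor inp.m a j * xv a i) *
              ∑ c ∈ Finset.range (inp.m + 1), nodeFactor inp.m c k * yv c i] := by
  rw [Prog.run]
  set env : Idx → ℕ := fun _ => 0
  set σ₁ := (Prog.sample .b (.lit 0)).exec inp env State.init with hσ₁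
  obtain ⟨c1, c2, c3⟩ := exec_chebVectors (env := env) (σ := σ₁) hB hB' hx hy exec_sample
  set σ₂ := chebVectors.exec inp env σ₁
  obtain ⟨d1, d2, d3⟩ := exec_damping (inp := inp) (env := env) (σ := σ₂)
  set σ₃ := damping.exec inp env σ₂
  obtain ⟨e1, e2, e3⟩ := exec_normalizers (inp := inp) (env := env) (σ := σ₃)
  set σ₄ := normalizers.exec inp env σ₃
  obtain ⟨f1, f2, f3⟩ := exec_nodeVectors (inp := inp) (env := env) (σ := σ₄) (xv := xv) (yv := yv)
    (fun j hj l => by rw [e2 _ (by simp), d2 _ (by simp), c1 j hj l])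
    (fun j hj l => by rw [e2 _ (by simp), d2 _ (by simp), c2 j hj l])
    (fun j hj => by rw [e2 _ (by simp), d1 j hj]) e1
  set σ₅ := nodeVectors.exec inp env σ₄
  have hout := exec_double_loop_out (inp := inp) (env := env) (σ := σ₅)
    (body := block [
      innerProd .U .V,
      .output (.mul .scale (.add (.cos (nodeAngle jv)) (.mul .imagUnit (.cos (nodeAngle kv))))),
      .output (.mul
        (.mul (.div .pi (.ofInt degs)) (.div .pi (.ofInt degs)))
        (.cell .acc (.lit 0) (.lit 0)))])
    (fun mem => ∀ c : Cell, c.1 ≠ .acc → mem c = σ₅.mem c)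
    (fun j k => [squarePoint inp.s (gaussNode inp.m j, gaussNode inp.m k),
          ((Real.pi / (inp.m + 1) * (Real.pi / (inp.m + 1)) : ℝ) : ℂ) *
            ∑ i, star (∑ a ∈ Finset.range (inp.m + 1), nodeFactor inp.m a j * xv a i) *
              ∑ c ∈ Finset.range (inp.m + 1), nodeFactor inp.m c k * yv c i])
    (fun _ _ => rfl) (by
      intro env' τ hj hk hτ
      obtain ⟨i1, i2, i3⟩ := exec_innerProd (env := env') (σ := τ) (a := .U) (a' := .V)
        (v := fun i => ∑ a ∈ Finset.range (inp.m + 1), nodeFactor inp.m a (env' .j) * xv a i)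
        (w := fun i => ∑ c ∈ Finset.range (inp.m + 1), nodeFactor inp.m c (env' .k) * yv c i)
        (by simp) (by simp)
        (fun l => by rw [hτ _ (by simp), f1 _ hj])
        (fun l => by rw [hτ _ (by simp), f2 _ hk])
      refine ⟨fun c hc => (i2 c hc).trans (hτ c hc), ?_⟩
      simp only [block, Prog.exec, SExp.eval, jv, kv, eval_nodeAngle, IExp.eval, i1, i3, degs,
        List.append_assoc, squarePoint, gaussNode]
      push_cast
      rfl)
  have hinit : σ₅.out = [] := f3.trans (e3.trans (d3.trans (c3.trans rfl)))
  rw [hinit, List.nil_append] at hout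
  exact hout

end

end SpecDens

namespace SpecDens

/-! ### The Chebyshev vectors in an eigenbasis -/

section

variable {n : ℕ} {u : OrthonormalBasis (Fin n) ℂ (EuclideanSpace ℂ (Fin n))}
  {b : EuclideanSpace ℂ (Fin n)}

/-- The coordinates of the vector obtained from `b` by multiplying its coefficients in the
orthonormal basis `u` by `c`. -/
noncomputable def spectralVec (u : OrthonormalBasis (Fin n) ℂ (EuclideanSpace ℂ (Fin n)))
    (b : EuclideanSpace ℂ (Fin n)) (c : Fin n → ℝ) : Fin n → ℂ :=
  fun i => ∑ l, (c l : ℂ) * inner ℂ (u l) b * (u l) i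

theorem spectralVec_eq_sum_smul (c : Fin n → ℝ) :
    spectralVec u b c = ∑ l, ((c l : ℂ) * inner ℂ (u l) b) • (u l).ofLp := by
  ext i
  simp [spectralVec]

theorem spectralVec_const (r : ℝ) (i : Fin n) : spectralVec u b (fun _ => r) i = r * b i := by
  have h := congrArg (fun v : EuclideanSpace ℂ (Fin n) => v i) (u.sum_repr' b)
  simp only [WithLp.ofLp_sum, Finset.sum_apply, PiLp.smul_apply, smul_eq_mul] at h
  rw [← h, Finset.mul_sum]
  exact Finset.sum_congr rfl fun l _ => mul_assoc _ _ _

/-- Orthonormality leaves only the diagonal terms, so inner products of functions of H and K applied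
to b are integrals against the spectral weights. -/
theorem sum_star_spectralVec_mul (c d : Fin n → ℝ) :
    ∑ i, star (spectralVec u b c i) * spectralVec u b d i =
      ((∑ l, basisWeight u b l * (c l * d l) : ℝ) : ℂ) := by
  have h := u.orthonormal.inner_sum (fun l => (c l : ℂ) * inner ℂ (u l) b)
    (fun l => (d l : ℂ) * inner ℂ (u l) b) Finset.univ
  have hv : ∀ (c : Fin n → ℝ) (i : Fin n),
      (∑ l, ((c l : ℂ) * inner ℂ (u l) b) • u l) i = spectralVec u b c i := fun c i => by
    simp [spectralVec]
  rw [PiLp.inner_apply] at h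
  simp only [hv, RCLike.inner_apply'] at h
  refine h.trans ?_
  push_cast
  refine Finset.sum_congr rfl fun l _ => ?_
  rw [basisWeight, map_mul, Complex.conj_ofReal]
  push_cast
  linear_combination (c l : ℂ) * d l * Complex.conj_mul' (inner ℂ (u l) b)

/-- If B multiplies the l-th coefficient by x_l, the vector recurrence splits into scalar ones. The
factors √2 in the first steps compensate the different normalization of T̃_0. -/
theorem isChebSeq_spectralVec {x : Fin n → ℝ} {B : (Fin n → ℂ) → Fin n → ℂ}
    (hB : ∀ c, B (spectralVec u b c) = spectralVec u b fun l => x l * c l) :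
    IsChebSeq b.ofLp B fun j => spectralVec u b fun l => chebT j (x l) := by
  have hs : √(2 / Real.pi) = √2 * √(1 / Real.pi) := by
    rw [← Real.sqrt_mul zero_le_two, mul_one_div]
  have hs2 : (√2 : ℝ) * √2 = 2 := Real.mul_self_sqrt zero_le_two
  have hadd : ∀ (α β : ℝ) (c d e : Fin n → ℝ) (i : Fin n), (∀ l, e l = α * c l - β * d l) →
      spectralVec u b e i = α * spectralVec u b c i - β * spectralVec u b d i := by
    intro α β c d e i h
    simp only [spectralVec, Finset.mul_sum, ← Finset.sum_sub_distrib]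
    refine Finset.sum_congr rfl fun l _ => ?_
    rw [h]
    push_cast
    ring
  refine ⟨fun i => ?_, fun i => ?_, fun i => ?_, fun j i => ?_⟩
  · simp only [chebT_zero]
    rw [spectralVec_const, Real.sqrt_div zero_le_one, Real.sqrt_one]
    push_cast
    ring
  · rw [hB, hadd (√2) 0 (fun l => x l * chebT 0 (x l)) (fun _ => 0)]
    · simp
    · intro l
      rw [chebT_zero, chebT_one, hs]
      ring
  · rw [hB]
    have h := hadd 2 (√2) (fun l => x l * chebT 1 (x l)) (fun l => chebT 0 (x l))
      (fun l => chebT 2 (x l)) i fun l => by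
        rw [chebT_zero, chebT_one, chebT_two, hs]
        ring
    simpa using h
  · rw [hB]
    have h := hadd 2 1 (fun l => x l * chebT (j + 2) (x l)) (fun l => chebT (j + 1) (x l))
      (fun l => chebT (j + 3) (x l)) i fun l => by
        have hT := congrArg (Polynomial.eval (x l)) (Polynomial.Chebyshev.T_add_two ℝ (j + 1))
        simp only [Polynomial.eval_sub, Polynomial.eval_mul, Polynomial.eval_ofNat,
          Polynomial.eval_X] at hT
        simp only [chebT, Nat.add_eq_zero_iff, OfNat.ofNat_ne_zero, one_ne_zero, and_false,
          if_false]
        push_cast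
        rw [show (j : ℤ) + 3 = j + 1 + 2 by ring, hT, show (j : ℤ) + 1 + 1 = j + 2 by ring]
        ring
    simpa using h

/-- A node vector is the Jackson kernel centered at the node, applied to b as a function of the
matrix. Inner products of node vectors are thus the kernel mixture at the nodes. -/
theorem sum_nodeFactor_mul_spectralVec (m k : ℕ) (x : Fin n → ℝ) (i : Fin n) :
    ∑ a ∈ Finset.range (m + 1), nodeFactor m a k * spectralVec u b (fun l => chebT a (x l)) i =
      spectralVec u b (fun l => jackson m (x l) (gaussNode m k)) i := by
  simp only [spectralVec, nodeFactor, jackson, Finset.mul_sum]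
  rw [Finset.sum_comm]
  refine Finset.sum_congr rfl fun l _ => ?_
  push_cast
  rw [Finset.sum_mul, Finset.sum_mul]
  exact Finset.sum_congr rfl fun a _ => by ring

variable {A : Matrix (Fin n) (Fin n) ℂ} {lam : Fin n → ℂ} {s : ℝ}

theorem IsEigenbasis.mulVec_spectralVec (h : IsEigenbasis A u lam) (c : Fin n → ℝ) (i : Fin n) :
    A.mulVec (spectralVec u b c) i = ∑ l, lam l * ((c l : ℂ) * inner ℂ (u l) b * (u l) i) := by
  rw [spectralVec_eq_sum_smul, Matrix.mulVec_sum, Finset.sum_apply]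
  refine Finset.sum_congr rfl fun l _ => ?_
  rw [Matrix.mulVec_smul, h.mulVec]
  simp only [Pi.smul_apply, smul_eq_mul]
  ring

theorem IsEigenbasis.conjTranspose_mulVec_spectralVec (h : IsEigenbasis A u lam) (c : Fin n → ℝ)
    (i : Fin n) : A.conjTranspose.mulVec (spectralVec u b c) i =
      ∑ l, star (lam l) * ((c l : ℂ) * inner ℂ (u l) b * (u l) i) := by
  rw [spectralVec_eq_sum_smul, Matrix.mulVec_sum, Finset.sum_apply]
  refine Finset.sum_congr rfl fun l _ => ?_
  rw [Matrix.mulVec_smul, h.conjTranspose_mulVec]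
  simp only [Pi.smul_apply, smul_eq_mul]
  ring

theorem IsEigenbasis.isChebSeq_re (h : IsEigenbasis A u lam) (hs : 0 < s) :
    IsChebSeq b.ofLp (fun z l => (A.mulVec z l + A.conjTranspose.mulVec z l) / (2 * s))
      fun j => spectralVec u b fun l => chebT j ((lam l).re / s) := by
  refine isChebSeq_spectralVec fun c => ?_
  have hs' : (s : ℂ) ≠ 0 := by exact_mod_cast hs.ne'
  ext i
  rw [h.mulVec_spectralVec, h.conjTranspose_mulVec_spectralVec, ← Finset.sum_add_distrib,
    Finset.sum_div]
  refine Finset.sum_congr rfl fun l _ => ?_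
  have h2 : lam l + star (lam l) = 2 * (lam l).re := by
    simpa using Complex.add_conj (lam l)
  rw [← add_mul, h2]
  push_cast
  field_simp

theorem IsEigenbasis.isChebSeq_im (h : IsEigenbasis A u lam) (hs : 0 < s) :
    IsChebSeq b.ofLp
      (fun z l => (A.mulVec z l - A.conjTranspose.mulVec z l) / (2 * Complex.I * s))
      fun j => spectralVec u b fun l => chebT j ((lam l).im / s) := by
  refine isChebSeq_spectralVec fun c => ?_
  have hs' : (s : ℂ) ≠ 0 := by exact_mod_cast hs.ne'
  ext i
  rw [h.mulVec_spectralVec, h.conjTranspose_mulVec_spectralVec, ← Finset.sum_sub_distrib,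
    Finset.sum_div]
  refine Finset.sum_congr rfl fun l _ => ?_
  have h2 : lam l - star (lam l) = 2 * (lam l).im * Complex.I := by
    simpa using Complex.sub_conj (lam l)
  rw [← sub_mul, h2]
  push_cast
  field_simp

end

/-! ### The measures represented by the outputs -/

theorem getD_flatMap_range {M N j k : ℕ} (g : ℕ → ℕ → ℂ) (hj : j < N) (hk : k < M) :
    ((List.range N).flatMap fun j => (List.range M).flatMap fun k => [g j k]).getD (j * M + k) 0 =
      g j k := by
  have hlen : ∀ N, ((List.range N).flatMap fun j =>
      (List.range M).flatMap fun k => [g j k]).length = N * M := by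
    intro N
    simp [List.length_flatMap]
  induction N with
  | zero => omega
  | succ N ih =>
    rw [List.range_succ (n := N), List.flatMap_append]
    rcases Nat.lt_succ_iff_lt_or_eq.mp hj with hj | rfl
    · rw [List.getD_append, ih hj]
      rw [hlen]
      nlinarith
    · rw [List.getD_append_right _ _ _ _ (by rw [hlen]; omega), hlen]
      simp [hk, ← List.map_eq_flatMap]

/-- The tail `rest` is kept general so that the lemma can be applied to the inner loop inside the
outer one. -/
theorem atomicMeasure_flatMap_range {F : ℕ → List ℂ} {ν : ℕ → Measure ℂ}
    (h : ∀ i rest, atomicMeasure (F i ++ rest) = ν i + atomicMeasure rest) (N : ℕ)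
    (rest : List ℂ) : atomicMeasure ((List.range N).flatMap F ++ rest) =
      ∑ i ∈ Finset.range N, ν i + atomicMeasure rest := by
  induction N generalizing rest with
  | zero => simp
  | succ N ih =>
    rw [List.range_succ, List.flatMap_append, List.append_assoc, ih, List.flatMap_singleton, h,
      Finset.sum_range_succ, add_assoc]

section

variable {n m : ℕ} {u : OrthonormalBasis (Fin n) ℂ (EuclideanSpace ℂ (Fin n))}
  {A : Matrix (Fin n) (Fin n) ℂ} {lam : Fin n → ℂ} {s : ℝ}

/-- The bridge from the program to analysis: the output coefficients are exactly the damped mixed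
moments of the spectral weights of b, so their polynomial is the kernel mixture. -/
theorem IsEigenbasis.estimate_eq (h : IsEigenbasis A u lam) (hs : 0 < s)
    (b : EuclideanSpace ℂ (Fin n)) :
    estimate ⟨n, m, s, A, b⟩ = kernelMeasure chebWeight s (jacksonMixture m (basisWeight u b)
      (fun l => (lam l).re / s) (fun l => (lam l).im / s)) := by
  rw [estimate, densityMeasure_eq_kernelMeasure]
  congr 1
  ext q
  rw [jacksonMixture_eq, kpmPoly, specDens_out (readsOff_entryH _) (readsOff_entryK _)
    (h.isChebSeq_re hs) (h.isChebSeq_im hs)]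
  refine Finset.sum_congr rfl fun j hj => Finset.sum_congr rfl fun k hk => ?_
  rw [getD_flatMap_range (fun j k => (jacksonCoeff m j : ℂ) * jacksonCoeff m k *
    ∑ i, star (spectralVec u b (fun l => chebT j ((lam l).re / s)) i) *
      spectralVec u b (fun l => chebT k ((lam l).im / s)) i)
    (Finset.mem_range.mp hj) (Finset.mem_range.mp hk), sum_star_spectralVec_mul, mixedMoment,
    ← Complex.ofReal_mul, ← Complex.ofReal_mul, Complex.ofReal_re, mul_assoc]

/-- The atoms are those of the same mixture relative to the product Gauss rule, so the atomic
variant needs no error analysis of its own. -/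
theorem IsEigenbasis.estimateAtomic_eq (h : IsEigenbasis A u lam) (hs : 0 < s)
    (b : EuclideanSpace ℂ (Fin n)) :
    estimateAtomic ⟨n, m, s, A, b⟩ = kernelMeasure (gaussRule m) s
      (jacksonMixture m (basisWeight u b) (fun l => (lam l).re / s) (fun l => (lam l).im / s)) := by
  rw [estimateAtomic, kernelMeasure_gaussRule m s continuous_jacksonMixture,
    specDensAtomic_out (readsOff_entryH _) (readsOff_entryK _) (h.isChebSeq_re hs)
      (h.isChebSeq_im hs), ← List.append_nil (List.flatMap _ _)]
  refine (atomicMeasure_flatMap_range (fun j rest =>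
    atomicMeasure_flatMap_range (ν := fun k => ENNReal.ofReal (Real.pi / (m + 1) *
      (Real.pi / (m + 1)) * jacksonMixture m (basisWeight u b) (fun l => (lam l).re / s)
        (fun l => (lam l).im / s) (gaussNode m j, gaussNode m k)) •
      Measure.dirac (squarePoint s (gaussNode m j, gaussNode m k)))
      (fun k rest => ?_) _ rest) _ _).trans (add_zero _)
  rw [List.cons_append, List.cons_append, List.nil_append, atomicMeasure]
  simp only [sum_nodeFactor_mul_spectralVec]
  rw [sum_star_spectralVec_mul, ← Complex.ofReal_mul, Complex.ofReal_re]
  rfl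

theorem kernelMeasure_gaussRule_compl (s : ℝ) {p : ℝ × ℝ → ℝ} (hp : Continuous p) {S : Finset ℂ}
    (hS : ∀ j < m + 1, ∀ k < m + 1, squarePoint s (gaussNode m j, gaussNode m k) ∈ S) :
    kernelMeasure (gaussRule m) s p (S : Set ℂ)ᶜ = 0 := by
  rw [kernelMeasure_gaussRule m s hp, Measure.finsetSum_apply]
  refine Finset.sum_eq_zero fun j hj => ?_
  rw [Measure.finsetSum_apply]
  refine Finset.sum_eq_zero fun k hk => ?_
  rw [Measure.smul_apply, Measure.dirac_apply' _ (Finset.measurableSet S).compl,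
    Set.indicator_of_notMem, smul_zero]
  rw [Set.mem_compl_iff, not_not]
  exact hS j (Finset.mem_range.mp hj) k (Finset.mem_range.mp hk)

end

end SpecDens

/-- For a normal matrix `A` and a scale `s ≥ ‖A‖` the algorithm is run on `A / s` and its output
is scaled back by `s`; the choice `s = ‖A‖` gives the bound on the error relative to `‖A‖`. -/
theorem theorem1 :
    ∃ C : ℝ, 0 < C ∧
      ∀ (n m : ℕ), 1 ≤ n → 1 ≤ m →
      ∀ (A : Matrix (Fin n) (Fin n) ℂ), IsStarNormal A →
      ∀ s : ℝ, 0 < s → SpecDens.specNorm A ≤ s →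
        -- for every value of the random vector: probability measures, resources, atoms
        (∀ b : Metric.sphere (0 : EuclideanSpace ℂ (Fin n)) 1,
          (IsProbabilityMeasure (SpecDens.estimate ⟨n, m, s, A, b.1⟩) ∧
            SpecDens.estimate ⟨n, m, s, A, b.1⟩ (SpecDens.square s)ᶜ = 0 ∧
            SpecDens.WithinBudget C n m (SpecDens.specDens.run ⟨n, m, s, A, b.1⟩)) ∧
          (IsProbabilityMeasure (SpecDens.estimateAtomic ⟨n, m, s, A, b.1⟩) ∧
            SpecDens.estimateAtomic ⟨n, m, s, A, b.1⟩ (SpecDens.square s)ᶜ = 0 ∧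
            SpecDens.WithinBudget C n m (SpecDens.specDensAtomic.run ⟨n, m, s, A, b.1⟩) ∧
            ∃ S : Finset ℂ, (S.card : ℝ) ≤ C * m ^ 2 ∧
              SpecDens.estimateAtomic ⟨n, m, s, A, b.1⟩ (S : Set ℂ)ᶜ = 0)) ∧
        -- the error bound fails with probability at most `δ` over `b`
        (∀ δ : ℝ, 0 < δ → δ < 1 →
          SpecDens.unifSphere n {b | ¬ SpecDens.earthMover (SpecDens.spectralDensity A)
              (SpecDens.estimate ⟨n, m, s, A, b.1⟩) / ENNReal.ofReal s ≤
            ENNReal.ofReal (SpecDens.errorBound C n m δ)} ≤ ENNReal.ofReal δ ∧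
          SpecDens.unifSphere n {b | ¬ SpecDens.earthMover (SpecDens.spectralDensity A)
              (SpecDens.estimateAtomic ⟨n, m, s, A, b.1⟩) / ENNReal.ofReal s ≤
            ENNReal.ofReal (SpecDens.errorBound C n m δ)} ≤ ENNReal.ofReal δ) := by
  -- The size of the constant comes from the step counts; the error bound needs 400 and the number
  -- of atoms only 4.
  refine ⟨5000, by norm_num, fun n m hn hm A hA s hs hAs => ?_⟩
  obtain ⟨u, lam, h⟩ := SpecDens.exists_isEigenbasis hA
  have hd := SpecDens.isChebQuad_chebWeight m
  have hg := SpecDens.isChebQuad_gaussRule m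
  refine ⟨fun b => ⟨⟨?_, ?_, ?_⟩, ?_, ?_, ?_, ?_⟩, fun δ hδ hδ1 => ⟨?_, ?_⟩⟩
  · rw [h.estimate_eq hs]
    exact SpecDens.isProbabilityMeasure_kernelMeasure hd (h.isWeighted hs hAs b) s
  · rw [h.estimate_eq hs]
    exact SpecDens.kernelMeasure_compl_square hd hs.le _
  · exact SpecDens.withinBudget_specDens hn hm
  · rw [h.estimateAtomic_eq hs]
    exact SpecDens.isProbabilityMeasure_kernelMeasure hg (h.isWeighted hs hAs b) s
  · rw [h.estimateAtomic_eq hs]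
    exact SpecDens.kernelMeasure_compl_square hg hs.le _
  · exact SpecDens.withinBudget_specDensAtomic hn hm
  · refine ⟨(Finset.range (m + 1) ×ˢ Finset.range (m + 1)).image fun q : ℕ × ℕ =>
      SpecDens.squarePoint s (SpecDens.gaussNode m q.1, SpecDens.gaussNode m q.2), ?_, ?_⟩
    · refine (Nat.cast_le.mpr Finset.card_image_le).trans ?_
      have hm' : (1 : ℝ) ≤ m := by exact_mod_cast hm
      rw [Finset.card_product, Finset.card_range]
      push_cast
      nlinarith
    · rw [h.estimateAtomic_eq hs]
      refine SpecDens.kernelMeasure_gaussRule_compl s SpecDens.continuous_jacksonMixture ?_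
      intro j hj k hk
      exact Finset.mem_image.mpr ⟨(j, k), by simp [hj, hk], rfl⟩
  · exact h.unifSphere_error_le hn hm hs hAs hd (fun b => h.estimate_eq hs b.1) (by norm_num) hδ hδ1
  · exact h.unifSphere_error_le hn hm hs hAs hg (fun b => h.estimateAtomic_eq hs b.1) (by norm_num)
      hδ hδ1
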